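/- \textbf{Theorem.} In the problem \textsc{Partial Cycle Cover}, one is given a finite simple graph $G=(V,E)$ and numbers $k,\ell\in\mathbb{N}$, and asks whether exactly $\ell$ vertices of $G$ can be covered with at most $k$ vertex-disjoint cycles, i.e., whether there is a set $C\subseteq E$ such that every vertex of $(V,C)$ has degree $0$ or $2$, exactly $\ell$ vertices have degree $2$, and the edges of $C$ form at most $k$ cycles. There is a randomized algorithm (a probabilistic random access machine with logarithmic cost that can toss fair coins) that, given a bipartite graph $G$ on $n$ vertices, numbers $k,\ell\in\mathbb{N}$ (in binary), and an elimination forest $\mathcal{T}$ of depth $\tau$ for $G$, solves \textsc{Partial Cycle Cover} in $4^{\tau}n^{\mathcal{O}(1)}$ time and polynomial space. More precisely, there are constants $A,c$ such that, for all outcomes of the coin tosses, it halts after time at most $A\cdot 4^{\tau}(n+1)^{c}+A(|k|+|\ell|)$ and uses space at most $A(n+1)^{c}+A(|k|+|\ell|)$, where $|k|,|\ell|$ are the binary lengths of $k$ and $\ell$ (this term only accounts for reading and storing the two numbers). The algorithm makes no false positives: on a no-instance it answers no for all outcomes of the coin tosses. It may make a false negative with probability at most $\frac12$: on a yes-instance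 it answers no with probability at most $\frac12$. Here an elimination forest for $G=(V,E)$ is a rooted forest on the vertex set $V$ such that for each edge $\{u,v\}\in E$ one of $u,v$ is an ancestor of the other; its depth is the largest number of vertices on a path from a root to a leaf. -/

import Mathlib

namespace PartialCycleCover

/-! ### Rooted forests and elimination forests -/

/-- A rooted forest on the vertex set `V`: every node has at most one parent (roots have none), and
no node is a proper ancestor of itself. -/
structure RootedForest (V : Type) where
  parent : V → Option V
  acyclic : ∀ v : V, ¬ Relation.TransGen (fun a b => parent b = some a) v v

namespace RootedForest

/-- `T.Ancestor u v`: the node `u` is an ancestor of `v` (every node is an ancestor of itself). -/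
def Ancestor {V : Type} (T : RootedForest V) (u v : V) : Prop :=
  Relation.ReflTransGen (fun a b => T.parent b = some a) u v

/-- The set of ancestors of `v`, including `v`; these are the nodes of the path from the root of
the tree of `v` to `v`. -/
def tail {V : Type} (T : RootedForest V) (v : V) : Set V := {u | T.Ancestor u v}

/-- The depth of a rooted forest: the largest number of vertices on a path from a root to a node
(equivalently, from a root to a leaf). -/
noncomputable def depth {V : Type} [Fintype V] (T : RootedForest V) : ℕ :=
  Finset.univ.sup fun v => (T.tail v).ncard

/-- `T` is an elimination forest for `G`: the endpoints of every edge of `G` are in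
ancestor-descendant relation in `T`. -/
def IsEliminationForest {V : Type} (T : RootedForest V) (G : SimpleGraph V) : Prop :=
  ∀ u v : V, G.Adj u v → T.Ancestor u v ∨ T.Ancestor v u

end RootedForest

/-! ### Partial cycle covers -/

/-- A partial cycle cover in `G = (V, E)`: a set `C ⊆ E` of edges such that each vertex of `(V, C)`
has degree zero or two. -/
def IsPartialCycleCover {V : Type} (G : SimpleGraph V) (C : Set (Sym2 V)) : Prop :=
  C ⊆ G.edgeSet ∧
    ∀ v : V, ((SimpleGraph.fromEdgeSet C).neighborSet v).ncard = 0 ∨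
      ((SimpleGraph.fromEdgeSet C).neighborSet v).ncard = 2

/-- The vertices covered by `C`, i.e. the endpoints of the edges in `C`. -/
def coveredVertices {V : Type} (C : Set (Sym2 V)) : Set V := {v | ∃ e ∈ C, v ∈ e}

/-- The number of cycles of a partial cycle cover `C`: the number of connected components of
`(V, C)` that consist of more than one vertex. -/
noncomputable def numCycles {V : Type} (C : Set (Sym2 V)) : ℕ :=
  {K : (SimpleGraph.fromEdgeSet C).ConnectedComponent | K.supp.Nontrivial}.ncard

/-- The yes-instances `(G, k, ℓ)` of the problem Partial Cycle Cover: exactly `ℓ` vertices of `G`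
can be covered with at most `k` vertex-disjoint cycles. -/
def HasPartialCycleCover {V : Type} (G : SimpleGraph V) (k ℓ : ℕ) : Prop :=
  ∃ C : Set (Sym2 V), IsPartialCycleCover G C ∧ numCycles C ≤ k ∧ (coveredVertices C).ncard = ℓ

/-! ### The machine model

A probabilistic random access machine with logarithmic cost, programmed in a structured way. The
memory consists of cells that hold natural numbers of arbitrary size. A cell is addressed by a pair
`(a, i)`: the first component is a fixed name in the program text, the second may be computed at run
time, so a name `a` stands for an array with indirect addressing. Only finitely many cells are
nonzero at any time. -/

/-- Memory contents. -/
abbrev Memory := ℕ × ℕ →₀ ℕ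

/-- Space occupied by the memory: for each nonzero cell, the bit lengths of its address and of its
contents. -/
noncomputable def Memory.bits (M : Memory) : ℕ :=
  M.sum fun p x => Nat.size p.1 + Nat.size p.2 + Nat.size x

/-- The arithmetic instructions; subtraction is truncated at zero, division rounds down (and
division by zero gives zero). -/
inductive ArithOp
  | add
  | sub
  | mul
  | div

def ArithOp.apply : ArithOp → ℕ → ℕ → ℕ
  | .add, x, y => x + y
  | .sub, x, y => x - y
  | .mul, x, y => x * y
  | .div, x, y => x / y

/-- Arithmetic expressions: constants, the cell `(a, i)` for an expression `i`, and the results of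
arithmetic instructions. -/
inductive Expr
  | const (x : ℕ)
  | cell (a : ℕ) (i : Expr)
  | arith (o : ArithOp) (e f : Expr)

/-- The value of an expression. -/
def Expr.val (M : Memory) : Expr → ℕ
  | .const x => x
  | .cell a i => M (a, i.val M)
  | .arith o e f => o.apply (e.val M) (f.val M)

/-- The logarithmic cost of evaluating an expression: each node costs one plus the bit length of
its value; accessing the cell `(a, i)` moreover costs the bit length of `a` (and that of the value
of `i`, which is charged at the node `i`). The cost is also an upper bound on the number of
bits of all intermediate results together. -/
def Expr.cost (M : Memory) : Expr → ℕ
  | .const x => 1 + Nat.size x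
  | .cell a i => i.cost M + (1 + Nat.size a + Nat.size (M (a, i.val M)))
  | .arith o e f => e.cost M + f.cost M + (1 + Nat.size (o.apply (e.val M) (f.val M)))

/-- Programs. -/
inductive Prog
  /-- do nothing -/
  | nop
  /-- store the value of `e` in the cell `(a, i)` -/
  | assign (a : ℕ) (i e : Expr)
  /-- toss a fair coin and store the outcome, `0` or `1`, in the cell `(a, i)` -/
  | toss (a : ℕ) (i : Expr)
  /-- execute `p`, then `q` -/
  | seq (p q : Prog)
  /-- if the value of `e` is nonzero then execute `p`, otherwise execute `q` -/
  | branch (e : Expr) (p q : Prog)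
  /-- as long as the value of `e` is nonzero, execute `p` -/
  | loop (e : Expr) (p : Prog)

/-- A state of a run: the memory and the number of coins tossed so far. -/
structure State where
  mem : Memory
  tossed : ℕ

/-- `Exec ω p s t m s'`: if the outcomes of the coin tosses are given by the sequence `ω`, then the
program `p`, started in the state `s`, halts in the state `s'` after time `t`, and uses space `m`,
where `m` is the maximum over the run of the space occupied by the memory plus the space for
evaluating the current instruction. -/
inductive Exec (ω : ℕ → Bool) : Prog → State → ℕ → ℕ → State → Prop
  | nop (s : State) : Exec ω .nop s 1 (s.mem.bits + 1) s
  | assign (s : State) (a : ℕ) (i e : Expr) :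
      Exec ω (.assign a i e) s
        (1 + Nat.size a + i.cost s.mem + e.cost s.mem)
        (s.mem.bits + (1 + Nat.size a + i.cost s.mem + e.cost s.mem))
        ⟨s.mem.update (a, i.val s.mem) (e.val s.mem), s.tossed⟩
  | toss (s : State) (a : ℕ) (i : Expr) :
      Exec ω (.toss a i) s
        (1 + Nat.size a + i.cost s.mem)
        (s.mem.bits + (1 + Nat.size a + i.cost s.mem))
        ⟨s.mem.update (a, i.val s.mem) (ω s.tossed).toNat, s.tossed + 1⟩
  | seq {p q : Prog} {s s' s'' : State} {t t' m m' : ℕ} :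
      Exec ω p s t m s' → Exec ω q s' t' m' s'' →
      Exec ω (.seq p q) s (t + t') (max m m') s''
  | branch_true {e : Expr} {p q : Prog} {s s' : State} {t m : ℕ} :
      e.val s.mem ≠ 0 → Exec ω p s t m s' →
      Exec ω (.branch e p q) s (1 + e.cost s.mem + t)
        (max (s.mem.bits + (1 + e.cost s.mem)) m) s'
  | branch_false {e : Expr} {p q : Prog} {s s' : State} {t m : ℕ} :
      e.val s.mem = 0 → Exec ω q s t m s' →
      Exec ω (.branch e p q) s (1 + e.cost s.mem + t)
        (max (s.mem.bits + (1 + e.cost s.mem)) m) s'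
  | loop_done {e : Expr} {p : Prog} {s : State} :
      e.val s.mem = 0 →
      Exec ω (.loop e p) s (1 + e.cost s.mem) (s.mem.bits + (1 + e.cost s.mem)) s
  | loop_step {e : Expr} {p : Prog} {s s' s'' : State} {t t' m m' : ℕ} :
      e.val s.mem ≠ 0 → Exec ω p s t m s' → Exec ω (.loop e p) s' t' m' s'' →
      Exec ω (.loop e p) s (1 + e.cost s.mem + (t + t'))
        (max (s.mem.bits + (1 + e.cost s.mem)) (max m m')) s''

/-- The started machine for the input `(G, T, k, ℓ)`, with `V(G) = {0, …, n - 1}`: the cells `(0, 0)`,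
`(0, 1)`, `(0, 2)` hold `n`, `k`, `ℓ`, array `1` is the adjacency matrix of `G`, row by row, and
array `2` is the list of parents in `T` (where `0` says that the node is a root, and `u + 1` that
its parent is `u`). All other cells are zero, and no coin has been tossed. -/
noncomputable def initialState {n : ℕ} (G : SimpleGraph (Fin n)) (T : RootedForest (Fin n))
    (k ℓ : ℕ) : State where
  mem :=
    Finsupp.single (0, 0) n + Finsupp.single (0, 1) k + Finsupp.single (0, 2) ℓ
      + (open Classical in
          ∑ u : Fin n, ∑ v : Fin n,
            Finsupp.single (1, u.val * n + v.val) (if G.Adj u v then 1 else 0))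
      + ∑ v : Fin n,
          Finsupp.single (2, v.val) ((T.parent v).elim 0 fun u : Fin n => u.val + 1)
  tossed := 0

/-- With coin tosses `ω`, the program `P` halts on the start state `s` and answers yes, i.e. leaves
`1` in the cell `(0, 0)`. -/
def AnswersYes (P : Prog) (s : State) (ω : ℕ → Bool) : Prop :=
  ∃ (t m : ℕ) (s' : State), Exec ω P s t m s' ∧ s'.mem (0, 0) = 1

/-- The distribution of an infinite sequence of independent tosses of a fair coin. -/
noncomputable def coinMeasure : MeasureTheory.Measure (ℕ → Bool) :=
  MeasureTheory.Measure.infinitePi fun _ : ℕ => (PMF.uniformOfFintype Bool).toMeasure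

end PartialCycleCover

set_option linter.unusedSectionVars false

namespace PartialCycleCover

/-! ### Determinism of the machine -/

/-! A bipartite graph with all degrees zero or two consists of isolated vertices and even cycles,
and each cycle has exactly two alternating colourings of its edges with two colours. So a partial
cycle cover with `c` cycles carries `2 ^ c` alternating colourings (`exists_alternatingColouring`,
`card_alternatingColouring`), and a count of coloured covers modulo `2 ^ (k + 1)` does not see
covers with more than `k` cycles. A nonzero residue therefore proves that a solution exists, which
excludes false positives. To keep solutions from cancelling each other, edges get random weights and
the count is refined by total weight. By the isolation lemma (`coinMeasure_not_isolating_le`), with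
probability at least one half the lightest solution is unique; in its weight class the count is `2 ^
c` with `c ≤ k` plus a multiple of `2 ^ (k + 1)`, hence nonzero (`accepts_of_isolating`).

To count, colour each edge with 1, 2 or nothing and require only that every vertex meets both
colours or neither. By a degree count, such a colouring touches as many vertices as it has coloured
edges exactly when it is alternating (`balanced_and_card_iff`). Inclusion-exclusion with four states
per vertex (`sum_assignments_eq`) turns the generating function of these colourings into a sum over
assignments of a product of local factors, where the factor of a vertex depends only on the states
of its ancestors in the elimination forest. The sum then factors over sibling subtrees
(`RootedForest.treeSum_eq`), and a depth-first search with a constant number of cells per node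
evaluates it; four branches per level give the factor `4 ^ τ`.

The variables marking vertices, edges and weights are replaced by widely spaced powers of `radix n`.
There are fewer colourings than the radix, so no carries occur and each desired count is a digit of
the result (`digit_resultValue`). The result is below `modulus n`, so arithmetic modulo that number
is exact and takes care of negative signs. All numbers have at most `cellBound n` bits, polynomially
many, and `Run` converts bounds on the number of instructions into bounds on logarithmic cost. -/

theorem Exec.deterministic {ω : ℕ → Bool} {p : Prog} {s s₁ : State} {t₁ m₁ : ℕ}
    (h₁ : Exec ω p s t₁ m₁ s₁) :
    ∀ {t₂ m₂ : ℕ} {s₂ : State}, Exec ω p s t₂ m₂ s₂ → s₁ = s₂ := by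
  induction h₁ with
  | nop | assign | toss => intro t₂ m₂ s₂ h; cases h; rfl
  | seq _ _ ih₁ ih₂ =>
    intro t₂ m₂ s₂ h
    cases h with
    | seq h h' => obtain rfl := ih₁ h; exact ih₂ h'
  | branch_true hc _ ih =>
    intro t₂ m₂ s₂ h
    cases h with
    | branch_true _ h => exact ih h
    | branch_false hc' _ => exact absurd hc' hc
  | branch_false hc _ ih =>
    intro t₂ m₂ s₂ h
    cases h with
    | branch_true hc' _ => exact absurd hc hc'
    | branch_false _ h => exact ih h
  | loop_done hc =>
    intro t₂ m₂ s₂ h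
    cases h with
    | loop_done => rfl
    | loop_step hc' => exact absurd hc hc'
  | loop_step hc _ _ ih₁ ih₂ =>
    intro t₂ m₂ s₂ h
    cases h with
    | loop_done hc' => exact absurd hc' hc
    | loop_step _ h h' => obtain rfl := ih₁ h; exact ih₂ h'

/-! ### Bounded memories and the cost of programs on them -/

/-- All nonzero cells have a small name, an index below `D` and at most `D` bits. -/
def Bdd (D : ℕ) (M : Memory) : Prop :=
  ∀ a i, M (a, i) ≠ 0 → a < 16 ∧ i < D ∧ M (a, i) < 2 ^ D

theorem Bdd.size_le {D : ℕ} {M : Memory} (h : Bdd D M) (a i : ℕ) : Nat.size (M (a, i)) ≤ D := by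
  by_cases h0 : M (a, i) = 0
  · simp [h0]
  · exact Nat.size_le.2 (h a i h0).2.2

theorem Bdd.update {D : ℕ} {M : Memory} (h : Bdd D M) {a i x : ℕ} (ha : a < 16) (hi : i < D)
    (hx : x < 2 ^ D) : Bdd D (M.update (a, i) x) := by
  intro b j hb
  rw [Finsupp.coe_update, Function.update_apply] at hb ⊢
  split_ifs at hb ⊢ with hp
  · obtain ⟨rfl, rfl⟩ := Prod.mk.inj hp
    exact ⟨ha, hi, hx⟩
  · exact h b j hb

/-- An upper bound for the space occupied by a bounded memory. -/
def spaceBound (D : ℕ) : ℕ := 16 * D * (5 + D + D)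

theorem Bdd.bits_le {D : ℕ} {M : Memory} (h : Bdd D M) : M.bits ≤ spaceBound D := by
  have hsub : M.support ⊆ Finset.range 16 ×ˢ Finset.range D := by
    rintro ⟨a, i⟩ hp
    have := h a i (Finsupp.mem_support_iff.1 hp)
    simp [this.1, this.2.1]
  have hterm : ∀ p ∈ M.support, Nat.size p.1 + Nat.size p.2 + Nat.size (M p) ≤ 5 + D + D := by
    rintro ⟨a, i⟩ hp
    obtain ⟨h1, h2, -⟩ := h a i (Finsupp.mem_support_iff.1 hp)
    -- Names below 16 fit into five bits with room to spare.
    have h4 : Nat.size a ≤ 5 := Nat.size_le.2 (h1.trans (by norm_num))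
    have h5 : Nat.size i ≤ D := Nat.size_le.2 (h2.trans Nat.lt_two_pow_self)
    have h6 := h.size_le a i
    simp only
    omega
  calc M.bits ≤ M.support.card • (5 + D + D) := Finset.sum_le_card_nsmul _ _ _ hterm
    _ ≤ spaceBound D := by
      have := Finset.card_le_card hsub
      simp only [Finset.card_product, Finset.card_range] at this
      rw [smul_eq_mul, spaceBound]
      gcongr

/-- Memories with different supports become comparable once both sums run over one finite set of
cells. -/
theorem Memory.bits_eq_sum {M : Memory} {S : Finset (ℕ × ℕ)} (hS : M.support ⊆ S) :
    M.bits = ∑ q ∈ S, if M q = 0 then 0 else Nat.size q.1 + Nat.size q.2 + Nat.size (M q) := by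
  rw [Memory.bits, Finsupp.sum, ← Finset.sum_subset hS]
  · refine Finset.sum_congr rfl fun q hq => ?_
    rw [if_neg (Finsupp.mem_support_iff.1 hq)]
  · intro q _ hq
    rw [if_pos (Finsupp.notMem_support_iff.1 hq)]

/-- For the instructions before the truncation of `k` and `ℓ`, when the contents have no bound `Bdd`
yet. The bits of the overwritten value are not subtracted. -/
theorem Memory.bits_update_le (M : Memory) (p : ℕ × ℕ) (x : ℕ) :
    Memory.bits (M.update p x)
      ≤ M.bits + (Nat.size p.1 + Nat.size p.2 + Nat.size x) := by
  classical
  have hsub : (M.update p x).support ⊆ insert p M.support := by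
    intro q hq
    by_cases hqp : q = p
    · simp [hqp]
    · simpa [hqp] using hq
  rw [Memory.bits_eq_sum hsub, Memory.bits_eq_sum (Finset.subset_insert p M.support)]
  calc _ ≤ ∑ q ∈ insert p M.support,
        ((if M q = 0 then 0 else Nat.size q.1 + Nat.size q.2 + Nat.size (M q))
          + if q = p then Nat.size p.1 + Nat.size p.2 + Nat.size x else 0) := by
        refine Finset.sum_le_sum fun q _ => ?_
        by_cases hqp : q = p
        · subst hqp
          simp only [Finsupp.coe_update, Function.update_self, if_true]
          split_ifs <;> omega
        · simp [hqp]
    _ = _ := by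
        rw [Finset.sum_add_distrib, Finset.sum_ite_eq' _ p, if_pos (Finset.mem_insert_self _ _)]

/-- Weight of an expression: on memories with `D`-bit cells its value has at most
`e.valWeight * D` bits. -/
def Expr.valWeight : Expr → ℕ
  | .const x => Nat.size x
  | .cell _ _ => 1
  | .arith _ e f => e.valWeight + f.valWeight + 1

/-- Weight of an expression: on memories with `D`-bit cells its cost is at most
`e.costWeight * D`. -/
def Expr.costWeight : Expr → ℕ
  | .const x => 1 + Nat.size x
  | .cell a i => i.costWeight + (1 + Nat.size a + 1)
  | .arith _ e f => e.costWeight + f.costWeight + (1 + (e.valWeight + f.valWeight + 1))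

theorem ArithOp.size_apply_le (o : ArithOp) (x y : ℕ) :
    Nat.size (o.apply x y) ≤ Nat.size x + Nat.size y + 1 := by
  have hx := Nat.lt_size_self x
  have hy := Nat.lt_size_self y
  have hx1 : 2 ^ Nat.size x ≤ 2 ^ (Nat.size x + Nat.size y) :=
    Nat.pow_le_pow_right (by norm_num) (by omega)
  have hy1 : 2 ^ Nat.size y ≤ 2 ^ (Nat.size x + Nat.size y) :=
    Nat.pow_le_pow_right (by norm_num) (by omega)
  have h2 : 2 ^ (Nat.size x + Nat.size y + 1) = 2 * 2 ^ (Nat.size x + Nat.size y) := by ring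
  rw [Nat.size_le, h2]
  cases o with
  | add => simp only [ArithOp.apply]; omega
  | sub => simp only [ArithOp.apply]; omega
  | mul =>
    simp only [ArithOp.apply]
    have : x * y < 2 ^ Nat.size x * 2 ^ Nat.size y :=
      Nat.mul_lt_mul_of_lt_of_lt hx hy
    rw [← pow_add] at this
    omega
  | div =>
    simp only [ArithOp.apply]
    have := Nat.div_le_self x y
    omega

theorem Expr.size_val_le {D : ℕ} (hD : 1 ≤ D) {M : Memory} (h : Bdd D M) (e : Expr) :
    Nat.size (e.val M) ≤ e.valWeight * D := by
  induction e with
  | const x => exact Nat.le_mul_of_pos_right _ hD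
  | cell a i ih => simpa [Expr.val, Expr.valWeight] using h.size_le a _
  | arith o e f ihe ihf =>
    have := o.size_apply_le (e.val M) (f.val M)
    simp only [Expr.val, Expr.valWeight, add_mul, one_mul]
    omega

theorem Expr.cost_le {D : ℕ} (hD : 1 ≤ D) {M : Memory} (h : Bdd D M) (e : Expr) :
    e.cost M ≤ e.costWeight * D := by
  induction e with
  | const x => exact Nat.le_mul_of_pos_right _ hD
  | cell a i ih =>
    have h1 := h.size_le a (i.val M)
    have h2 : Nat.size a ≤ Nat.size a * D := Nat.le_mul_of_pos_right _ hD
    simp only [Expr.cost, Expr.costWeight, add_mul, one_mul]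
    omega
  | arith o e f ihe ihf =>
    have h1 := (Expr.arith o e f).size_val_le hD h
    simp only [Expr.val, Expr.valWeight, add_mul, one_mul] at h1
    simp only [Expr.cost, Expr.costWeight, add_mul, one_mul]
    omega

/-- Weight of a program: the cost of one instruction on memories with `D`-bit cells is at most
`p.weight * D`. -/
def Prog.weight : Prog → ℕ
  | .nop => 1
  | .assign a i e => 1 + Nat.size a + i.costWeight + e.costWeight
  | .toss a i => 1 + Nat.size a + i.costWeight
  | .seq p q => p.weight + q.weight
  | .branch e p q => 1 + e.costWeight + p.weight + q.weight
  | .loop e p => 1 + e.costWeight + p.weight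

/-- With coin tosses `ω`, the program `p` leads from `s` to `s'` in at most `N` instructions, with
the cost to be expected on `D`-bounded memories. -/
def Run (ω : ℕ → Bool) (D : ℕ) (p : Prog) (s : State) (N : ℕ) (s' : State) : Prop :=
  ∃ t m, Exec ω p s t m s' ∧ t ≤ p.weight * D * N ∧ m ≤ spaceBound D + p.weight * D

/-! ### Cost rules for the program constructs on bounded memories. -/

section Run

variable {ω : ℕ → Bool} {D : ℕ} {s s' s'' : State} {N N' : ℕ} {p q : Prog} {e : Expr}

theorem Run.mono (h : Run ω D p s N s') (hN : N ≤ N') : Run ω D p s N' s' := by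
  obtain ⟨t, m, h, ht, hm⟩ := h
  exact ⟨t, m, h, ht.trans (by gcongr), hm⟩

theorem Run.nop (hD : 1 ≤ D) (h : Bdd D s.mem) : Run ω D .nop s 1 s := by
  refine ⟨_, _, .nop s, ?_, ?_⟩
  · simpa [Prog.weight] using hD
  · have := h.bits_le
    simp only [Prog.weight]
    omega

theorem Run.assign (hD : 1 ≤ D) (h : Bdd D s.mem) (a : ℕ) (i e : Expr) :
    Run ω D (.assign a i e) s 1 ⟨s.mem.update (a, i.val s.mem) (e.val s.mem), s.tossed⟩ := by
  have hb := h.bits_le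
  have h1 := i.cost_le hD h
  have h2 := e.cost_le hD h
  have h3 : Nat.size a ≤ Nat.size a * D := Nat.le_mul_of_pos_right _ hD
  refine ⟨_, _, .assign s a i e, ?_, ?_⟩ <;>
    · simp only [Prog.weight, add_mul, one_mul, mul_one]
      omega

theorem Run.toss (hD : 1 ≤ D) (h : Bdd D s.mem) (a : ℕ) (i : Expr) :
    Run ω D (.toss a i) s 1
      ⟨s.mem.update (a, i.val s.mem) (ω s.tossed).toNat, s.tossed + 1⟩ := by
  have hb := h.bits_le
  have h1 := i.cost_le hD h
  have h3 : Nat.size a ≤ Nat.size a * D := Nat.le_mul_of_pos_right _ hD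
  refine ⟨_, _, .toss s a i, ?_, ?_⟩ <;>
    · simp only [Prog.weight, add_mul, one_mul, mul_one]
      omega

theorem Run.seq (h : Run ω D p s N s') (h' : Run ω D q s' N' s'') :
    Run ω D (.seq p q) s (N + N') s'' := by
  obtain ⟨t, m, h, ht, hm⟩ := h
  obtain ⟨t', m', h', ht', hm'⟩ := h'
  refine ⟨_, _, .seq h h', ?_, ?_⟩
  · calc t + t' ≤ p.weight * D * N + q.weight * D * N' := add_le_add ht ht'
      _ ≤ (p.weight + q.weight) * D * N + (p.weight + q.weight) * D * N' := by
        gcongr <;> omega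
      _ = _ := by simp only [Prog.weight]; ring
  · simp only [Prog.weight, add_mul]
    omega

theorem Run.branch_true (hD : 1 ≤ D) (hb : Bdd D s.mem) (he : e.val s.mem ≠ 0)
    (h : Run ω D p s N s') : Run ω D (.branch e p q) s (N + 1) s' := by
  obtain ⟨t, m, h, ht, hm⟩ := h
  have h1 := e.cost_le hD hb
  have h2 := hb.bits_le
  refine ⟨_, _, .branch_true he h, ?_, ?_⟩
  · calc 1 + e.cost s.mem + t ≤ (1 + e.costWeight) * D + p.weight * D * N := by
          simp only [add_mul, one_mul]; omega
      _ ≤ (Prog.branch e p q).weight * D + (Prog.branch e p q).weight * D * N := by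
          have hw : (Prog.branch e p q).weight = 1 + e.costWeight + p.weight + q.weight := rfl
          exact add_le_add (Nat.mul_le_mul_right _ (by omega))
            (Nat.mul_le_mul_right _ (Nat.mul_le_mul_right _ (by omega)))
      _ = _ := by ring
  · simp only [Prog.weight, add_mul, one_mul]
    omega

theorem Run.branch_false (hD : 1 ≤ D) (hb : Bdd D s.mem) (he : e.val s.mem = 0)
    (h : Run ω D q s N s') : Run ω D (.branch e p q) s (N + 1) s' := by
  obtain ⟨t, m, h, ht, hm⟩ := h
  have h1 := e.cost_le hD hb
  have h2 := hb.bits_le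
  refine ⟨_, _, .branch_false he h, ?_, ?_⟩
  · calc 1 + e.cost s.mem + t ≤ (1 + e.costWeight) * D + q.weight * D * N := by
          simp only [add_mul, one_mul]; omega
      _ ≤ (Prog.branch e p q).weight * D + (Prog.branch e p q).weight * D * N := by
          have hw : (Prog.branch e p q).weight = 1 + e.costWeight + p.weight + q.weight := rfl
          exact add_le_add (Nat.mul_le_mul_right _ (by omega))
            (Nat.mul_le_mul_right _ (Nat.mul_le_mul_right _ (by omega)))
      _ = _ := by ring
  · simp only [Prog.weight, add_mul, one_mul]
    omega

theorem Run.loop_done (hD : 1 ≤ D) (hb : Bdd D s.mem) (he : e.val s.mem = 0) :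
    Run ω D (.loop e p) s 1 s := by
  have h1 := e.cost_le hD hb
  have h2 := hb.bits_le
  refine ⟨_, _, .loop_done he, ?_, ?_⟩ <;>
    · simp only [Prog.weight, add_mul, one_mul, mul_one]
      omega

theorem Run.loop_step (hD : 1 ≤ D) (hb : Bdd D s.mem) (he : e.val s.mem ≠ 0)
    (h : Run ω D p s N s') (h' : Run ω D (.loop e p) s' N' s'') :
    Run ω D (.loop e p) s (N + 1 + N') s'' := by
  obtain ⟨t, m, h, ht, hm⟩ := h
  obtain ⟨t', m', h', ht', hm'⟩ := h'
  have h1 := e.cost_le hD hb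
  have h2 := hb.bits_le
  refine ⟨_, _, .loop_step he h h', ?_, ?_⟩
  · calc 1 + e.cost s.mem + (t + t')
        ≤ (1 + e.costWeight) * D + (p.weight * D * N + (Prog.loop e p).weight * D * N') := by
          simp only [add_mul, one_mul]; omega
      _ ≤ (Prog.loop e p).weight * D + ((Prog.loop e p).weight * D * N
          + (Prog.loop e p).weight * D * N') := by
          have hw : (Prog.loop e p).weight = 1 + e.costWeight + p.weight := rfl
          exact add_le_add (Nat.mul_le_mul_right _ (by omega))
            (Nat.add_le_add_right
              (Nat.mul_le_mul_right _ (Nat.mul_le_mul_right _ (by omega))) _)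
      _ = _ := by ring
  · simp only [Prog.weight, add_mul, one_mul] at hm' ⊢
    omega

/-- A loop that maintains an invariant and ends after exactly `L` rounds. -/
theorem Run.loop_invariant (hD : 1 ≤ D) (Inv : ℕ → State → Prop) {L K : ℕ}
    (hB : ∀ j ≤ L, ∀ s, Inv j s → Bdd D s.mem)
    (hstep : ∀ j < L, ∀ s, Inv j s →
      e.val s.mem ≠ 0 ∧ ∃ s', Run ω D p s K s' ∧ Inv (j + 1) s')
    (hend : ∀ s, Inv L s → e.val s.mem = 0) {s : State} (hs : Inv 0 s) :
    ∃ s', Run ω D (.loop e p) s (L * (K + 1) + 1) s' ∧ Inv L s' := by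
  -- Induction on the number `i` of rounds still to come, because `Run.loop_step` puts a round in
  -- front.
  suffices H : ∀ i ≤ L, ∀ s, Inv (L - i) s →
      ∃ s', Run ω D (.loop e p) s (i * (K + 1) + 1) s' ∧ Inv L s' from
    H L le_rfl s (by simpa using hs)
  intro i
  induction i with
  | zero =>
    intro _ s hs
    exact ⟨s, by simpa using Run.loop_done hD (hB _ (by omega) s hs) (hend s hs), hs⟩
  | succ i ih =>
    intro hi s hs
    obtain ⟨he, s', hr, hs'⟩ := hstep (L - (i + 1)) (by omega) s hs
    obtain ⟨s'', hr', hs''⟩ := ih (by omega) s'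
      (by rwa [show L - i = L - (i + 1) + 1 by omega])
    exact ⟨s'', (Run.loop_step hD (hB _ (by omega) s hs) he hr hr').mono (by linarith), hs''⟩

end Run

/-! ### Sums over assignments -/

section AssignSum

variable {V R : Type} [Fintype V] [DecidableEq V] [CommRing R]

/-- The sum of `g` over all assignments `V → {0, 1, 2, 3}` that agree with `σ` outside `A`. -/
def assignSum (A : Finset V) (g : (V → ℕ) → R) (σ : V → ℕ) : R :=
  ∑ τ ∈ Fintype.piFinset (fun u => if u ∈ A then Finset.range 4 else {σ u}), g τ

/-- `g` does not depend on the values on `A`. -/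
def IndepOf (A : Finset V) (g : (V → ℕ) → R) : Prop :=
  ∀ σ τ : V → ℕ, (∀ u ∉ A, σ u = τ u) → g σ = g τ

theorem IndepOf.mono {A B : Finset V} {g : (V → ℕ) → R} (h : IndepOf B g) (hAB : A ⊆ B) :
    IndepOf A g := fun σ τ hστ => h σ τ fun u hu => hστ u fun hA => hu (hAB hA)

theorem IndepOf.prod {κ : Type} {K : Finset κ} {A : Finset V} {g : κ → (V → ℕ) → R}
    (h : ∀ c ∈ K, IndepOf A (g c)) : IndepOf A (fun σ => ∏ c ∈ K, g c σ) :=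
  fun σ τ hστ => Finset.prod_congr rfl fun c hc => h c hc σ τ hστ

theorem assignSum_empty (g : (V → ℕ) → R) (σ : V → ℕ) : assignSum ∅ g σ = g σ := by
  have : Fintype.piFinset (fun u => if u ∈ (∅ : Finset V) then Finset.range 4 else {σ u})
      = {σ} := by
    ext τ
    simp [funext_iff]
  rw [assignSum, this, Finset.sum_singleton]

/-- The assignments are sorted by their value at `v`. -/
theorem assignSum_insert {A : Finset V} {v : V} (hv : v ∉ A) (g : (V → ℕ) → R) (σ : V → ℕ) :
    assignSum (insert v A) g σ
      = ∑ q ∈ Finset.range 4, assignSum A g (Function.update σ v q) := by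
  simp only [assignSum]
  rw [← Finset.sum_fiberwise_of_maps_to (s := Fintype.piFinset _) (t := Finset.range 4)
    (g := fun τ : V → ℕ => τ v)]
  · refine Finset.sum_congr rfl fun q hq => Finset.sum_congr ?_ fun _ _ => rfl
    ext τ
    simp only [Finset.mem_filter, Fintype.mem_piFinset]
    constructor
    · rintro ⟨h, rfl⟩ u
      have := h u
      by_cases huv : u = v
      · subst huv; simp [hv]
      · simpa [huv] using this
    · intro h
      have hvq : τ v = q := by simpa [hv] using h v
      refine ⟨fun u => ?_, hvq⟩
      have := h u
      by_cases huv : u = v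
      · subst huv; simpa [hvq] using hq
      · simpa [huv] using this
  · intro τ hτ
    simpa using Fintype.mem_piFinset.1 hτ v

theorem assignSum_congr_of_indepOf {A C : Finset V} {g : (V → ℕ) → R} (hg : IndepOf C g)
    {σ τ : V → ℕ} (h : ∀ u ∉ C, σ u = τ u) : assignSum A g σ = assignSum A g τ := by
  induction A using Finset.induction_on generalizing σ τ with
  | empty => rw [assignSum_empty, assignSum_empty]; exact hg σ τ h
  | insert v A hv ih =>
    rw [assignSum_insert hv, assignSum_insert hv]
    refine Finset.sum_congr rfl fun q _ => ih fun u hu => ?_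
    by_cases huv : u = v
    · subst huv; simp
    · simp [huv, h u hu]

/-- The distributive law over two disjoint blocks of variables; both factors may still depend on
variables outside `A ∪ B`, whose values `σ` fixes. Peeling one vertex off `A` changes `σ` there,
which `h` does not notice. -/
theorem assignSum_mul {A B : Finset V} {g h : (V → ℕ) → R} (hAB : Disjoint A B)
    (hg : IndepOf B g) (hh : IndepOf A h) (σ : V → ℕ) :
    assignSum (A ∪ B) (fun τ => g τ * h τ) σ = assignSum A g σ * assignSum B h σ := by
  induction A using Finset.induction_on generalizing σ with
  | empty =>
    rw [assignSum_empty, Finset.empty_union]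
    simp only [assignSum]
    rw [Finset.mul_sum]
    refine Finset.sum_congr rfl fun τ hτ => ?_
    rw [hg τ σ fun u hu => ?_]
    simpa [hu] using Fintype.mem_piFinset.1 hτ u
  | insert v A hv ih =>
    rw [Finset.disjoint_insert_left] at hAB
    have hvu : v ∉ A ∪ B := by simp [hv, hAB.1]
    rw [Finset.insert_union, assignSum_insert hvu, assignSum_insert hv, Finset.sum_mul]
    refine Finset.sum_congr rfl fun q _ => ?_
    rw [ih hAB.2 (hh.mono (Finset.subset_insert v A))]
    congr 1
    refine assignSum_congr_of_indepOf hh fun u hu => ?_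
    have : u ≠ v := fun h => hu (by simp [h])
    simp [this]

theorem assignSum_const_mul {B : Finset V} {g h : (V → ℕ) → R} (hg : IndepOf B g)
    (σ : V → ℕ) : assignSum B (fun τ => g τ * h τ) σ = g σ * assignSum B h σ := by
  have := assignSum_mul (A := ∅) (B := B) (g := g) (h := h) (Finset.disjoint_empty_left _) hg
    (fun σ τ h => by rw [funext fun u => h u (Finset.notMem_empty u)]) σ
  rwa [assignSum_empty, Finset.empty_union] at this

theorem assignSum_biUnion {κ : Type} [DecidableEq κ] {K : Finset κ} {A : κ → Finset V}
    {g : κ → (V → ℕ) → R} (hA : ∀ c ∈ K, ∀ d ∈ K, c ≠ d → Disjoint (A c) (A d))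
    (hg : ∀ c ∈ K, ∀ d ∈ K, c ≠ d → IndepOf (A d) (g c)) (σ : V → ℕ) :
    assignSum (K.biUnion A) (fun τ => ∏ c ∈ K, g c τ) σ = ∏ c ∈ K, assignSum (A c) (g c) σ := by
  induction K using Finset.induction_on with
  | empty => simp [assignSum_empty]
  | insert c K hc ih =>
    have hne : ∀ d ∈ K, c ≠ d := fun d hd h => hc (h ▸ hd)
    rw [Finset.biUnion_insert, Finset.prod_insert hc,
      ← ih (fun d hd e he => hA d (by simp [hd]) e (by simp [he]))
        (fun d hd e he => hg d (by simp [hd]) e (by simp [he])), ← assignSum_mul]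
    · simp only [Finset.prod_insert hc]
    · rw [Finset.disjoint_biUnion_right]
      exact fun d hd => hA c (by simp) d (by simp [hd]) (hne d hd)
    · intro τ τ' hτ
      -- Independence of each block `A d` gives independence of their union: two assignments that
      -- differ on several blocks are joined by changing one block at a time.
      have key : ∀ K' ⊆ K, ∀ τ τ' : V → ℕ, (∀ u ∉ K'.biUnion A, τ u = τ' u) →
          g c τ = g c τ' := by
        intro K'
        induction K' using Finset.induction_on with
        | empty =>
          intro _ τ τ' h
          rw [funext fun u => h u (by simp)]
        | insert d K' hd ih' =>
          intro hK τ τ' h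
          rw [Finset.insert_subset_iff] at hK
          rw [ih' hK.2 τ (fun u => if u ∈ A d then τ u else τ' u) fun u hu => ?_]
          · exact hg c (by simp) d (by simp [hK.1]) (hne d hK.1) _ _ fun u hu => by simp [hu]
          · by_cases hd : u ∈ A d
            · simp [hd]
            · simp only [hd, if_false]
              exact h u (by simp [hd, Finset.mem_biUnion] at hu ⊢; exact hu)
      exact key K subset_rfl τ τ' hτ
    · exact IndepOf.prod fun d hd => hg d (by simp [hd]) c (by simp) (hne d hd).symm

end AssignSum

/-! ### Rooted forests -/

namespace RootedForest

variable {V : Type} (T : RootedForest V)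

theorem ancestor_parent {u v p : V} (h : T.Ancestor u v) (hp : T.parent v = some p)
    (hne : u ≠ v) : T.Ancestor u p := by
  rcases Relation.ReflTransGen.cases_tail h with h | ⟨w, hw, hwv⟩
  · exact absurd h.symm hne
  · rw [hp, Option.some_inj] at hwv
    exact hwv ▸ hw

theorem Ancestor.antisymm' {u v : V} (h : T.Ancestor u v) (h' : T.Ancestor v u) : u = v := by
  by_contra hne
  rcases Relation.reflTransGen_iff_eq_or_transGen.1 h with h1 | h1
  · exact hne h1.symm
  · exact T.acyclic _ (h1.trans_left h')

theorem not_ancestor_of_parent {v p : V} (hp : T.parent v = some p) : ¬ T.Ancestor v p :=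
  fun h => T.acyclic v (Relation.TransGen.tail' h hp)

/-- The ancestors of a node form a chain, since parents are unique. -/
theorem ancestor_total {u v w : V} (hu : T.Ancestor u w) (hv : T.Ancestor v w) :
    T.Ancestor u v ∨ T.Ancestor v u := by
  induction hu with
  | refl => exact Or.inr hv
  | tail h hp ih =>
    rename_i b c
    by_cases hvc : v = c
    · exact Or.inl (hvc ▸ Relation.ReflTransGen.tail h hp)
    · exact ih (T.ancestor_parent hv hp hvc)

variable [Fintype V] [DecidableEq V]

open Classical in
/-- The nodes of the subtree of `v`. -/
noncomputable def subtree (v : V) : Finset V := {u | T.Ancestor v u}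

open Classical in
/-- The children of the node `p`; the children of `none` are the roots. -/
noncomputable def children (p : Option V) : Finset V := {c | T.parent c = p}

@[simp] theorem mem_subtree {u v : V} : u ∈ T.subtree v ↔ T.Ancestor v u := by simp [subtree]

@[simp] theorem mem_children {p : Option V} {c : V} : c ∈ T.children p ↔ T.parent c = p := by
  simp [children]

/-- A common node would make the two siblings comparable, and a sibling that is a proper ancestor
would be an ancestor of its own parent. The case `p = none` is that of two roots. -/
theorem disjoint_subtree {p : Option V} {c d : V} (hc : T.parent c = p) (hd : T.parent d = p)
    (hne : c ≠ d) : Disjoint (T.subtree c) (T.subtree d) := by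
  have key : ∀ {c d : V}, T.parent c = p → T.parent d = p → c ≠ d → ¬ T.Ancestor c d := by
    intro c d hc hd hne h
    rcases Relation.ReflTransGen.cases_tail h with h | ⟨w, hw, hwv⟩
    · exact hne h.symm
    · exact T.not_ancestor_of_parent (hc.trans (hd.symm.trans hwv)) hw
  rw [Finset.disjoint_left]
  intro u hu hu'
  rcases T.ancestor_total (T.mem_subtree.1 hu) (T.mem_subtree.1 hu') with h | h
  · exact key hc hd hne h
  · exact key hd hc hne.symm h

theorem subtree_eq_insert (v : V) :
    T.subtree v = insert v ((T.children (some v)).biUnion T.subtree) := by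
  ext u
  simp only [mem_subtree, Finset.mem_insert, Finset.mem_biUnion, mem_children]
  constructor
  · intro h
    rcases Relation.ReflTransGen.cases_head h with h | ⟨c, hc, hcu⟩
    · exact Or.inl h.symm
    · exact Or.inr ⟨c, hc, hcu⟩
  · rintro (rfl | ⟨c, hc, hcu⟩)
    · exact Relation.ReflTransGen.refl
    · exact Relation.ReflTransGen.head hc hcu

theorem notMem_biUnion_subtree (v : V) : v ∉ (T.children (some v)).biUnion T.subtree := by
  simp only [mem_subtree, Finset.mem_biUnion, mem_children, not_exists, not_and]
  exact fun c hc => T.not_ancestor_of_parent hc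

/-- Induction from the leaves upwards: the children come before their parent. -/
theorem wellFounded_parent : WellFounded fun c p : V => T.parent c = some p := by
  have : IsTrans V (Relation.TransGen fun c p : V => T.parent c = some p) :=
    ⟨fun _ _ _ => Relation.TransGen.trans⟩
  have : Std.Irrefl (Relation.TransGen fun c p : V => T.parent c = some p) :=
    ⟨fun v h => T.acyclic v (Relation.transGen_swap.1 h)⟩
  exact (Finite.wellFounded_of_trans_of_irrefl
    (Relation.TransGen fun c p : V => T.parent c = some p)).mono
    fun _ _ h => Relation.TransGen.single h

/-- Induction from the roots downwards: the parent comes before its children. -/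
theorem wellFounded_child : WellFounded fun p c : V => T.parent c = some p := by
  have : IsTrans V (Relation.TransGen fun p c : V => T.parent c = some p) :=
    ⟨fun _ _ _ => Relation.TransGen.trans⟩
  have : Std.Irrefl (Relation.TransGen fun p c : V => T.parent c = some p) :=
    ⟨fun v h => T.acyclic v h⟩
  exact (Finite.wellFounded_of_trans_of_irrefl
    (Relation.TransGen fun p c : V => T.parent c = some p)).mono
    fun _ _ h => Relation.TransGen.single h

theorem biUnion_roots : (T.children none).biUnion T.subtree = Finset.univ := by
  ext v
  simp only [mem_subtree, Finset.mem_biUnion, mem_children, Finset.mem_univ, iff_true]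
  induction v using T.wellFounded_child.induction with
  | _ v ih =>
    rcases hp : T.parent v with _ | p
    · exact ⟨v, hp, Relation.ReflTransGen.refl⟩
    · obtain ⟨r, hr, h⟩ := ih p hp
      exact ⟨r, hr, h.tail hp⟩

/-- The sum over the assignments to a subtree of the product of the local factors. -/
noncomputable def treeSum {R : Type} [CommRing R] (loc : V → (V → ℕ) → R) (v : V) (σ : V → ℕ) :
    R :=
  assignSum (T.subtree v) (fun τ => ∏ u ∈ T.subtree v, loc u τ) σ

/-! ### Recursive evaluation of a sum of products whose factors look only at ancestors. -/

section TreeSum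

variable {R : Type} [CommRing R] {loc : V → (V → ℕ) → R}
  (hloc : ∀ v σ τ, (∀ u, T.Ancestor u v → σ u = τ u) → loc v σ = loc v τ)
include hloc

/-- The factor of `u` looks only at ancestors of `u`; if one of them lay below `d`, then `u` itself
would lie below `d` as well as below its sibling `c`. -/
theorem indepOf_loc_subtree {p : Option V} {c d : V} (hc : T.parent c = p)
    (hd : T.parent d = p) (hne : c ≠ d) :
    IndepOf (T.subtree d) (fun τ => ∏ u ∈ T.subtree c, loc u τ) := by
  refine IndepOf.prod fun u hu σ τ h => hloc u σ τ fun w hw => h w fun hwd => ?_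
  have hdu : u ∈ T.subtree d := T.mem_subtree.2 ((T.mem_subtree.1 hwd).trans hw)
  exact Finset.disjoint_left.1 (T.disjoint_subtree hc hd hne) hu hdu

theorem assignSum_forest (p : Option V) (σ : V → ℕ) :
    assignSum ((T.children p).biUnion T.subtree)
      (fun τ => ∏ u ∈ (T.children p).biUnion T.subtree, loc u τ) σ
      = ∏ c ∈ T.children p, T.treeSum loc c σ := by
  have hdisj : ∀ c ∈ T.children p, ∀ d ∈ T.children p, c ≠ d →
      Disjoint (T.subtree c) (T.subtree d) := fun c hc d hd =>
    T.disjoint_subtree (T.mem_children.1 hc) (T.mem_children.1 hd)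
  have : (fun τ => ∏ u ∈ (T.children p).biUnion T.subtree, loc u τ)
      = fun τ => ∏ c ∈ T.children p, ∏ u ∈ T.subtree c, loc u τ := by
    funext τ
    exact Finset.prod_biUnion fun c hc d hd => hdisj c hc d hd
  rw [this, assignSum_biUnion hdisj]
  · rfl
  · exact fun c hc d hd =>
      T.indepOf_loc_subtree hloc (T.mem_children.1 hc) (T.mem_children.1 hd)

/-- The recursion that the search evaluates. Once the state of `v` is fixed, the factor of `v` is a
constant for everything below, and the subtrees of the children do not influence each other. -/
theorem treeSum_eq (v : V) (σ : V → ℕ) :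
    T.treeSum loc v σ = ∑ q ∈ Finset.range 4, loc v (Function.update σ v q) *
      ∏ c ∈ T.children (some v), T.treeSum loc c (Function.update σ v q) := by
  rw [treeSum, T.subtree_eq_insert v, assignSum_insert (T.notMem_biUnion_subtree v)]
  refine Finset.sum_congr rfl fun q _ => ?_
  rw [← T.assignSum_forest hloc, ← assignSum_const_mul]
  · simp only [Finset.prod_insert (T.notMem_biUnion_subtree v)]
  · intro σ τ h
    refine hloc v σ τ fun u hu => h u ?_
    simp only [mem_subtree, Finset.mem_biUnion, mem_children, not_exists, not_and]
    exact fun c hc hcu => T.not_ancestor_of_parent hc (hcu.trans hu)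

theorem prod_treeSum_roots (σ : V → ℕ) :
    ∏ r ∈ T.children none, T.treeSum loc r σ
      = ∑ τ ∈ Fintype.piFinset (fun _ : V => Finset.range 4), ∏ v, loc v τ := by
  rw [← T.assignSum_forest hloc, T.biUnion_roots, assignSum]
  simp

end TreeSum

end RootedForest

/-! ### The generating function of two-coloured edge sets -/

section Expansion

variable {ι V R : Type} [Fintype ι] [DecidableEq ι] [Fintype V] [DecidableEq V] [CommRing R]

/-- Indicator of the bit with weight two. -/
def hiBit (R : Type) [CommRing R] (q : ℕ) : R := ((q / 2 : ℕ) : R)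

/-- Indicator of the bit with weight one. -/
def loBit (R : Type) [CommRing R] (q : ℕ) : R := ((q % 2 : ℕ) : R)

/-- Weight of a vertex in state `q`. -/
def vertexWeight (t : R) (q : ℕ) : R :=
  (1 - hiBit R q) * (1 - loBit R q) + t * (1 - 2 * hiBit R q) * (1 - 2 * loBit R q)

/-- Each vertex meets both colours or none. -/
def Balanced (inc : V → ι → Prop) (f : ι → Fin 3) : Prop :=
  ∀ v, (∃ e, inc v e ∧ f e = 1) ↔ ∃ e, inc v e ∧ f e = 2

open Classical in
/-- The vertices that meet the first colour. -/
noncomputable def touched (inc : V → ι → Prop) (f : ι → Fin 3) : Finset V :=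
  {v | ∃ e, inc v e ∧ f e = 1}

/-- Both terms of the weight factor over the two bits. The sum of `1 - b` over `b ∈ {0, 1}` is one,
and of `(1 - b) * b` zero, so the first term detects that neither colour is present. The sum of `1 -
2 * b` is zero, and of `(1 - 2 * b) * b` minus one, so the second term contributes `t` if both are
present. With one colour alone everything cancels. -/
theorem sum_vertexWeight (t : R) (P₁ P₂ : Prop) [Decidable P₁] [Decidable P₂] :
    ∑ q ∈ Finset.range 4, vertexWeight t q * ((if P₁ then hiBit R q else 1) *
      (if P₂ then loBit R q else 1))
      = if (P₁ ↔ P₂) then (if P₁ then t else 1) else 0 := by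
  simp only [Finset.sum_range_succ, Finset.sum_range_zero, vertexWeight, hiBit, loBit]
  by_cases h1 : P₁ <;> by_cases h2 : P₂ <;> simp [h1, h2] <;> ring

theorem prod_ite_eq_ite_forall {κ : Type} (s : Finset κ) (p : κ → Prop) [DecidablePred p]
    [Decidable (∀ c ∈ s, p c)] (a : κ → R) :
    (∏ c ∈ s, if p c then a c else 0) = if ∀ c ∈ s, p c then ∏ c ∈ s, a c else 0 := by
  split_ifs with h
  · exact Finset.prod_congr rfl fun c hc => if_pos (h c hc)
  · push Not at h
    obtain ⟨c, hc, hp⟩ := h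
    exact Finset.prod_eq_zero hc (if_neg hp)

-- Bits are idempotent: a vertex met by several edges of `s` contributes its bit only once.
open Classical in
theorem prod_hiBit (inc : V → ι → Prop) (bit : ℕ → R) (hbit : ∀ q < 4, bit q * bit q = bit q)
    (s : Finset ι) {τ : V → ℕ} (hτ : ∀ v, τ v < 4) :
    (∏ e ∈ s, ∏ v with inc v e, bit (τ v)) = ∏ v, if ∃ e ∈ s, inc v e then bit (τ v) else 1 := by
  simp only [Finset.prod_filter]
  rw [Finset.prod_comm]
  refine Finset.prod_congr rfl fun v _ => ?_
  have hpow : ∀ k, bit (τ v) ^ (k + 1) = bit (τ v) := by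
    intro k
    induction k with
    | zero => simp
    | succ k ih => rw [pow_succ, ih, hbit _ (hτ v)]
  rw [← Finset.prod_filter, Finset.prod_const]
  split_ifs with h
  · obtain ⟨e, he, hve⟩ := h
    have : 0 < (s.filter fun e => inc v e).card :=
      Finset.card_pos.2 ⟨e, by simp [he, hve]⟩
    obtain ⟨k, hk⟩ := Nat.exists_eq_succ_of_ne_zero this.ne'
    rw [hk, hpow]
  · have : (s.filter fun e => inc v e) = ∅ := by
      rw [Finset.filter_eq_empty_iff]
      exact fun e he hve => h ⟨e, he, hve⟩
    rw [this]; simp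

open Classical in
/-- Inclusion-exclusion over the two colours at every vertex. -/
theorem sum_assignments_eq (inc : V → ι → Prop) (y : ι → R) (t : R) :
    ∑ τ ∈ Fintype.piFinset (fun _ : V => Finset.range 4), (∏ v, vertexWeight t (τ v)) *
      ∏ e, (1 + y e * ((∏ v with inc v e, hiBit R (τ v)) + ∏ v with inc v e, loBit R (τ v)))
    = ∑ f : ι → Fin 3 with Balanced inc f,
        t ^ (touched inc f).card * ∏ e with f e ≠ 0, y e := by
  have hhi : ∀ q < 4, hiBit R q * hiBit R q = hiBit R q := by
    intro q hq; interval_cases q <;> simp [hiBit]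
  have hlo : ∀ q < 4, loBit R q * loBit R q = loBit R q := by
    intro q hq; interval_cases q <;> simp [loBit]
  -- Expanding the product over the edges means choosing for each edge no colour, the first or the
  -- second, that is, a function `f`.
  have hexp : ∀ τ ∈ Fintype.piFinset (fun _ : V => Finset.range 4),
      (∏ v, vertexWeight t (τ v)) *
      ∏ e, (1 + y e * ((∏ v with inc v e, hiBit R (τ v)) + ∏ v with inc v e, loBit R (τ v)))
      = ∑ f : ι → Fin 3, (∏ e with f e ≠ 0, y e) * ∏ v, (vertexWeight t (τ v) *
          ((if ∃ e, inc v e ∧ f e = 1 then hiBit R (τ v) else 1) *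
           (if ∃ e, inc v e ∧ f e = 2 then loBit R (τ v) else 1))) := by
    intro τ hτ
    have hτ4 : ∀ v, τ v < 4 := fun v => by simpa using Fintype.mem_piFinset.1 hτ v
    have hfac : ∀ e, (1 + y e * ((∏ v with inc v e, hiBit R (τ v))
        + ∏ v with inc v e, loBit R (τ v)))
        = ∑ j : Fin 3, (if j ≠ 0 then y e else 1) *
          ((if j = 1 then ∏ v with inc v e, hiBit R (τ v) else 1) *
           (if j = 2 then ∏ v with inc v e, loBit R (τ v) else 1)) := by
      intro e
      rw [Fin.sum_univ_three]
      simp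
      ring
    rw [Finset.prod_congr rfl fun e _ => hfac e, Finset.prod_univ_sum, Finset.mul_sum,
      Fintype.piFinset_univ]
    refine Finset.sum_congr rfl fun f _ => ?_
    simp only [Finset.prod_mul_distrib]
    rw [← Finset.prod_filter, ← Finset.prod_filter, ← Finset.prod_filter,
      prod_hiBit inc _ hhi _ hτ4, prod_hiBit inc _ hlo _ hτ4]
    simp only [Finset.mem_filter, Finset.mem_univ, true_and, and_comm (a := inc _ _)]
    ring
  rw [Finset.sum_congr rfl hexp, Finset.sum_comm, Finset.sum_filter]
  refine Finset.sum_congr rfl fun f _ => ?_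
  -- For a fixed `f` the summand is a product over the vertices, so the sum over `τ` becomes a
  -- product of one-vertex sums.
  rw [← Finset.mul_sum, ← Finset.prod_univ_sum (fun _ : V => Finset.range 4)
    fun v q => vertexWeight t q * ((if ∃ e, inc v e ∧ f e = 1 then hiBit R q else 1) *
           (if ∃ e, inc v e ∧ f e = 2 then loBit R q else 1))]
  simp only [sum_vertexWeight]
  rw [prod_ite_eq_ite_forall]
  simp only [Finset.mem_univ, true_imp_iff]
  by_cases hb : Balanced inc f
  · rw [if_pos hb, if_pos (by simpa [Balanced] using hb), ← Finset.prod_filter,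
      Finset.prod_const, mul_comm]
    rfl
  · rw [if_neg hb, if_neg (by simpa [Balanced] using hb), mul_zero]

end Expansion

/-! ### Local factors along an elimination forest -/

section EdgeProduct

variable {V R : Type} [Fintype V] [CommRing R]

open Classical in
/-- In an elimination forest, the edges correspond to the pairs of a vertex and a neighbour that is
its ancestor. -/
theorem prod_edges_eq (G : SimpleGraph V) (T : RootedForest V) (hT : T.IsEliminationForest G)
    (φ : Sym2 V → R) :
    ∏ e : G.edgeSet, φ e = ∏ v, ∏ a with T.Ancestor a v ∧ G.Adj v a, φ s(v, a) := by
  rw [Finset.prod_sigma']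
  symm
  refine Finset.prod_bij (fun p hp => ⟨s(p.1, p.2), ?_⟩) ?_ ?_ ?_ ?_
  · simp only [Finset.mem_sigma, Finset.mem_filter] at hp
    exact hp.2.2.2
  · simp
  · rintro ⟨v, a⟩ hp ⟨w, b⟩ hq h
    simp only [Finset.mem_sigma, Finset.mem_filter, Finset.mem_univ, true_and] at hp hq
    rcases Sym2.eq_iff.1 (Subtype.mk.inj h) with ⟨h1, h2⟩ | ⟨h1, h2⟩
    · simp only at h1 h2; subst h1 h2; rfl
    · simp only at h1 h2; subst h1 h2
      -- An edge is listed only at its lower endpoint; being listed at both would make each endpoint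
      -- an ancestor of the other.
      exact absurd (RootedForest.Ancestor.antisymm' T hq.1 hp.1) hp.2.ne
  · rintro ⟨e, he⟩ -
    induction e using Sym2.ind with
    | _ u v =>
      rcases hT u v he with h | h
      · exact ⟨⟨v, u⟩, by simpa using ⟨h, SimpleGraph.Adj.symm he⟩, Subtype.ext Sym2.eq_swap⟩
      · exact ⟨⟨u, v⟩, by simpa using ⟨h, he⟩, rfl⟩
  · intros; rfl

end EdgeProduct

/-! ### Alternating colourings of a graph whose degrees are zero or two -/

section Alternating

variable {V : Type}

/-- `κ` colours the edges of `H` alternatingly with the colours `1` and `2`; the colour `0` marks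
the non-edges. -/
structure IsAlternatingColouring (H : SimpleGraph V) (κ : V → V → Fin 3) : Prop where
  symm : ∀ u v, κ u v = κ v u
  ne_zero_iff : ∀ u v, κ u v ≠ 0 ↔ H.Adj u v
  unique : ∀ v u w, κ v u ≠ 0 → κ v u = κ v w → u = w
  balanced : ∀ v, (∃ u, κ v u = 1) ↔ ∃ u, κ v u = 2

/-- Exchange the colours `1` and `2`. -/
def swapColour : Equiv.Perm (Fin 3) := Equiv.swap 1 2

theorem swapColour_zero : swapColour 0 = 0 := by decide

theorem swapColour_ne_self : ∀ {x : Fin 3}, x ≠ 0 → swapColour x ≠ x := by decide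

theorem eq_or_eq_swapColour : ∀ {x y : Fin 3}, x ≠ 0 → y ≠ 0 → x = y ∨ x = swapColour y := by
  decide

theorem swapColour_swapColour : ∀ x : Fin 3, swapColour (swapColour x) = x := by decide

theorem swapColour_eq_zero_iff : ∀ {x : Fin 3}, swapColour x = 0 ↔ x = 0 := by decide

variable {H : SimpleGraph V} {κ κ₀ : V → V → Fin 3}

/-- At `v` both colourings are injective maps from the same set of edges to the colours `1` and `2`,
so they coincide or differ by the exchange of the colours. -/
theorem IsAlternatingColouring.agree_or_swap (h : IsAlternatingColouring H κ)
    (h₀ : IsAlternatingColouring H κ₀) (v : V) :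
    (∀ u, κ v u = κ₀ v u) ∨ ∀ u, κ v u = swapColour (κ₀ v u) := by
  have hz : ∀ u, κ v u = 0 ↔ κ₀ v u = 0 := fun u =>
    not_iff_not.1 ((h.ne_zero_iff v u).trans (h₀.ne_zero_iff v u).symm)
  by_contra hcon
  push Not at hcon
  obtain ⟨⟨a, ha⟩, b, hb⟩ := hcon
  have ha0 : κ v a ≠ 0 := fun h0 => ha (h0.trans ((hz a).1 h0).symm)
  have hb0 : κ v b ≠ 0 := fun h0 => hb (by rw [h0, (hz b).1 h0, swapColour_zero])
  have ha0' : κ₀ v a ≠ 0 := fun h0 => ha0 ((hz a).2 h0)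
  have hb0' : κ₀ v b ≠ 0 := fun h0 => hb0 ((hz b).2 h0)
  have ha1 := (eq_or_eq_swapColour ha0 ha0').resolve_left ha
  have hb1 := (eq_or_eq_swapColour hb0 hb0').resolve_right hb
  rcases eq_or_eq_swapColour ha0' hb0' with hab | hab
  · obtain rfl := h₀.unique v a b ha0' hab
    exact ha hb1
  · have : κ v a = κ v b := by
      rw [ha1, hb1, hab]
      exact swapColour_swapColour _
    obtain rfl := h.unique v a b ha0 this
    exact ha hb1

/-- The edge between `u` and `v` has one colour, seen from either end; it decides between agreement
and exchange at both. -/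
theorem IsAlternatingColouring.agree_iff_of_adj (h : IsAlternatingColouring H κ)
    (h₀ : IsAlternatingColouring H κ₀) {u v : V} (huv : H.Adj u v) :
    (∀ w, κ u w = κ₀ u w) ↔ ∀ w, κ v w = κ₀ v w := by
  have key : ∀ {u v}, H.Adj u v → (∀ w, κ u w = κ₀ u w) → ∀ w, κ v w = κ₀ v w := by
    intro u v huv hu
    refine (h.agree_or_swap h₀ v).resolve_right fun hs => ?_
    have h1 := hs u
    rw [h.symm, hu v, h₀.symm] at h1
    exact swapColour_ne_self ((h₀.ne_zero_iff v u).2 huv.symm) h1.symm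
  exact ⟨key huv, key huv.symm⟩

theorem IsAlternatingColouring.agree_iff_of_reachable (h : IsAlternatingColouring H κ)
    (h₀ : IsAlternatingColouring H κ₀) {u v : V} (huv : H.Reachable u v) :
    (∀ w, κ u w = κ₀ u w) ↔ ∀ w, κ v w = κ₀ v w := by
  obtain ⟨p⟩ := huv
  induction p with
  | nil => rfl
  | cons hadj _ ih => exact (h.agree_iff_of_adj h₀ hadj).trans ih

theorem nontrivial_supp_of_adj {u v : V} (h : H.Adj u v) :
    (H.connectedComponentMk u).supp.Nontrivial :=
  ⟨u, rfl, v, (SimpleGraph.ConnectedComponent.eq.2 h.symm.reachable), h.ne⟩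

theorem exists_adj_of_nontrivial_supp {K : H.ConnectedComponent} (hK : K.supp.Nontrivial) :
    ∃ u v, H.connectedComponentMk u = K ∧ H.Adj u v := by
  obtain ⟨u, hu, v, hv, hne⟩ := hK
  obtain ⟨p⟩ : H.Reachable u v := SimpleGraph.ConnectedComponent.eq.1 (hu.trans hv.symm)
  cases p with
  | nil => exact absurd rfl hne
  | cons hadj _ => exact ⟨u, _, hu, hadj⟩

open Classical in
/-- Exchange the colours of `κ₀` in the components selected by `g`. -/
noncomputable def flipColouring (κ₀ : V → V → Fin 3)
    (g : {K : H.ConnectedComponent | K.supp.Nontrivial} → Bool) (u v : V) : Fin 3 :=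
  -- `g` is defined on nontrivial components only; isolated vertices have no colours to exchange.
  if ∃ h, g ⟨H.connectedComponentMk u, h⟩ = true then swapColour (κ₀ u v) else κ₀ u v

theorem flipColouring_eq_zero_iff (g : {K : H.ConnectedComponent | K.supp.Nontrivial} → Bool)
    (u v : V) : flipColouring κ₀ g u v = 0 ↔ κ₀ u v = 0 := by
  rw [flipColouring]
  split_ifs
  · exact swapColour_eq_zero_iff
  · rfl

/-- Both ends of an edge lie in the same component, so the exchange is consistent along edges, and
at each vertex it is a permutation of the two colours. -/
theorem IsAlternatingColouring.flip (h₀ : IsAlternatingColouring H κ₀)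
    (g : {K : H.ConnectedComponent | K.supp.Nontrivial} → Bool) :
    IsAlternatingColouring H (flipColouring κ₀ g) where
  symm u v := by
    by_cases huv : H.Adj u v
    · have : H.connectedComponentMk u = H.connectedComponentMk v :=
        SimpleGraph.ConnectedComponent.eq.2 huv.reachable
      simp only [flipColouring, h₀.symm u v]
      rw [this]
    · have h1 : κ₀ u v = 0 := by
        by_contra h; exact huv ((h₀.ne_zero_iff u v).1 h)
      rw [(flipColouring_eq_zero_iff g u v).2 h1,
        (flipColouring_eq_zero_iff g v u).2 (by rw [h₀.symm, h1])]
  ne_zero_iff u v := by rw [Ne, flipColouring_eq_zero_iff]; exact h₀.ne_zero_iff u v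
  unique v u w hne heq := by
    rw [Ne, flipColouring_eq_zero_iff] at hne
    refine h₀.unique v u w hne ?_
    simp only [flipColouring] at heq
    split_ifs at heq
    · exact swapColour.injective heq
    · exact heq
  balanced v := by
    simp only [flipColouring]
    split_ifs
    · have h1 : ∀ x, swapColour x = 1 ↔ x = 2 := by decide
      have h2 : ∀ x, swapColour x = 2 ↔ x = 1 := by decide
      simp only [h1, h2]
      exact (h₀.balanced v).symm
    · exact h₀.balanced v

/-- A graph that has an alternating colouring has `2 ^ c` of them, where `c` is the number of its
nontrivial components. -/
theorem card_alternatingColouring [Finite V] (h₀ : IsAlternatingColouring H κ₀) :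
    Nat.card {κ // IsAlternatingColouring H κ}
      = 2 ^ {K : H.ConnectedComponent | K.supp.Nontrivial}.ncard := by
  classical
  have hbij : Function.Bijective
      (fun g : {K : H.ConnectedComponent | K.supp.Nontrivial} → Bool =>
        (⟨flipColouring κ₀ g, h₀.flip g⟩ : {κ // IsAlternatingColouring H κ})) := by
    constructor
    · intro g g' hgg
      have hgg' : ∀ u v, flipColouring κ₀ g u v = flipColouring κ₀ g' u v := fun u v =>
        congrFun (congrFun (congrArg Subtype.val hgg) u) v
      funext ⟨K, hK⟩
      -- The colour of a single edge of a component reveals whether the component was flipped.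
      obtain ⟨u, v, rfl, hadj⟩ := exists_adj_of_nontrivial_supp hK
      have h1 := hgg' u v
      have hne := swapColour_ne_self ((h₀.ne_zero_iff u v).2 hadj)
      have hK' : (H.connectedComponentMk u).supp.Nontrivial := hK
      simp only [flipColouring, Set.mem_ofPred_eq, hK', exists_true_left] at h1
      cases h2 : g ⟨H.connectedComponentMk u, hK⟩ <;>
        cases h3 : g' ⟨H.connectedComponentMk u, hK⟩ <;>
        simp_all [hne.symm]
    · rintro ⟨κ, h⟩
      -- Flip exactly the components on which `κ` differs from `κ₀`; testing at one representative
      -- suffices because agreement is constant on components.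
      refine ⟨fun K => decide ¬ ∀ w, κ K.1.out w = κ₀ K.1.out w, Subtype.ext ?_⟩
      funext u v
      simp only [flipColouring]
      have hag : (∀ w, κ (H.connectedComponentMk u).out w = κ₀ (H.connectedComponentMk u).out w)
          ↔ ∀ w, κ u w = κ₀ u w :=
        h.agree_iff_of_reachable h₀
          (SimpleGraph.ConnectedComponent.eq.1 (Quot.out_eq (H.connectedComponentMk u)))
      simp only [decide_eq_true_eq, hag]
      split_ifs with hc
      · obtain ⟨-, hc⟩ := hc
        exact ((h.agree_or_swap h₀ u).resolve_left hc v).symm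
      · by_cases hadj : H.Adj u v
        · have : ∀ w, κ u w = κ₀ u w := by
            by_contra hcon
            exact hc ⟨nontrivial_supp_of_adj hadj, hcon⟩
          exact (this v).symm
        · have e1 : κ₀ u v = 0 := by by_contra h; exact hadj ((h₀.ne_zero_iff u v).1 h)
          have e2 : κ u v = 0 := by by_contra h'; exact hadj ((h.ne_zero_iff u v).1 h')
          rw [e1, e2]
  rw [← Nat.card_eq_of_bijective _ hbij, Nat.card_fun]
  simp [Set.ncard]

open Classical in
/-- A bipartite graph all of whose degrees are zero or two has an alternating colouring. -/
theorem exists_alternatingColouring [Fintype V]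
    (hdeg : ∀ v, (H.neighborSet v).ncard = 0 ∨ (H.neighborSet v).ncard = 2)
    (hbip : H.IsBipartite) : ∃ κ, IsAlternatingColouring H κ := by
  have hdeg' : ∀ v, H.degree v = 0 ∨ H.degree v = 2 := fun v => by
    have : (H.neighborSet v).ncard = H.degree v := by
      rw [Set.ncard_eq_toFinset_card', ← SimpleGraph.card_neighborFinset_eq_degree,
        SimpleGraph.neighborFinset]
    rw [← this]; exact hdeg v
  let S := {v : V // H.degree v = 2}
  have hS : ∀ {u v}, H.Adj u v → H.degree u = 2 := fun {u v} h =>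
    (hdeg' u).resolve_left fun h0 => by
      have : v ∈ H.neighborFinset u := by simpa using h
      rw [Finset.card_eq_zero.1 ((SimpleGraph.card_neighborFinset_eq_degree _ _).trans h0)] at this
      simp at this
  -- Hall's theorem on the vertices of degree two. Its condition holds by double counting: every
  -- vertex of `A` has two neighbours, and every vertex is a neighbour of at most two elements of
  -- `A`.
  obtain ⟨π, hπinj, hπ⟩ := (Finset.all_card_le_biUnion_card_iff_exists_injective
    fun v : S => H.neighborFinset v.1).1 fun A => by
      have := Finset.card_mul_le_card_mul (fun (v : S) u => H.Adj v.1 u) (m := 2) (n := 2)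
        (s := A) (t := A.biUnion fun v => H.neighborFinset v.1) ?_ ?_
      · omega
      · intro v hv
        refine v.2.ge.trans ?_
        rw [← SimpleGraph.card_neighborFinset_eq_degree]
        refine Finset.card_le_card fun u hu => ?_
        rw [Finset.mem_bipartiteAbove]
        exact ⟨Finset.mem_biUnion.2 ⟨v, hv, hu⟩, by simpa using hu⟩
      · intro u hu
        have h2 : H.degree u ≤ 2 := by rcases hdeg' u with h | h <;> omega
        refine le_trans ?_ h2
        rw [← SimpleGraph.card_neighborFinset_eq_degree]
        refine Finset.card_le_card_of_injOn Subtype.val ?_ Subtype.val_injective.injOn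
        intro v hv
        rw [Finset.mem_coe, Finset.mem_bipartiteBelow] at hv
        simpa using hv.2.symm
  have hadj : ∀ v : S, H.Adj v.1 (π v) := fun v => by simpa using hπ v
  -- `π` is an injective self-map of the finite set `S`, hence surjective, so the pairs starting on
  -- the first side cover the second side too.
  have hsurj : ∀ w, H.degree w = 2 → ∃ v : S, π v = w := by
    have : Function.Bijective fun v : S => (⟨π v, hS (hadj v).symm⟩ : S) :=
      Finite.injective_iff_bijective.1 fun v w h => hπinj (congrArg Subtype.val h)
    intro w hw
    obtain ⟨v, hv⟩ := this.2 ⟨w, hw⟩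
    exact ⟨v, congrArg Subtype.val hv⟩
  obtain ⟨c⟩ := hbip
  have hc : ∀ {u v}, H.Adj u v → (c u = 0 ↔ c v ≠ 0) := by
    intro u v h
    have := c.valid h
    revert this
    generalize c u = x
    generalize c v = y
    revert x y
    decide
  -- the matching edges are the pairs `v, π v` with `v` on the first side
  let M : V → V → Prop := fun u v => ∃ a : S, c a.1 = 0 ∧ ((u = a.1 ∧ v = π a) ∨ (v = a.1 ∧ u = π a))
  have hMsymm : ∀ u v, M u v ↔ M v u := fun u v => by
    simp only [M]
    exact exists_congr fun a => and_congr_right fun _ => or_comm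
  have hMadj : ∀ {u v}, M u v → H.Adj u v := by
    rintro u v ⟨a, -, ⟨rfl, rfl⟩ | ⟨rfl, rfl⟩⟩
    · exact hadj a
    · exact (hadj a).symm
  -- The side of `v` tells whether `v` is the argument or the value of `π`; then `π` being a
  -- function, or its injectivity, yields uniqueness.
  have hMuniq : ∀ {v u w}, M v u → M v w → u = w := by
    rintro v u w ⟨a, ha, ⟨h1, h2⟩ | ⟨h1, h2⟩⟩ ⟨b, hb, ⟨h3, h4⟩ | ⟨h3, h4⟩⟩
    · obtain rfl : a = b := Subtype.ext (h1.symm.trans h3)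
      rw [h2, h4]
    · exact absurd (h1 ▸ ha) (by rw [h4]; exact (hc (hadj b)).1 hb)
    · exact absurd (h3 ▸ hb) (by rw [h2]; exact (hc (hadj a)).1 ha)
    · obtain rfl : a = b := hπinj (h2.symm.trans h4)
      rw [h1, h3]
  have hMex : ∀ v, H.degree v = 2 → ∃ u, M v u := by
    intro v hv
    by_cases hcv : c v = 0
    · exact ⟨π ⟨v, hv⟩, ⟨v, hv⟩, hcv, Or.inl ⟨rfl, rfl⟩⟩
    · obtain ⟨a, ha⟩ := hsurj v hv
      refine ⟨a.1, a, ?_, Or.inr ⟨rfl, ha.symm⟩⟩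
      exact (hc (hadj a)).2 (by rwa [ha])
  -- The matching gets colour `1`. It uses one of the two edges at each vertex of degree two, so the
  -- remaining edges form a matching of colour `2`.
  let κ : V → V → Fin 3 := fun u v => if M u v then 1 else if H.Adj u v then 2 else 0
  have hκ1 : ∀ {u v}, κ u v = 1 ↔ M u v := by
    intro u v
    simp only [κ]
    split_ifs with h1 h2
    · exact iff_of_true rfl h1
    · exact iff_of_false (by decide) h1
    · exact iff_of_false (by decide) h1
  have hκ2 : ∀ {u v}, κ u v = 2 ↔ H.Adj u v ∧ ¬ M u v := by
    intro u v
    simp only [κ]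
    split_ifs with h1 h2
    · exact iff_of_false (by decide) fun h => h.2 h1
    · exact iff_of_true rfl ⟨h2, h1⟩
    · exact iff_of_false (by decide) fun h => h2 h.1
  have htwo : ∀ v, H.degree v = 2 → ∃ a b, a ≠ b ∧ M v a ∧ ¬ M v b ∧
      ∀ u, H.Adj v u ↔ u = a ∨ u = b := by
    intro v hv
    obtain ⟨a, b, hab, hN⟩ := Finset.card_eq_two.1 hv
    have hN' : ∀ u, H.Adj v u ↔ u = a ∨ u = b := fun u => by
      rw [← SimpleGraph.mem_neighborFinset, hN]; simp
    obtain ⟨u, hu⟩ := hMex v hv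
    rcases (hN' u).1 (hMadj hu) with rfl | rfl
    · exact ⟨u, b, hab, hu, fun hb => hab (hMuniq hu hb), hN'⟩
    · exact ⟨u, a, hab.symm, hu, fun hb => hab (hMuniq hb hu), fun w => (hN' w).trans or_comm⟩
  refine ⟨κ, ⟨fun u v => ?_, fun u v => ?_, fun v u w hne heq => ?_, fun v => ?_⟩⟩
  · exact if_congr (hMsymm u v) rfl (if_congr (H.adj_comm u v) rfl rfl)
  · simp only [κ]
    split_ifs with h1 h2
    · exact iff_of_true one_ne_zero (hMadj h1)
    · exact iff_of_true (by decide) h2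
    · exact iff_of_false (fun h => h rfl) h2
  · have h3 : ∀ x : Fin 3, x ≠ 0 → x = 1 ∨ x = 2 := by decide
    rcases h3 _ hne with h1 | h1
    · exact hMuniq (hκ1.1 h1) (hκ1.1 (heq ▸ h1))
    · obtain ⟨hu, hu'⟩ := hκ2.1 h1
      obtain ⟨hw, hw'⟩ := hκ2.1 (heq ▸ h1)
      obtain ⟨a, b, -, ha, -, hN⟩ := htwo v (hS hu)
      have key : ∀ x, H.Adj v x → ¬ M v x → x = b := fun x hx hx' =>
        ((hN x).1 hx).resolve_left fun h => hx' (h ▸ ha)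
      rw [key u hu hu', key w hw hw']
  · simp only [hκ1, hκ2]
    constructor
    · rintro ⟨u, hu⟩
      obtain ⟨a, b, -, -, hb, hN⟩ := htwo v (hS (hMadj hu))
      exact ⟨b, (hN b).2 (Or.inr rfl), hb⟩
    · rintro ⟨u, hu, -⟩
      exact hMex v (hS hu)

end Alternating

/-! ### Balanced colourings and partial cycle covers -/

section Balanced

variable {V : Type} {G : SimpleGraph V}

/-- Incidence between vertices and edges. -/
def edgeInc (G : SimpleGraph V) (v : V) (e : G.edgeSet) : Prop := v ∈ (e : Sym2 V)

/-- The set of coloured edges. -/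
def colourSupp (f : G.edgeSet → Fin 3) : Set (Sym2 V) := {e | ∃ h : e ∈ G.edgeSet, f ⟨e, h⟩ ≠ 0}

open Classical in
/-- The colour of the edge between two vertices, `0` if there is none. -/
noncomputable def pairColour (f : G.edgeSet → Fin 3) (u v : V) : Fin 3 :=
  if h : G.Adj u v then f ⟨s(u, v), h⟩ else 0

theorem pairColour_symm (f : G.edgeSet → Fin 3) (u v : V) :
    pairColour f u v = pairColour f v u := by
  by_cases h : G.Adj u v
  · rw [pairColour, pairColour, dif_pos h, dif_pos h.symm]
    congr 2
    exact Sym2.eq_swap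
  · rw [pairColour, pairColour, dif_neg h, dif_neg fun h' => h h'.symm]

theorem pairColour_eq_iff {f : G.edgeSet → Fin 3} {i : Fin 3} (hi : i ≠ 0) {u v : V} :
    pairColour f u v = i ↔ ∃ h : G.Adj u v, f ⟨s(u, v), h⟩ = i := by
  rw [pairColour]
  split_ifs with h
  · exact ⟨fun h' => ⟨h, h'⟩, fun ⟨_, h'⟩ => h'⟩
  · exact iff_of_false hi.symm fun ⟨h', _⟩ => h h'

theorem pairColour_ne_zero_iff (f : G.edgeSet → Fin 3) (u v : V) :
    pairColour f u v ≠ 0 ↔ (SimpleGraph.fromEdgeSet (colourSupp f)).Adj u v := by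
  rw [SimpleGraph.fromEdgeSet_adj, pairColour]
  constructor
  · intro h
    split_ifs at h with hadj
    · exact ⟨⟨hadj, h⟩, hadj.ne⟩
    · exact absurd rfl h
  · rintro ⟨⟨hadj, h⟩, -⟩
    rw [dif_pos (show G.Adj u v from hadj)]
    exact h

theorem exists_pairColour_eq_iff {f : G.edgeSet → Fin 3} {i : Fin 3} (hi : i ≠ 0) {v : V} :
    (∃ u, pairColour f v u = i) ↔ ∃ e, edgeInc G v e ∧ f e = i := by
  simp only [pairColour_eq_iff hi]
  constructor
  · rintro ⟨u, h, hf⟩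
    exact ⟨⟨s(v, u), h⟩, Sym2.mem_mk_left v u, hf⟩
  · rintro ⟨⟨e, he⟩, ⟨u, rfl⟩, hf⟩
    exact ⟨u, he, hf⟩

theorem pairColour_injective :
    Function.Injective (pairColour : (G.edgeSet → Fin 3) → V → V → Fin 3) := by
  intro f g h
  funext ⟨e, he⟩
  induction e using Sym2.ind with
  | _ u v =>
    have := congrFun (congrFun h u) v
    rwa [pairColour, pairColour, dif_pos (show G.Adj u v from he),
      dif_pos (show G.Adj u v from he)] at this

variable [Fintype V]

open Classical in
/-- The number of edges at `v` of colour `i`. -/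
noncomputable def colourDegree (f : G.edgeSet → Fin 3) (i : Fin 3) (v : V) : ℕ :=
  (Finset.univ.filter fun e => edgeInc G v e ∧ f e = i).card

-- The handshake lemma for one colour class.
open Classical in
theorem sum_colourDegree (f : G.edgeSet → Fin 3) (i : Fin 3) :
    ∑ v, colourDegree f i v = 2 * (Finset.univ.filter fun e => f e = i).card := by
  have := Finset.sum_card_bipartiteAbove_eq_sum_card_bipartiteBelow (edgeInc G)
    (s := Finset.univ) (t := Finset.univ.filter fun e => f e = i)
  have h1 : ∀ v, colourDegree f i v
      = ((Finset.univ.filter fun e => f e = i).bipartiteAbove (edgeInc G) v).card := fun v => by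
    rw [colourDegree, Finset.bipartiteAbove, Finset.filter_filter]
    simp only [and_comm]
  have h2 : ∀ e : G.edgeSet, (Finset.univ.bipartiteBelow (edgeInc G) e).card = 2 := fun e => by
    rw [← Sym2.card_toFinset_of_not_isDiag _ (G.not_isDiag_of_mem_edgeSet e.2)]
    congr 1
    ext v
    simp [Finset.mem_bipartiteBelow, edgeInc]
  simp only [h1, this, h2, Finset.sum_const, smul_eq_mul, mul_comm]

theorem colourDegree_pos_iff {f : G.edgeSet → Fin 3} {i : Fin 3} {v : V} :
    0 < colourDegree f i v ↔ ∃ e, edgeInc G v e ∧ f e = i := by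
  rw [colourDegree, Finset.card_pos]
  simp [Finset.Nonempty]

theorem colourDegree_le_one_iff {f : G.edgeSet → Fin 3} {i : Fin 3} (hi : i ≠ 0) {v : V} :
    colourDegree f i v ≤ 1 ↔ ∀ u w, pairColour f v u = i → pairColour f v w = i → u = w := by
  rw [colourDegree, Finset.card_le_one]
  simp only [pairColour_eq_iff hi, Finset.mem_filter, Finset.mem_univ, true_and]
  constructor
  · rintro h u w ⟨hu, hfu⟩ ⟨hw, hfw⟩
    have := h ⟨s(v, u), hu⟩ ⟨Sym2.mem_mk_left v u, hfu⟩ ⟨s(v, w), hw⟩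
      ⟨Sym2.mem_mk_left v w, hfw⟩
    exact Sym2.congr_right.1 (Subtype.mk.inj this)
  · rintro h ⟨e, he⟩ ⟨⟨u, rfl⟩, hfu⟩ ⟨e', he'⟩ ⟨⟨w, rfl⟩, hfw⟩
    obtain rfl := h u w ⟨he, hfu⟩ ⟨he', hfw⟩
    rfl

open Classical in
/-- Balanced colourings with as few edges as possible are alternating. -/
theorem balanced_and_card_iff (f : G.edgeSet → Fin 3) :
    (Balanced (edgeInc G) f ∧
        (touched (edgeInc G) f).card = (Finset.univ.filter fun e => f e ≠ 0).card)
      ↔ IsAlternatingColouring (SimpleGraph.fromEdgeSet (colourSupp f)) (pairColour f) := by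
  have h12 : (Finset.univ.filter fun e => f e ≠ 0).card
      = (Finset.univ.filter fun e => f e = 1).card
        + (Finset.univ.filter fun e => f e = 2).card := by
    rw [← Finset.card_union_of_disjoint]
    · congr 1
      ext e
      have : ∀ x : Fin 3, x ≠ 0 ↔ x = 1 ∨ x = 2 := by decide
      simp [this]
    · rw [Finset.disjoint_filter]
      intro e _ h1 h2
      rw [h1] at h2
      exact absurd h2 (by decide)
  have hsum : ∑ v, (colourDegree f 1 v + colourDegree f 2 v)
      = 2 * (Finset.univ.filter fun e => f e ≠ 0).card := by
    rw [Finset.sum_add_distrib, sum_colourDegree, sum_colourDegree, h12, mul_add]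
  have htouch : ∑ v, (if v ∈ touched (edgeInc G) f then 2 else 0)
      = 2 * (touched (edgeInc G) f).card := by
    rw [← Finset.sum_filter, Finset.sum_const, smul_eq_mul, mul_comm]
    simp
  have hcases : ∀ x : Fin 3, x ≠ 0 → x = 1 ∨ x = 2 := by decide
  have hmem : ∀ v, v ∈ touched (edgeInc G) f ↔ 0 < colourDegree f 1 v := fun v => by
    rw [colourDegree_pos_iff]; simp [touched]
  have hbal : Balanced (edgeInc G) f ↔
      ∀ v, 0 < colourDegree f 1 v ↔ 0 < colourDegree f 2 v := by
    simp only [colourDegree_pos_iff, Balanced]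
  constructor
  · rintro ⟨hb, hcard⟩
    rw [hbal] at hb
    -- By balance every touched vertex has an edge of each colour, so the coloured degrees sum to at
    -- least twice the number of touched vertices. By the handshake lemma the sum is twice the
    -- number of coloured edges; equal cardinalities force exactly one edge of each colour at every
    -- touched vertex.
    have hle : ∀ v ∈ Finset.univ, (if v ∈ touched (edgeInc G) f then 2 else 0)
        ≤ colourDegree f 1 v + colourDegree f 2 v := fun v _ => by
      have := hb v
      simp only [hmem]
      split_ifs <;> omega
    have heq := (Finset.sum_eq_sum_iff_of_le hle).1 (by rw [hsum, htouch, hcard])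
    have hone : ∀ v, colourDegree f 1 v ≤ 1 ∧ colourDegree f 2 v ≤ 1 := fun v => by
      have h1 := heq v (Finset.mem_univ v)
      have := hb v
      simp only [hmem] at h1
      split_ifs at h1 <;> omega
    refine ⟨pairColour_symm f, pairColour_ne_zero_iff f, fun v u w hne h => ?_, fun v => ?_⟩
    · rcases hcases _ hne with h1 | h1
      · exact (colourDegree_le_one_iff (by decide)).1 (hone v).1 u w h1 (h ▸ h1)
      · exact (colourDegree_le_one_iff (by decide)).1 (hone v).2 u w h1 (h ▸ h1)
    · rw [exists_pairColour_eq_iff (by decide), exists_pairColour_eq_iff (by decide),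
        ← colourDegree_pos_iff, ← colourDegree_pos_iff]
      exact hb v
  · intro h
    have hb : ∀ v, 0 < colourDegree f 1 v ↔ 0 < colourDegree f 2 v := fun v => by
      have := h.balanced v
      rwa [exists_pairColour_eq_iff (by decide), exists_pairColour_eq_iff (by decide),
        ← colourDegree_pos_iff, ← colourDegree_pos_iff] at this
    have hone : ∀ i ≠ 0, ∀ v, colourDegree f i v ≤ 1 := fun i hi v =>
      (colourDegree_le_one_iff hi).2 fun u w hu hw =>
        h.unique v u w (by rwa [hu]) (hu.trans hw.symm)
    refine ⟨hbal.2 hb, ?_⟩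
    have : ∑ v, (if v ∈ touched (edgeInc G) f then 2 else 0)
        = ∑ v, (colourDegree f 1 v + colourDegree f 2 v) := by
      refine Finset.sum_congr rfl fun v _ => ?_
      have h1 := hone 1 (by decide) v
      have h2 := hone 2 (by decide) v
      have := hb v
      simp only [hmem]
      split_ifs <;> omega
    omega

theorem colourSupp_subset (f : G.edgeSet → Fin 3) : colourSupp f ⊆ G.edgeSet := fun _ h => h.1

open Classical in
theorem coe_touched_eq {f : G.edgeSet → Fin 3} (hb : Balanced (edgeInc G) f) :
    (touched (edgeInc G) f : Set V) = coveredVertices (colourSupp f) := by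
  ext v
  simp only [touched, Finset.coe_filter, Finset.mem_univ, true_and, Set.mem_ofPred_eq,
    coveredVertices, colourSupp]
  constructor
  · rintro ⟨⟨e, he⟩, hv, hf⟩
    exact ⟨e, ⟨he, by rw [hf]; decide⟩, hv⟩
  · rintro ⟨e, ⟨he, hf⟩, hv⟩
    have hcases : ∀ x : Fin 3, x ≠ 0 → x = 1 ∨ x = 2 := by decide
    rcases hcases _ hf with h | h
    · exact ⟨⟨e, he⟩, hv, h⟩
    · exact (hb v).2 ⟨⟨e, he⟩, hv, h⟩

theorem IsAlternatingColouring.ncard_neighborSet {H : SimpleGraph V} {κ : V → V → Fin 3}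
    (h : IsAlternatingColouring H κ) (v : V) :
    (H.neighborSet v).ncard = 0 ∨ (H.neighborSet v).ncard = 2 := by
  rcases (H.neighborSet v).eq_empty_or_nonempty with he | ⟨u, hu⟩
  · simp [he]
  · right
    have hcases : ∀ x : Fin 3, x ≠ 0 → x = 1 ∨ x = 2 := by decide
    obtain ⟨a, ha, b, hb⟩ : ∃ a, κ v a = 1 ∧ ∃ b, κ v b = 2 := by
      rcases hcases _ ((h.ne_zero_iff v u).2 hu) with h1 | h1
      · exact ⟨u, h1, (h.balanced v).1 ⟨u, h1⟩⟩
      · obtain ⟨a, ha⟩ := (h.balanced v).2 ⟨u, h1⟩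
        exact ⟨a, ha, u, h1⟩
    rw [Set.ncard_eq_two]
    refine ⟨a, b, fun hab => ?_, ?_⟩
    · rw [hab, hb] at ha
      exact absurd ha (by decide)
    · ext w
      rw [SimpleGraph.mem_neighborSet, ← h.ne_zero_iff]
      constructor
      · intro hw
        rcases hcases _ hw with h1 | h1
        · exact Or.inl (h.unique v w a hw (h1.trans ha.symm))
        · exact Or.inr (h.unique v w b hw (h1.trans hb.symm))
      · rintro (rfl | rfl)
        · rw [ha]; decide
        · rw [hb]; decide

/-- `SimpleGraph.fromEdgeSet` only forgets loops, and the edge set of `G` contains none. -/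
theorem fromEdgeSet_injOn {C D : Set (Sym2 V)} (hC : C ⊆ G.edgeSet) (hD : D ⊆ G.edgeSet)
    (h : SimpleGraph.fromEdgeSet C = SimpleGraph.fromEdgeSet D) : C = D := by
  have key : ∀ {C : Set (Sym2 V)}, C ⊆ G.edgeSet → (SimpleGraph.fromEdgeSet C).edgeSet = C := by
    intro C hC
    rw [SimpleGraph.edgeSet_fromEdgeSet]
    exact sdiff_eq_left.2 (Set.disjoint_left.2 fun e he hd =>
      G.not_isDiag_of_mem_edgeSet (hC he) hd)
  rw [← key hC, ← key hD, h]

-- By `balanced_and_card_iff` these are the alternating colourings of `(V, C)`, two choices for each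
-- cycle. Bipartiteness passes from `G` to this subgraph and guarantees that there is at least one.
open Classical in
theorem card_colourings_of_supp (hG : G.IsBipartite) {C : Set (Sym2 V)}
    (hC : IsPartialCycleCover G C) :
    (Finset.univ.filter fun f : G.edgeSet → Fin 3 =>
      (Balanced (edgeInc G) f ∧
        (touched (edgeInc G) f).card = (Finset.univ.filter fun e => f e ≠ 0).card) ∧
      colourSupp f = C).card = 2 ^ numCycles C := by
  have hle : SimpleGraph.fromEdgeSet C ≤ G := by
    intro u v h
    exact hC.1 ((SimpleGraph.fromEdgeSet_adj C).1 h).1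
  obtain ⟨κ₀, h₀⟩ := exists_alternatingColouring hC.2 (hG.mono_left hle)
  rw [numCycles, ← card_alternatingColouring h₀, ← Fintype.card_subtype, ← Nat.card_eq_fintype_card]
  have hsub : ∀ f : G.edgeSet → Fin 3, ((Balanced (edgeInc G) f ∧
        (touched (edgeInc G) f).card = (Finset.univ.filter fun e => f e ≠ 0).card) ∧
      colourSupp f = C) ↔ IsAlternatingColouring (SimpleGraph.fromEdgeSet C) (pairColour f) := by
    intro f
    rw [balanced_and_card_iff]
    constructor
    · rintro ⟨h, rfl⟩
      exact h
    · intro h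
      have : colourSupp f = C := by
        refine fromEdgeSet_injOn (colourSupp_subset f) hC.1 ?_
        ext u v
        rw [← h.ne_zero_iff, pairColour_ne_zero_iff]
      exact ⟨this.symm ▸ h, this⟩
  refine Nat.card_eq_of_bijective
    (fun f => ⟨pairColour f.1, (hsub f.1).1 f.2⟩) ⟨fun f g h => ?_, fun κ => ?_⟩
  · exact Subtype.ext (pairColour_injective (congrArg Subtype.val h))
  · have hκ := κ.2
    -- An alternating colouring is symmetric, so it descends to unordered pairs; off the edges of
    -- `G` it vanishes.
    have hpc : pairColour (fun e : G.edgeSet => Sym2.lift ⟨κ.1, hκ.symm⟩ e.1) = κ.1 := by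
      funext u v
      rw [pairColour]
      split_ifs with h
      · rfl
      · by_contra h0
        exact h (hle ((hκ.ne_zero_iff u v).1 (Ne.symm h0)))
    exact ⟨⟨_, (hsub _).2 (by rw [hpc]; exact hκ)⟩, Subtype.ext hpc⟩

open Classical in
/-- Counting balanced colourings with `ℓ` touched vertices and `ℓ` edges by their supports. -/
theorem card_balanced_eq (hG : G.IsBipartite) (ℓ : ℕ) (wt : Set (Sym2 V) → ℕ) (w : ℕ) :
    (Finset.univ.filter fun f : G.edgeSet → Fin 3 => Balanced (edgeInc G) f ∧
        (touched (edgeInc G) f).card = ℓ ∧ (Finset.univ.filter fun e => f e ≠ 0).card = ℓ ∧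
        wt (colourSupp f) = w).card
      = ∑ C : Set (Sym2 V) with IsPartialCycleCover G C ∧ (coveredVertices C).ncard = ℓ ∧ wt C = w,
          2 ^ numCycles C := by
  have hcov : ∀ f : G.edgeSet → Fin 3, Balanced (edgeInc G) f →
      (touched (edgeInc G) f).card = (coveredVertices (colourSupp f)).ncard := fun f hb => by
    rw [← coe_touched_eq hb, Set.ncard_coe_finset]
  rw [Finset.card_eq_sum_card_fiberwise (f := colourSupp)
    (t := Finset.univ.filter fun C => IsPartialCycleCover G C ∧
      (coveredVertices C).ncard = ℓ ∧ wt C = w)]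
  · refine Finset.sum_congr rfl fun C hC => ?_
    simp only [Finset.mem_filter, Finset.mem_univ, true_and] at hC
    rw [← card_colourings_of_supp hG hC.1, Finset.filter_filter]
    congr 1
    ext f
    simp only [Finset.mem_filter, Finset.mem_univ, true_and]
    constructor
    · rintro ⟨⟨hb, h1, h2, -⟩, h3⟩
      exact ⟨⟨hb, h1.trans h2.symm⟩, h3⟩
    · rintro ⟨⟨hb, h1⟩, rfl⟩
      have := hcov f hb
      exact ⟨⟨hb, this.trans hC.2.1, h1 ▸ this.trans hC.2.1, hC.2.2⟩, rfl⟩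
  · intro f hf
    simp only [Finset.coe_filter, Finset.mem_univ, true_and, Set.mem_ofPred_eq] at hf ⊢
    obtain ⟨hb, h1, h2, h3⟩ := hf
    have h := (balanced_and_card_iff f).1 ⟨hb, h1.trans h2.symm⟩
    exact ⟨⟨colourSupp_subset f, h.ncard_neighborSet⟩, (hcov f hb).symm.trans h1, h3⟩

theorem numCycles_le_card (C : Set (Sym2 V)) : numCycles C ≤ Fintype.card V := by
  have h1 : numCycles C ≤ Nat.card (SimpleGraph.fromEdgeSet C).ConnectedComponent :=
    Set.ncard_le_card _
  refine h1.trans ?_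
  rw [← Nat.card_eq_fintype_card]
  exact Nat.card_le_card_of_surjective _ Quot.mk_surjective

end Balanced

/-! ### Extracting digits -/

section Digits

variable {α : Type} {F : Finset α} {e : α → ℕ} {B : ℕ}

/-- Fewer than `B` powers, each at most `B ^ (m - 1)`, cannot add up to `B ^ m`. -/
theorem sum_pow_lt (hB : F.card < B) {m : ℕ} (he : ∀ a ∈ F, e a < m) :
    ∑ a ∈ F, B ^ e a < B ^ m := by
  rcases m with _ | m
  · have : F = ∅ := Finset.eq_empty_of_forall_notMem fun a ha => Nat.not_lt_zero _ (he a ha)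
    simp [this]
  · calc ∑ a ∈ F, B ^ e a ≤ F.card • B ^ m :=
          Finset.sum_le_card_nsmul _ _ _ fun a ha =>
            Nat.pow_le_pow_right (by omega) (Nat.lt_succ_iff.1 (he a ha))
      _ < B * B ^ m := Nat.mul_lt_mul_of_pos_right hB (Nat.pow_pos (by omega))
      _ = B ^ (m + 1) := by ring

/-- The number of exponents equal to `j` is a digit of the sum of powers. -/
theorem digit_sum_pow (hB : F.card < B) (j : ℕ) :
    (∑ a ∈ F, B ^ e a) / B ^ j % B = (F.filter fun a => e a = j).card := by
  have hpos : 0 < B ^ j := Nat.pow_pos (by omega)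
  -- The smaller exponents sum to less than `B ^ j`, the exponents equal to `j` give the digit, and
  -- the larger ones a multiple of `B ^ (j + 1)`. No carry arises because there are fewer than `B`
  -- terms.
  have hlt : ∑ a ∈ F with e a < j, B ^ e a < B ^ j :=
    sum_pow_lt ((Finset.card_filter_le _ _).trans_lt hB) fun a ha => (Finset.mem_filter.1 ha).2
  have heq : ∑ a ∈ F with e a = j, B ^ e a = (F.filter fun a => e a = j).card * B ^ j := by
    rw [Finset.sum_congr rfl fun a ha => by rw [(Finset.mem_filter.1 ha).2], Finset.sum_const,
      smul_eq_mul]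
  obtain ⟨h, hh⟩ : B ^ (j + 1) ∣ ∑ a ∈ F with j < e a, B ^ e a :=
    Finset.dvd_sum fun a ha => pow_dvd_pow _ (Finset.mem_filter.1 ha).2
  have hsplit : ∑ a ∈ F, B ^ e a = ∑ a ∈ F with e a < j, B ^ e a
      + (∑ a ∈ F with e a = j, B ^ e a + ∑ a ∈ F with j < e a, B ^ e a) := by
    rw [Finset.sum_filter, Finset.sum_filter, Finset.sum_filter, ← Finset.sum_add_distrib,
      ← Finset.sum_add_distrib]
    refine Finset.sum_congr rfl fun a _ => ?_
    rcases lt_trichotomy (e a) j with h | h | h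
    · simp [h, h.ne, h.le]
    · simp [h]
    · simp [h, h.ne', h.le]
  rw [hsplit, heq, hh, show ∀ x c : ℕ, x + (c * B ^ j + B ^ (j + 1) * h)
    = x + B ^ j * (c + B * h) from fun x c => by ring, Nat.add_mul_div_left _ _ hpos,
    Nat.div_eq_of_lt hlt, zero_add, Nat.add_mul_mod_self_left]
  exact Nat.mod_eq_of_lt ((Finset.card_filter_le _ _).trans_lt hB)

end Digits

/-! ### The isolation lemma for weights given by coin tosses -/

/-- The number with the binary digits `ω (i * r), …, ω (i * r + m - 1)`. -/
def coinNumber (ω : ℕ → Bool) (r i : ℕ) : ℕ → ℕ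
  | 0 => 0
  | m + 1 => 2 * coinNumber ω r i m + (ω (i * r + m)).toNat

theorem coinNumber_lt (ω : ℕ → Bool) (r i m : ℕ) : coinNumber ω r i m < 2 ^ m := by
  induction m with
  | zero => simp [coinNumber]
  | succ m ih =>
    have : (ω (i * r + m)).toNat ≤ 1 := Bool.toNat_le _
    rw [coinNumber, pow_succ]
    omega

theorem coinNumber_congr {ω ω' : ℕ → Bool} {r i m : ℕ}
    (h : ∀ b < m, ω (i * r + b) = ω' (i * r + b)) :
    coinNumber ω r i m = coinNumber ω' r i m := by
  induction m with
  | zero => rfl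
  | succ m ih =>
    rw [coinNumber, coinNumber, ih fun b hb => h b (by omega), h m (by omega)]

theorem coinNumber_injective {ω ω' : ℕ → Bool} {r i m : ℕ}
    (h : coinNumber ω r i m = coinNumber ω' r i m) :
    ∀ b < m, ω (i * r + b) = ω' (i * r + b) := by
  induction m with
  | zero => intro b hb; omega
  | succ m ih =>
    rw [coinNumber, coinNumber] at h
    have h1 : (ω (i * r + m)).toNat ≤ 1 := Bool.toNat_le _
    have h2 : (ω' (i * r + m)).toNat ≤ 1 := Bool.toNat_le _
    intro b hb
    rcases Nat.lt_succ_iff_lt_or_eq.1 hb with hb | rfl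
    · exact ih (by omega) b hb
    · have h3 : (ω (i * r + b)).toNat = (ω' (i * r + b)).toNat := by omega
      revert h3
      generalize ω (i * r + b) = x
      generalize ω' (i * r + b) = y
      revert x y
      decide

-- Reduces the probability of an event that depends on the first `M` tosses to counting bit strings.
open MeasureTheory in
open Classical in
theorem coinMeasure_restrict (M : ℕ) (S : Set (Finset.range M → Bool)) :
    coinMeasure {ω | (Finset.range M).restrict ω ∈ S}
      = (Finset.univ.filter fun x => x ∈ S).card / 2 ^ M := by
  have h1 : coinMeasure {ω | (Finset.range M).restrict ω ∈ S}
      = Measure.pi (fun _ : Finset.range M => (PMF.uniformOfFintype Bool).toMeasure) S :=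
    Measure.infinitePi_cylinder (μ := fun _ : ℕ => (PMF.uniformOfFintype Bool).toMeasure)
      (s := Finset.range M) (S := S) (Set.toFinite S).measurableSet
  have h2 : S = ((Finset.univ.filter fun x => x ∈ S : Finset (Finset.range M → Bool)) : Set _) := by
    ext; simp
  rw [h1]
  conv_lhs => rw [h2]
  rw [← sum_measure_singleton]
  have h3 : ∀ x : Finset.range M → Bool,
      Measure.pi (fun _ : Finset.range M => (PMF.uniformOfFintype Bool).toMeasure) {x}
        = (2 ^ M)⁻¹ := by
    intro x
    rw [Measure.pi_singleton]
    simp [ENNReal.inv_pow]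
  rw [Finset.sum_congr rfl fun x _ => h3 x, Finset.sum_const, nsmul_eq_mul, ENNReal.div_eq_inv_mul,
    mul_comm]

/-! ### Unique minima under random weights. -/

section Isolation

variable {N : ℕ} (F : Finset (Finset (Fin N))) (r : ℕ)

/-- The weight of a set of indices. -/
def setWeight (ω : ℕ → Bool) (A : Finset (Fin N)) : ℕ := ∑ i ∈ A, coinNumber ω r i r

/-- Some set of minimum weight contains `i` and another one does not. -/
def Ambiguous (i : Fin N) (ω : ℕ → Bool) : Prop :=
  ∃ A ∈ F, ∃ B ∈ F, i ∈ A ∧ i ∉ B ∧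
    (∀ C ∈ F, setWeight r ω A ≤ setWeight r ω C) ∧ ∀ C ∈ F, setWeight r ω B ≤ setWeight r ω C

/-- There is a unique set of minimum weight. -/
def Isolating (ω : ℕ → Bool) : Prop :=
  ∃ A ∈ F, ∀ B ∈ F, setWeight r ω B ≤ setWeight r ω A → B = A

variable {F r}

/-- Two different sets of minimum weight differ in some index. -/
theorem exists_ambiguous (hF : F.Nonempty) {ω : ℕ → Bool} (h : ¬ Isolating F r ω) :
    ∃ i, Ambiguous F r i ω := by
  obtain ⟨A, hA, hmin⟩ := F.exists_min_image (setWeight r ω) hF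
  simp only [Isolating, not_exists, not_and, not_forall] at h
  obtain ⟨B, hB, hle, hne⟩ := h A hA
  have hminB : ∀ C ∈ F, setWeight r ω B ≤ setWeight r ω C := fun C hC => hle.trans (hmin C hC)
  have : ∃ i, ¬ (i ∈ B ↔ i ∈ A) := by
    by_contra hcon
    push Not at hcon
    exact hne (Finset.ext hcon)
  obtain ⟨i, hi⟩ := this
  refine ⟨i, ?_⟩
  by_cases hiA : i ∈ A
  · exact ⟨A, hA, B, hB, hiA, fun h => hi (iff_of_true h hiA), hmin, hminB⟩
  · refine ⟨B, hB, A, hA, ?_, hiA, hminB, hmin⟩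
    by_contra hiB
    exact hi (iff_of_false hiB hiA)

/-- With the other weights fixed, the minimum over the sets avoiding `i` is a constant, and the
minimum over those containing `i` is a constant plus the weight of `i`. Ambiguity says that the two
minima agree, which leaves one possible weight for `i`. -/
theorem Ambiguous.coinNumber_eq {i : Fin N} {ω ω' : ℕ → Bool} (h : Ambiguous F r i ω)
    (h' : Ambiguous F r i ω') (hagree : ∀ j : Fin N, j ≠ i → coinNumber ω r j r = coinNumber ω' r j r) :
    coinNumber ω r i r = coinNumber ω' r i r := by
  obtain ⟨A, hA, B, hB, hiA, hiB, hminA, hminB⟩ := h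
  obtain ⟨A', hA', B', hB', hiA', hiB', hminA', hminB'⟩ := h'
  have hnot : ∀ C : Finset (Fin N), i ∉ C → setWeight r ω C = setWeight r ω' C := fun C hC =>
    Finset.sum_congr rfl fun j hj => hagree j fun h => hC (h ▸ hj)
  have hmem : ∀ C : Finset (Fin N), i ∈ C → setWeight r ω C + coinNumber ω' r i r
      = setWeight r ω' C + coinNumber ω r i r := fun C hC => by
    have := hnot (C.erase i) (Finset.notMem_erase i C)
    simp only [setWeight] at this ⊢
    rw [← Finset.add_sum_erase _ _ hC, ← Finset.add_sum_erase _ _ hC, this]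
    ring
  -- Under both outcomes `A` and `A'` are lightest among the sets containing `i`, and `B` and `B'`
  -- among those avoiding it. From `ω` to `ω'` the former all shift by the change in the weight of
  -- `i`, the latter do not move.
  have e1 := hminA B hB
  have e2 := hminB A hA
  have e3 := hminA' B' hB'
  have e4 := hminB' A' hA'
  have e5 := hminA A' hA'
  have e6 := hminA' A hA
  have e7 := hminB B' hB'
  have e8 := hminB' B hB
  have := hnot B hiB
  have := hnot B' hiB'
  have := hmem A hiA
  have := hmem A' hiA'
  omega

/-- Extend finitely many coin tosses by `false`. -/
def extendCoins (M : ℕ) (x : Finset.range M → Bool) (j : ℕ) : Bool :=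
  if h : j ∈ Finset.range M then x ⟨j, h⟩ else false

theorem coinNumber_extend (ω : ℕ → Bool) {i : ℕ} (hi : i < N) :
    coinNumber (extendCoins (N * r) ((Finset.range (N * r)).restrict ω)) r i r
      = coinNumber ω r i r := by
  refine coinNumber_congr fun b hb => ?_
  have : i * r + b < N * r := by
    calc i * r + b < i * r + r := by omega
      _ = (i + 1) * r := by ring
      _ ≤ N * r := Nat.mul_le_mul_right _ hi
  simp [extendCoins, this]

theorem setWeight_extend (ω : ℕ → Bool) (A : Finset (Fin N)) :
    setWeight r (extendCoins (N * r) ((Finset.range (N * r)).restrict ω)) A = setWeight r ω A :=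
  Finset.sum_congr rfl fun i _ => coinNumber_extend ω i.2

theorem ambiguous_extend {i : Fin N} {ω : ℕ → Bool} :
    Ambiguous F r i (extendCoins (N * r) ((Finset.range (N * r)).restrict ω))
      ↔ Ambiguous F r i ω := by
  simp only [Ambiguous, setWeight_extend]

-- Adding an arbitrary string of `r` bits to the coins of index `i` maps pairs of a string and an
-- ambiguous outcome injectively to outcomes: the other coins are untouched, they determine the
-- weight of `i` in the ambiguous outcome, hence its coins, and then the string.
open Classical in
theorem card_ambiguous_le (i : Fin N) :
    2 ^ r * (Finset.univ.filter fun x => Ambiguous F r i (extendCoins (N * r) x)).card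
      ≤ 2 ^ (N * r) := by
  let S := {x : Finset.range (N * r) → Bool // Ambiguous F r i (extendCoins (N * r) x)}
  have hlt : ∀ {j : Fin N} {b}, b < r → j * r + b < N * r := fun {j b} hb => by
    calc j * r + b < j * r + r := by omega
      _ = (j + 1) * r := by ring
      _ ≤ N * r := Nat.mul_le_mul_right _ j.2
  let φ : (Fin r → Bool) × S → (Finset.range (N * r) → Bool) := fun p j =>
    if h : ∃ b : Fin r, j.1 = i * r + b then xor (p.1 h.choose) (p.2.1 j) else p.2.1 j
  have hφ : ∀ p (b : Fin r), φ p ⟨i * r + b, Finset.mem_range.2 (hlt b.2)⟩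
      = xor (p.1 b) (p.2.1 ⟨i * r + b, Finset.mem_range.2 (hlt b.2)⟩) := by
    intro p b
    have h : ∃ b' : Fin r, i * r + (b : ℕ) = i * r + b' := ⟨b, rfl⟩
    have hb : h.choose = b := Fin.ext (by have := h.choose_spec; omega)
    simp only [φ]
    rw [dif_pos h, hb]
  have hinj : Function.Injective φ := by
    rintro ⟨c, x, hx⟩ ⟨c', x', hx'⟩ h
    have hout : ∀ j : Finset.range (N * r), (¬ ∃ b : Fin r, j.1 = i * r + b) → x j = x' j := by
      intro j hj
      have := congrFun h j
      simpa only [φ, dif_neg hj] using this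
    have hnum := hx.coinNumber_eq hx' fun j hj => coinNumber_congr fun b hb => by
      have hm : (j : ℕ) * r + b ∈ Finset.range (N * r) := Finset.mem_range.2 (hlt hb)
      simp only [extendCoins, hm, dif_pos]
      refine hout _ ?_
      rintro ⟨b', hb'⟩
      simp only at hb'
      refine hj (Fin.ext ?_)
      -- The blocks of coins of different indices are disjoint, since division by `r` recovers the
      -- index.
      have h1 : ((j : ℕ) * r + b) / r = j := by
        rw [mul_comm, Nat.mul_add_div (by omega), Nat.div_eq_of_lt hb, add_zero]
      have h2 : ((i : ℕ) * r + b') / r = i := by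
        rw [mul_comm, Nat.mul_add_div (by omega), Nat.div_eq_of_lt b'.2, add_zero]
      rw [← h1, ← h2, hb']
    have hbits := coinNumber_injective hnum
    have hxx : x = x' := by
      funext j
      by_cases hj : ∃ b : Fin r, j.1 = i * r + b
      · obtain ⟨b, hb⟩ := hj
        have := hbits b b.2
        rw [← hb] at this
        simpa only [extendCoins, j.2, dif_pos] using this
      · exact hout j hj
    subst hxx
    have hcc : c = c' := by
      funext b
      have := congrFun h ⟨i * r + b, Finset.mem_range.2 (hlt b.2)⟩
      rw [hφ, hφ] at this
      simpa using this
    rw [hcc]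
  have := Fintype.card_le_of_injective φ hinj
  rw [Fintype.card_prod, Fintype.card_fun, Fintype.card_fun, Fintype.card_subtype] at this
  simpa using this

/-- **Isolation lemma**: with probability at least one half, there is a unique set of minimum
weight in a nonempty family. -/
theorem coinMeasure_not_isolating_le (hF : F.Nonempty) (hr : 2 * N ≤ 2 ^ r) :
    coinMeasure {ω | ¬ Isolating F r ω} ≤ 1 / 2 := by
  classical
  have hsub : {ω | ¬ Isolating F r ω} ⊆ ⋃ i : Fin N, {ω | Ambiguous F r i ω} := fun ω hω =>
    Set.mem_iUnion.2 (exists_ambiguous hF hω)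
  have hone : ∀ i : Fin N, coinMeasure {ω | Ambiguous F r i ω} ≤ (2 ^ r)⁻¹ := by
    intro i
    have h1 := coinMeasure_restrict (N * r) {x | Ambiguous F r i (extendCoins (N * r) x)}
    simp only [Set.mem_ofPred_eq, ambiguous_extend] at h1
    rw [h1]
    refine ENNReal.div_le_of_le_mul ?_
    rw [← ENNReal.div_eq_inv_mul, ENNReal.le_div_iff_mul_le (by simp) (by simp), mul_comm]
    exact_mod_cast card_ambiguous_le (F := F) (r := r) i
  calc coinMeasure {ω | ¬ Isolating F r ω}
      ≤ ∑ i : Fin N, coinMeasure {ω | Ambiguous F r i ω} :=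
        (MeasureTheory.measure_mono hsub).trans (MeasureTheory.measure_iUnion_fintype_le _ _)
    _ ≤ ∑ _i : Fin N, (2 ^ r)⁻¹ := Finset.sum_le_sum fun i _ => hone i
    _ = N * (2 ^ r)⁻¹ := by simp
    _ ≤ 1 / 2 := by
      rw [← div_eq_mul_inv, ENNReal.div_le_iff (by simp) (by simp), one_div,
        ← ENNReal.div_eq_inv_mul, ENNReal.le_div_iff_mul_le (by simp) (by simp), mul_comm]
      exact_mod_cast hr

end Isolation

/-! ### Depth-first search with constant memory per node

The nodes are `0, …, n`, where `0` is an artificial root; `par c` is the parent of `c + 1`. -/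

/-- The state of the search: the current node, and for each node a value from `{0, 1, 2, 3}`, the
product over the children treated so far, the sum over the values treated so far, and the next
candidate for a child. -/
structure Search where
  cur : ℕ
  st : ℕ → ℕ
  pr : ℕ → ℕ
  sm : ℕ → ℕ
  ch : ℕ → ℕ

namespace Search

variable (n : ℕ) (par : ℕ → ℕ) (Q : ℕ) (loc : (ℕ → ℕ) → ℕ → ℕ)

/-- One step of the search. The value `4` at the root marks the end. -/
def step (s : Search) : Search :=
  if s.ch s.cur < n then
    if par (s.ch s.cur) = s.cur then
      { cur := s.ch s.cur + 1
        st := s.st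
        pr := Function.update s.pr (s.ch s.cur + 1) (loc s.st (s.ch s.cur + 1))
        sm := Function.update s.sm (s.ch s.cur + 1) 0
        ch := Function.update (Function.update s.ch s.cur (s.ch s.cur + 1)) (s.ch s.cur + 1) 0 }
    else { s with ch := Function.update s.ch s.cur (s.ch s.cur + 1) }
  -- All candidates have been examined, so `pr` is the complete term for the present value; it joins
  -- the sum, and the scan restarts with the next value.
  else if s.st s.cur < 3 then
    { cur := s.cur
      st := Function.update s.st s.cur (s.st s.cur + 1)
      pr := Function.update s.pr s.cur
        (loc (Function.update s.st s.cur (s.st s.cur + 1)) s.cur)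
      sm := Function.update s.sm s.cur ((s.sm s.cur + s.pr s.cur) % Q)
      ch := Function.update s.ch s.cur 0 }
  -- The artificial root starts with the value `3` and so makes a single pass; its sum becomes the
  -- product over the roots of the forest.
  else if s.cur = 0 then
    { s with
      st := Function.update s.st 0 4
      sm := Function.update s.sm 0 ((s.sm 0 + s.pr 0) % Q) }
  -- The four terms of the node are complete. Their sum enters the product of the parent, and the
  -- value is reset because nodes off the current path must have value `0`.
  else
    { cur := par (s.cur - 1)
      st := Function.update s.st s.cur 0
      pr := Function.update s.pr (par (s.cur - 1))
        ((s.pr (par (s.cur - 1)) * ((s.sm s.cur + s.pr s.cur) % Q)) % Q)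
      sm := Function.update s.sm s.cur ((s.sm s.cur + s.pr s.cur) % Q)
      ch := s.ch }

variable {n par Q loc}

/-- The search leads from `s` to `s'` in `N` steps, without having been finished before. -/
inductive Reach (n : ℕ) (par : ℕ → ℕ) (Q : ℕ) (loc : (ℕ → ℕ) → ℕ → ℕ) :
    ℕ → Search → Search → Prop
  | refl (s : Search) : Reach n par Q loc 0 s s
  | head {N : ℕ} {s s' : Search} : s.st 0 = 3 → Reach n par Q loc N (step n par Q loc s) s' →
      Reach n par Q loc (N + 1) s s'

theorem Reach.trans {N N' : ℕ} {s s' s'' : Search} (h : Reach n par Q loc N s s')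
    (h' : Reach n par Q loc N' s' s'') : Reach n par Q loc (N + N') s s'' := by
  induction h with
  | refl => simpa using h'
  | head h0 _ ih => rw [Nat.add_right_comm]; exact .head h0 (ih h')

theorem Reach.single {s : Search} (h : s.st 0 = 3) : Reach n par Q loc 1 s (step n par Q loc s) :=
  .head h (.refl _)

/-- What the search needs to know about the forest: `sub v u` says that `u` is in the subtree of
`v`, `Ok v σ` that `σ` vanishes outside the path to `v`; `F v σ` is the value to be computed for
the subtree of `v`, and `I v` bounds the number of steps needed for that. -/
structure Spec (n : ℕ) (par : ℕ → ℕ) (Q : ℕ) (loc : (ℕ → ℕ) → ℕ → ℕ) (sub : ℕ → ℕ → Prop)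
    (Ok : ℕ → (ℕ → ℕ) → Prop) (F : ℕ → (ℕ → ℕ) → ZMod Q) (I : ℕ → ℕ) : Prop where
  sub_refl : ∀ v, sub v v
  sub_child : ∀ c < n, ∀ u, sub (c + 1) u → sub (par c) u
  not_sub : ∀ c < n, ¬ sub (c + 1) (par c)
  ok_child : ∀ c < n, ∀ σ, Ok (par c) σ → Ok (c + 1) σ ∧ σ (c + 1) = 0
  ok_update : ∀ v σ q, Ok v σ → Ok v (Function.update σ v q)
  induct : ∀ P : ℕ → Prop, (∀ c < n, (∀ d < n, par d = c + 1 → P d) → P c) → ∀ c < n, P c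
  value : ∀ c < n, ∀ σ, Ok (c + 1) σ → F (c + 1) σ = ∑ q ∈ Finset.range 4,
    (loc (Function.update σ (c + 1) q) (c + 1) : ZMod Q) *
      ∏ d ∈ Finset.range n with par d = c + 1, F (d + 1) (Function.update σ (c + 1) q)
  steps : ∀ c < n, 4 * (n + 1 + ∑ d ∈ Finset.range n with par d = c + 1, I (d + 1)) ≤ I (c + 1)

variable {sub : ℕ → ℕ → Prop} {Ok : ℕ → (ℕ → ℕ) → Prop} {F : ℕ → (ℕ → ℕ) → ZMod Q} {I : ℕ → ℕ}

/-- The search treats the subtree of `c + 1` correctly. -/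
def CallSpec (n : ℕ) (par : ℕ → ℕ) (Q : ℕ) (loc : (ℕ → ℕ) → ℕ → ℕ) (sub : ℕ → ℕ → Prop)
    (Ok : ℕ → (ℕ → ℕ) → Prop) (F : ℕ → (ℕ → ℕ) → ZMod Q) (I : ℕ → ℕ) (c : ℕ) : Prop :=
  ∀ s : Search, s.st 0 = 3 → s.cur = c + 1 → Ok (c + 1) s.st → s.st (c + 1) = 0 →
    s.ch (c + 1) = 0 → s.sm (c + 1) = 0 → s.pr (c + 1) = loc s.st (c + 1) →
    ∃ N ≤ I (c + 1), ∃ s', Reach n par Q loc N s s' ∧ s'.cur = par c ∧ s'.st = s.st ∧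
      (s'.pr (par c) : ZMod Q) = s.pr (par c) * F (c + 1) s.st ∧
      ∀ u, ¬ sub (c + 1) u →
        s'.ch u = s.ch u ∧ s'.sm u = s.sm u ∧ (u ≠ par c → s'.pr u = s.pr u)

/-- Induction on the number `k` of candidates left. A candidate that is a child is handled by
`hcall` and multiplies `pr v` by its value; any other costs a single step. The last clause, that
nothing outside the subtree changes, is what lets the calls be chained. -/
theorem scan (H : Spec n par Q loc sub Ok F I) {v : ℕ}
    (hcall : ∀ c < n, par c = v → CallSpec n par Q loc sub Ok F I c) (k : ℕ) :
    ∀ j, j + k = n → ∀ s : Search, s.st 0 = 3 → s.cur = v → Ok v s.st → s.ch v = j →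
    ∃ N ≤ k + ∑ d ∈ Finset.Ico j n with par d = v, I (d + 1),
      ∃ s', Reach n par Q loc N s s' ∧ s'.cur = v ∧ s'.st = s.st ∧ s'.ch v = n ∧
        (s'.pr v : ZMod Q) = s.pr v * ∏ d ∈ Finset.Ico j n with par d = v, F (d + 1) s.st ∧
        s'.sm v = s.sm v ∧
        ∀ u, ¬ sub v u → s'.ch u = s.ch u ∧ s'.sm u = s.sm u ∧ s'.pr u = s.pr u := by
  induction k with
  | zero =>
    intro j hj s h3 hcur hok hch
    obtain rfl : j = n := hj
    exact ⟨0, Nat.zero_le _, s, .refl s, hcur, rfl, hch, by simp, rfl, fun u _ => ⟨rfl, rfl, rfl⟩⟩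
  | succ k ih =>
    intro j hj s h3 hcur hok hch
    have hjn : j < n := by omega
    have hIco : Finset.Ico j n = insert j (Finset.Ico (j + 1) n) := by
      ext x; simp only [Finset.mem_Ico, Finset.mem_insert]; omega
    have hnot : j ∉ Finset.filter (fun d => par d = v) (Finset.Ico (j + 1) n) := by simp
    rw [hIco, Finset.filter_insert]
    have hstep := Reach.single (n := n) (par := par) (Q := Q) (loc := loc) h3
    by_cases hp : par j = v
    · have hs : step n par Q loc s =
          { cur := j + 1
            st := s.st
            pr := Function.update s.pr (j + 1) (loc s.st (j + 1))
            sm := Function.update s.sm (j + 1) 0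
            ch := Function.update (Function.update s.ch v (j + 1)) (j + 1) 0 } := by
        simp [step, hcur, hch, hjn, hp]
      have hnv : ¬ sub (j + 1) v := hp ▸ H.not_sub j hjn
      have hne : v ≠ j + 1 := fun h => hnv (h ▸ H.sub_refl _)
      obtain ⟨hok', hst0⟩ := H.ok_child j hjn s.st (hp.symm ▸ hok)
      obtain ⟨N, hN, s', hr, hcur', hst', hpr', hfr⟩ := hcall j hjn hp
        (step n par Q loc s) (by rw [hs]; exact h3) (by rw [hs]) (by rw [hs]; exact hok')
        (by rw [hs]; exact hst0) (by simp [hs]) (by simp [hs]) (by simp [hs])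
      simp only [hp, hs] at hcur' hst' hpr' hfr
      obtain ⟨N', hN', s'', hr', hcur'', hst'', hch'', hpr'', hsm'', hfr'⟩ :=
        ih (j + 1) (by omega) s' (by rw [hst']; exact h3) hcur' (by rw [hst']; exact hok)
          (by rw [(hfr v hnv).1]; simp [hne])
      refine ⟨1 + (N + N'), ?_, s'', hstep.trans (hr.trans hr'), hcur'', hst''.trans hst', hch'',
        ?_, ?_, ?_⟩
      · rw [if_pos hp, Finset.sum_insert hnot]
        omega
      · rw [hpr'', hpr', hst']
        rw [if_pos hp, Finset.prod_insert hnot]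
        simp only [ne_eq, hne, not_false_eq_true, Function.update_of_ne]
        ring
      · rw [hsm'', (hfr v hnv).2.1]; simp [hne]
      · intro u hu
        have hu1 : ¬ sub (j + 1) u := fun h => hu (hp ▸ H.sub_child j hjn u h)
        have hu2 : u ≠ j + 1 := fun h => hu1 (h ▸ H.sub_refl _)
        have hu3 : u ≠ v := fun h => hu (h ▸ H.sub_refl _)
        obtain ⟨a1, a2, a3⟩ := hfr u hu1
        obtain ⟨b1, b2, b3⟩ := hfr' u hu
        rw [b1, b2, b3, a1, a2, a3 hu3]
        simp [hu2, hu3]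
    · have hs : step n par Q loc s = { s with ch := Function.update s.ch v (j + 1) } := by
        simp [step, hcur, hch, hjn, hp]
      rw [hs] at hstep
      obtain ⟨N, hN, s', hr, hcur', hst', hch', hpr', hsm', hfr⟩ :=
        ih (j + 1) (by omega) { s with ch := Function.update s.ch v (j + 1) } h3 hcur hok (by simp)
      rw [if_neg hp]
      refine ⟨1 + N, by omega, s', hstep.trans hr, hcur', hst', hch', hpr', hsm', ?_⟩
      intro u hu
      have hu3 : u ≠ v := fun h => hu (h ▸ H.sub_refl _)
      obtain ⟨b1, b2, b3⟩ := hfr u hu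
      rw [b1, b2, b3]
      simp [hu3]

/-- Induction from the leaves upwards. A node makes four passes, one for each value `q`; a pass
needs at most `n` steps for the candidates, `S` steps inside the subtrees, and one step to close it.
-/
theorem call (H : Spec n par Q loc sub Ok F I) : ∀ c < n, CallSpec n par Q loc sub Ok F I c := by
  refine H.induct _ fun c hc IH s h3 hcur hok hst hch hsm hpr => ?_
  have hne0 : (0 : ℕ) ≠ c + 1 := by omega
  have hnp : ¬ sub (c + 1) (par c) := H.not_sub c hc
  have hpne : par c ≠ c + 1 := fun h => hnp (h.symm ▸ H.sub_refl _)
  let S := ∑ d ∈ Finset.range n with par d = c + 1, I (d + 1)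
  let G : ℕ → ZMod Q := fun q => (loc (Function.update s.st (c + 1) q) (c + 1) : ZMod Q) *
      ∏ d ∈ Finset.range n with par d = c + 1, F (d + 1) (Function.update s.st (c + 1) q)
  -- one pass through the children
  have hpass : ∀ q (a : Search), a.cur = c + 1 → a.st = Function.update s.st (c + 1) q →
      a.ch (c + 1) = 0 → a.pr (c + 1) = loc a.st (c + 1) →
      ∃ N ≤ n + S, ∃ b, Reach n par Q loc N a b ∧ b.cur = c + 1 ∧ b.st = a.st ∧ b.ch (c + 1) = n ∧
        (b.pr (c + 1) : ZMod Q) = G q ∧ b.sm (c + 1) = a.sm (c + 1) ∧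
        ∀ u, ¬ sub (c + 1) u → b.ch u = a.ch u ∧ b.sm u = a.sm u ∧ b.pr u = a.pr u := by
    intro q a ha1 ha2 ha3 ha4
    obtain ⟨N, hN, b, h1, h2, h3', h4, h5, h6, h7⟩ := scan H IH n 0 (by omega) a
      (by rw [ha2]; simpa [hne0] using h3) ha1 (ha2 ▸ H.ok_update _ _ _ hok) ha3
    rw [Nat.Ico_zero_eq_range] at hN h5
    exact ⟨N, hN, b, h1, h2, h3', h4, by rw [h5, ha4, ha2], h6, h7⟩
  -- After `q` completed passes the sum holds the terms below `q`. The range stops at `3` since the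
  -- fourth pass is closed by the return to the parent.
  have hround : ∀ q ≤ 3, ∃ N ≤ q * (n + 1 + S), ∃ a, Reach n par Q loc N s a ∧ a.cur = c + 1 ∧
      a.st = Function.update s.st (c + 1) q ∧ a.ch (c + 1) = 0 ∧
      a.pr (c + 1) = loc a.st (c + 1) ∧
      (a.sm (c + 1) : ZMod Q) = ∑ q' ∈ Finset.range q, G q' ∧
      ∀ u, ¬ sub (c + 1) u → a.ch u = s.ch u ∧ a.sm u = s.sm u ∧ a.pr u = s.pr u := by
    intro q
    induction q with
    | zero =>
      intro _
      exact ⟨0, Nat.zero_le _, s, .refl s, hcur, by rw [← hst, Function.update_eq_self], hch, hpr,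
        by simp [hsm], fun u _ => ⟨rfl, rfl, rfl⟩⟩
    | succ q ih =>
      intro hq
      obtain ⟨N, hN, a, hr, a1, a2, a3, a4, a5, a6⟩ := ih (by omega)
      obtain ⟨N', hN', b, hr', b1, b2, b3, b4, b5, b6⟩ := hpass q a a1 a2 a3 a4
      have hb0 : b.st 0 = 3 := by rw [b2, a2]; simpa [hne0] using h3
      have hbst : b.st (c + 1) = q := by rw [b2, a2]; simp
      have hs : step n par Q loc b =
          { cur := c + 1
            st := Function.update s.st (c + 1) (q + 1)
            pr := Function.update b.pr (c + 1)
              (loc (Function.update s.st (c + 1) (q + 1)) (c + 1))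
            sm := Function.update b.sm (c + 1) ((b.sm (c + 1) + b.pr (c + 1)) % Q)
            ch := Function.update b.ch (c + 1) 0 } := by
        simp only [step, b1, b3, lt_irrefl, if_false, hbst, show q < 3 by omega, if_true]
        rw [b2, a2, Function.update_idem]
      refine ⟨N + (N' + 1), ?_, _, hr.trans (hr'.trans (.single hb0)), ?_⟩
      · rw [Nat.succ_mul]
        omega
      · rw [hs]
        refine ⟨rfl, rfl, by simp, by simp, ?_, fun u hu => ?_⟩
        · simp only [Function.update_self, ZMod.natCast_mod, Nat.cast_add]
          rw [b5, a5, b4, Finset.sum_range_succ]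
        · have hu2 : u ≠ c + 1 := fun h => hu (h ▸ H.sub_refl _)
          simp [hu2, b6 u hu, a6 u hu]
  obtain ⟨N, hN, a, hr, a1, a2, a3, a4, a5, a6⟩ := hround 3 le_rfl
  obtain ⟨N', hN', b, hr', b1, b2, b3, b4, b5, b6⟩ := hpass 3 a a1 a2 a3 a4
  have hb0 : b.st 0 = 3 := by rw [b2, a2]; simpa [hne0] using h3
  have hbst : b.st (c + 1) = 3 := by rw [b2, a2]; simp
  have hs : step n par Q loc b =
      { cur := par c
        st := s.st
        pr := Function.update b.pr (par c)
          (b.pr (par c) * ((b.sm (c + 1) + b.pr (c + 1)) % Q) % Q)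
        sm := Function.update b.sm (c + 1) ((b.sm (c + 1) + b.pr (c + 1)) % Q)
        ch := b.ch } := by
    simp only [step, b1, b3, lt_irrefl, if_false, hbst, Nat.succ_ne_zero, Nat.add_sub_cancel]
    rw [b2, a2, Function.update_idem, ← hst, Function.update_eq_self]
  refine ⟨N + (N' + 1), ?_, _, hr.trans (hr'.trans (.single hb0)), ?_⟩
  · have := H.steps c hc
    simp only [S] at hN hN'
    omega
  · rw [hs]
    refine ⟨rfl, rfl, ?_, fun u hu => ?_⟩
    · simp only [Function.update_self, ZMod.natCast_mod, Nat.cast_add, Nat.cast_mul]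
      rw [(b6 _ hnp).2.2, (a6 _ hnp).2.2, b5, a5, b4, ← Finset.sum_range_succ, H.value c hc _ hok]
    · have hu2 : u ≠ c + 1 := fun h => hu (h ▸ H.sub_refl _)
      refine ⟨?_, ?_, fun hu3 => ?_⟩ <;> simp [b6 u hu, a6 u hu, *]

/-- The search started at the artificial root computes the product of the values of the roots. -/
theorem run (H : Spec n par Q loc sub Ok F I) (s : Search) (hcur : s.cur = 0) (hst : s.st 0 = 3)
    (hok : Ok 0 s.st) (hch : s.ch 0 = 0) (hsm : s.sm 0 = 0) (hpr : s.pr 0 = 1) (hQ : 0 < Q) :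
    ∃ N ≤ n + 1 + ∑ d ∈ Finset.range n with par d = 0, I (d + 1),
      ∃ s', Reach n par Q loc N s s' ∧ s'.st 0 = 4 ∧ s'.sm 0 < Q ∧
        (s'.sm 0 : ZMod Q) = ∏ d ∈ Finset.range n with par d = 0, F (d + 1) s.st := by
  obtain ⟨N, hN, b, hr, b1, b2, b3, b4, b5, -⟩ :=
    scan H (fun c hc _ => call H c hc) n 0 (by omega) s hst hcur hok hch
  rw [Nat.Ico_zero_eq_range] at hN b4
  have hb0 : b.st 0 = 3 := by rw [b2, hst]
  have hs : step n par Q loc b = { b with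
      st := Function.update b.st 0 4
      sm := Function.update b.sm 0 ((b.sm 0 + b.pr 0) % Q) } := by
    simp [step, b1, b3, hb0]
  refine ⟨N + 1, by omega, _, hr.trans (.single hb0), ?_⟩
  rw [hs]
  refine ⟨by simp, by simpa using Nat.mod_lt _ hQ, ?_⟩
  simp only [Function.update_self, ZMod.natCast_mod, Nat.cast_add]
  rw [b5, b4, hsm, hpr]
  simp

end Search

/-! ### Notation for expressions and derived programs -/

instance : Add Expr := ⟨.arith .add⟩
instance : Sub Expr := ⟨.arith .sub⟩
instance : Mul Expr := ⟨.arith .mul⟩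
instance : Div Expr := ⟨.arith .div⟩
instance (x : ℕ) : OfNat Expr x := ⟨.const x⟩

/-- The remainder of a division. -/
def Expr.mod (e f : Expr) : Expr := e - e / f * f

/-- A cell of the array of scalars. -/
def Expr.scalar (i : ℕ) : Expr := .cell 0 (.const i)

section Val

variable (M : Memory) (e f : Expr)

@[simp] theorem Expr.val_add : (e + f).val M = e.val M + f.val M := rfl
@[simp] theorem Expr.val_sub : (e - f).val M = e.val M - f.val M := rfl
@[simp] theorem Expr.val_mul : (e * f).val M = e.val M * f.val M := rfl
@[simp] theorem Expr.val_div : (e / f).val M = e.val M / f.val M := rfl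
@[simp] theorem Expr.val_ofNat (x : ℕ) : (ofNat(x) : Expr).val M = ofNat(x) := rfl
@[simp] theorem Expr.val_const (x : ℕ) : (Expr.const x).val M = x := rfl
@[simp] theorem Expr.val_cell (a : ℕ) : (Expr.cell a e).val M = M (a, e.val M) := rfl
@[simp] theorem Expr.val_scalar (i : ℕ) : (Expr.scalar i).val M = M (0, i) := rfl

@[simp] theorem Expr.val_mod : (e.mod f).val M = e.val M % f.val M := by
  simp only [Expr.mod, Expr.val_sub, Expr.val_mul, Expr.val_div]
  exact Nat.mod_eq_sub_div_mul.symm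

end Val

/-- Execute `p` for the values `0, …, b - 1` of the scalar `c`. -/
def Prog.for (c : ℕ) (b : Expr) (p : Prog) : Prog :=
  .seq (.assign 0 (.const c) 0)
    (.loop (b - .scalar c) (.seq p (.assign 0 (.const c) (.scalar c + 1))))

/-- Store the power `x ^ b` in the scalar `d`. -/
def Prog.pow (d : ℕ) (x b : Expr) : Prog :=
  .seq (.assign 0 (.const d) 1)
    (.for 10 b (.assign 0 (.const d) (.scalar d * x)))

section Derived

variable {ω : ℕ → Bool} {D : ℕ}

/-- The body must preserve the counter. A round costs the body, the increment and the test; the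
final `2` accounts for the initial assignment and the failing test. -/
theorem Run.for (hD : 16 ≤ D) {c : ℕ} {b : Expr} {p : Prog}
    (Inv : ℕ → State → Prop) {L K : ℕ}
    (hB : ∀ j ≤ L, ∀ s, Inv j s → Bdd D s.mem ∧ s.mem (0, c) = j ∧ b.val s.mem = L)
    (hstep : ∀ j < L, ∀ s, Inv j s → ∃ s', Run ω D p s K s' ∧ Bdd D s'.mem ∧ s'.mem (0, c) = j ∧
      Inv (j + 1) ⟨s'.mem.update (0, c) (j + 1), s'.tossed⟩)
    {s : State} (hs : Bdd D s.mem) (h0 : Inv 0 ⟨s.mem.update (0, c) 0, s.tossed⟩) :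
    ∃ s', Run ω D (.for c b p) s (L * (K + 2) + 2) s' ∧ Inv L s' := by
  have key := Run.loop_invariant (ω := ω) (D := D) (e := b - .scalar c)
    (p := .seq p (.assign 0 (.const c) (.scalar c + 1))) (by omega) Inv (L := L) (K := K + 1)
    (fun j hj s h => (hB j hj s h).1) ?_ ?_ h0
  · obtain ⟨s', hr, hs'⟩ := key
    refine ⟨s', ((Run.assign (by omega) hs 0 (.const c) 0).seq hr).mono ?_, hs'⟩
    exact le_of_eq (by ring)
  · intro j hj s hs
    obtain ⟨h1, h2, h3⟩ := hB j hj.le s hs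
    obtain ⟨s', hr, hb, hc', hi⟩ := hstep j hj s hs
    refine ⟨by simp [h2, h3]; omega, _, hr.seq (Run.assign (by omega) hb _ _ _), ?_⟩
    simpa [hc'] using hi
  · intro s hs
    obtain ⟨h1, h2, h3⟩ := hB L le_rfl s hs
    simp [h2, h3]

/-- `hx` and `hb` say that the base and the exponent do not read the two scalars being modified. -/
theorem Run.pow (hD : 16 ≤ D) {d : ℕ} (hd : d < 10) {x b : Expr} {X L : ℕ} (hX : 1 ≤ X)
    (hL : L < 2 ^ D) (hXL : X ^ L < 2 ^ D) {s : State} (hs : Bdd D s.mem)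
    (hx : ∀ M : Memory, (∀ p, p ≠ (0, d) → p ≠ (0, 10) → M p = s.mem p) → x.val M = X)
    (hb : ∀ M : Memory, (∀ p, p ≠ (0, d) → p ≠ (0, 10) → M p = s.mem p) → b.val M = L) :
    ∃ s', Run ω D (.pow d x b) s (L * 3 + 3) s' ∧ Bdd D s'.mem ∧ s'.mem (0, d) = X ^ L ∧
      s'.tossed = s.tossed ∧ ∀ p, p ≠ (0, d) → p ≠ (0, 10) → s'.mem p = s.mem p := by
  have hd10 : d ≠ 10 := by omega
  have hle : ∀ j ≤ L, X ^ j < 2 ^ D := fun j hj =>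
    (Nat.pow_le_pow_right hX hj).trans_lt hXL
  have h1 := Run.assign (ω := ω) (D := D) (by omega) hs 0 (.const d) 1
  have hb1 : Bdd D (s.mem.update (0, d) 1) :=
    hs.update (by omega) (by omega) (by simpa using hle 0 (Nat.zero_le _))
  have key := Run.for (ω := ω) hD (c := 10) (b := b)
    (p := .assign 0 (.const d) (.scalar d * x))
    (fun j a => Bdd D a.mem ∧ a.mem (0, d) = X ^ j ∧ a.mem (0, 10) = j ∧ a.tossed = s.tossed ∧
      ∀ p, p ≠ (0, d) → p ≠ (0, 10) → a.mem p = s.mem p) (L := L) (K := 1)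
    (fun j hj a ⟨h1, h2, h3, h4, h5⟩ => ⟨h1, h3, hb _ h5⟩) ?_
    (s := ⟨s.mem.update (0, d) 1, s.tossed⟩) hb1 ?_
  · obtain ⟨s', hr, h2, h3, h4, h5, h6⟩ := key
    exact ⟨s', (h1.seq hr).mono (by omega), h2, h3, h5, h6⟩
  · rintro j hj a ⟨h1, h2, h3, h4, h5⟩
    refine ⟨_, Run.assign (by omega) h1 _ _ _, ?_, ?_, ?_, ?_, ?_, h4, ?_⟩
    · simp only [Expr.val_const, Expr.val_mul, Expr.val_scalar, h2, hx _ h5, ← pow_succ]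
      exact h1.update (by omega) (by omega) (hle _ (by omega))
    · simp [hd10.symm, h3]
    · simp only [Expr.val_const, Expr.val_mul, Expr.val_scalar, h2, hx _ h5, ← pow_succ]
      exact (h1.update (by omega) (by omega) (hle _ (by omega))).update (by omega) (by omega)
        (by omega)
    · simp [hd10, h2, hx _ h5, pow_succ]
    · simp
    · intro p hp hp'
      simp [hp, hp', h5 p hp hp']
  · refine ⟨hb1.update (by omega) (by omega) (by omega), ?_, ?_, rfl, ?_⟩
    · simp [hd10]
    · simp
    · intro p hp hp'
      simp [hp, hp']

end Derived

/-! ### The parameters -/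

/-- The number of coins per weight. -/
def coinLength (n : ℕ) : ℕ := Nat.size (2 * n * n)

/-- The base of the numeral system. -/
def radix (n : ℕ) : ℕ := 2 ^ (2 * n * n + 1)

/-- A strict upper bound for the weight of an edge set. -/
def weightBound (n : ℕ) : ℕ := n * n * 2 ^ coinLength n + 1

/-- The formal variable that counts vertices. -/
def vertexVar (n : ℕ) : ℕ := radix n ^ weightBound n

/-- The formal variable that counts edges. -/
def edgeVar (n : ℕ) : ℕ := vertexVar n ^ (n + 2)

/-- The modulus of the computation. -/
def modulus (n : ℕ) : ℕ := edgeVar n ^ (n * n + 1)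

/-- The binary length of the modulus. -/
def modulusLength (n : ℕ) : ℕ := (2 * n * n + 1) * weightBound n * (n + 2) * (n * n + 1)

/-- The bound for the length of the numbers in the memory. -/
def cellBound (n : ℕ) : ℕ := modulusLength n + n * n + n + 20

theorem modulus_eq (n : ℕ) : modulus n = 2 ^ modulusLength n := by
  simp only [modulus, edgeVar, vertexVar, radix, modulusLength, ← pow_mul]

theorem modulus_lt (n : ℕ) : modulus n < 2 ^ cellBound n := by
  rw [modulus_eq]
  exact Nat.pow_lt_pow_right (by norm_num) (by rw [cellBound]; omega)

theorem one_lt_radix (n : ℕ) : 1 < radix n := Nat.one_lt_two_pow (by omega)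

theorem one_lt_vertexVar (n : ℕ) : 1 < vertexVar n :=
  Nat.one_lt_pow (by rw [weightBound]; omega) (one_lt_radix n)

theorem one_lt_edgeVar (n : ℕ) : 1 < edgeVar n := Nat.one_lt_pow (by omega) (one_lt_vertexVar n)

theorem edgeVar_le (n : ℕ) : edgeVar n ≤ modulus n :=
  Nat.le_self_pow (by omega) _

theorem vertexVar_le (n : ℕ) : vertexVar n ≤ modulus n :=
  (Nat.le_self_pow (by omega) _).trans (edgeVar_le n)

theorem radix_le (n : ℕ) : radix n ≤ modulus n :=
  (Nat.le_self_pow (by rw [weightBound]; omega) _).trans (vertexVar_le n)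

theorem one_lt_modulus (n : ℕ) : 1 < modulus n := (one_lt_radix n).trans_le (radix_le n)

theorem lt_two_pow_cellBound {n x : ℕ} (h : x ≤ cellBound n) : x < 2 ^ cellBound n :=
  h.trans_lt Nat.lt_two_pow_self

/-- Makes the loop bounds used later at most `cellBound n`, so that counters fit into cells and the
numbers of rounds are controlled. -/
theorem modulusLength_ge (n : ℕ) : weightBound n + 2 * n * n ≤ modulusLength n := by
  have h1 : 1 ≤ weightBound n := by rw [weightBound]; omega
  calc weightBound n + 2 * n * n ≤ weightBound n + 2 * n * n * weightBound n := by
        exact Nat.add_le_add_left (Nat.le_mul_of_pos_right _ h1) _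
    _ = (2 * n * n + 1) * weightBound n * 1 * 1 := by ring
    _ ≤ modulusLength n := by
      rw [modulusLength]
      gcongr <;> omega

theorem two_pow_coinLength_le {n : ℕ} : 2 ^ coinLength n ≤ 4 * n * n + 1 := by
  rcases h : coinLength n with _ | m
  · simp
  · have : m < Nat.size (2 * n * n) := by rw [← coinLength, h]; omega
    have := Nat.lt_size.1 this
    rw [pow_succ]
    have e : 4 * n * n = 2 * (2 * n * n) := by ring
    omega

theorem le_two_pow_coinLength (n : ℕ) : 2 * n * n < 2 ^ coinLength n := Nat.lt_size_self _

/-- The range of the scalars used as counters. -/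
theorem pow_le_vertexVar {n m : ℕ} (hn : n ≠ 0) (hm : m ≤ 2 ^ coinLength n) :
    radix n ^ m ≤ vertexVar n := by
  refine Nat.pow_le_pow_right (one_lt_radix n).le (hm.trans ?_)
  have : 1 ≤ n * n := Nat.mul_pos (by omega) (by omega)
  have : 1 * 2 ^ coinLength n ≤ n * n * 2 ^ coinLength n := Nat.mul_le_mul_right _ this
  rw [weightBound]
  omega

/-! ### Preparing the constants -/

/-- Compute the constants of the algorithm. -/
def Prog.constants : Prog :=
  -- Doubling until `2 * n * n` is exceeded yields `2 ^ coinLength n` in scalar `3`; scalar `4`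
  -- counts the doublings.
  .seq (.assign 0 3 1) <| .seq (.loop (2 * .scalar 0 * .scalar 0 + 1 - .scalar 3)
    (.seq (.assign 0 3 (.scalar 3 * 2)) (.assign 0 4 (.scalar 4 + 1)))) <|
  .seq (.pow 5 2 (2 * .scalar 0 * .scalar 0 + 1)) <|
  .seq (.pow 6 (.scalar 5) (.scalar 0 * .scalar 0 * .scalar 3 + 1)) <|
  .seq (.pow 7 (.scalar 6) (.scalar 0 + 2)) <|
  .seq (.pow 8 (.scalar 7) (.scalar 0 * .scalar 0 + 1)) <|
  .pow 9 2 (.scalar 1 + 1)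

/-- The scalars hold the constants of the algorithm. -/
structure Constants (n k ℓ : ℕ) (M : Memory) : Prop where
  bdd : Bdd (cellBound n) M
  n_eq : M (0, 0) = n
  k_eq : M (0, 1) = k
  l_eq : M (0, 2) = ℓ
  coins_eq : M (0, 3) = 2 ^ coinLength n
  length_eq : M (0, 4) = coinLength n
  radix_eq : M (0, 5) = radix n
  vertexVar_eq : M (0, 6) = vertexVar n
  edgeVar_eq : M (0, 7) = edgeVar n
  modulus_eq : M (0, 8) = modulus n
  power_eq : M (0, 9) = 2 ^ (k + 1)

theorem coinLength_le (n : ℕ) : coinLength n ≤ weightBound n := by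
  have h : coinLength n ≤ 2 * n * n := Nat.size_le.2 Nat.lt_two_pow_self
  have h2 : 1 ≤ 2 ^ coinLength n := Nat.one_le_two_pow
  have h3 := Nat.lt_two_pow_self (n := coinLength n)
  rcases Nat.eq_zero_or_pos n with rfl | hn
  · simp at h; omega
  · have : 1 ≤ n * n := Nat.mul_pos hn hn
    have : 1 * 2 ^ coinLength n ≤ n * n * 2 ^ coinLength n := Nat.mul_le_mul_right _ this
    rw [weightBound]
    omega

/-- The bound `k ≤ n`, provided by the truncation of the input, keeps `2 ^ (k + 1)` within a cell.
-/
theorem run_constants {ω : ℕ → Bool} {n k ℓ : ℕ} (hk : k ≤ n) {s : State}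
    (hs : Bdd (cellBound n) s.mem) (h0 : s.mem (0, 0) = n) (h1 : s.mem (0, 1) = k)
    (h2 : s.mem (0, 2) = ℓ) (h4 : s.mem (0, 4) = 0) :
    ∃ s', Run ω (cellBound n) .constants s (20 * cellBound n + 20) s' ∧
      Constants n k ℓ s'.mem ∧ s'.tossed = s.tossed ∧
      ∀ p : ℕ × ℕ, (p.1 = 0 → 11 ≤ p.2) → s'.mem p = s.mem p := by
  have hD : 16 ≤ cellBound n := by rw [cellBound]; omega
  have hDlen := modulusLength_ge n
  have hcl := coinLength_le n
  have hDdef : cellBound n = modulusLength n + n * n + n + 20 := rfl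
  have hcoins : 2 ^ coinLength n < 2 ^ cellBound n :=
    Nat.pow_lt_pow_right (by norm_num) (by omega)
  have hsmall : ∀ {x}, x ≤ cellBound n → x < 2 ^ cellBound n := lt_two_pow_cellBound
  have hr1 := Run.assign (ω := ω) (by omega) hs 0 3 1
  obtain ⟨s2, hr2, b2, e23, e24, t2, f2⟩ := Run.loop_invariant (ω := ω) (D := cellBound n)
    (e := 2 * .scalar 0 * .scalar 0 + 1 - .scalar 3)
    (p := .seq (.assign 0 3 (.scalar 3 * 2)) (.assign 0 4 (.scalar 4 + 1))) (by omega)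
    (fun j a => Bdd (cellBound n) a.mem ∧ a.mem (0, 3) = 2 ^ j ∧ a.mem (0, 4) = j ∧
      a.tossed = s.tossed ∧ ∀ p, p ≠ (0, 3) → p ≠ (0, 4) → a.mem p = s.mem p)
    (L := coinLength n) (K := 1 + 1) (fun j hj a h => h.1)
    (by
      rintro j hj a ⟨c1, c2, c3, c4, c5⟩
      have hlt : 2 ^ j ≤ 2 * n * n := Nat.lt_size.1 hj
      have hj2 : 2 ^ (j + 1) < 2 ^ cellBound n := Nat.pow_lt_pow_right (by norm_num) (by omega)
      have b1 : Bdd (cellBound n) (a.mem.update (0, 3) (2 ^ (j + 1))) :=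
        c1.update (by omega) (by omega) hj2
      refine ⟨?_, _, (Run.assign (by omega) c1 _ _ _).seq (Run.assign (by omega) ?_ _ _ _), ?_⟩
      · simp only [Expr.val_sub, Expr.val_add, Expr.val_mul, Expr.val_ofNat, Expr.val_scalar, c2,
          c5 (0, 0) (by simp) (by simp), h0]
        omega
      · simpa [c2, pow_succ] using b1
      · simp only [Expr.val_add, Expr.val_mul, Expr.val_ofNat, Expr.val_scalar, c2, ← pow_succ]
        refine ⟨?_, ?_, ?_, c4, ?_⟩
        · exact b1.update (by omega) (by omega) (by simp [c3]; exact hsmall (by omega))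
        · simp
        · simp [c3]
        · intro p hp hp'
          simp [hp, hp', c5 p hp hp'])
    (by
      rintro a ⟨c1, c2, c3, c4, c5⟩
      have := le_two_pow_coinLength n
      simp only [Expr.val_sub, Expr.val_add, Expr.val_mul, Expr.val_ofNat, Expr.val_scalar, c2,
          c5 (0, 0) (by simp) (by simp), h0]
      omega)
    (s := ⟨s.mem.update (0, 3) 1, s.tossed⟩)
    (by
      refine ⟨hs.update (by omega) (by omega) (hsmall (by omega)), by simp, by simp [h4], rfl, ?_⟩
      intro p hp hp'
      simp [hp])
  have hQ := modulus_lt n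
  have n2 : s2.mem (0, 0) = n := by rw [f2 _ (by simp) (by simp), h0]
  have k2 : s2.mem (0, 1) = k := by rw [f2 _ (by simp) (by simp), h1]
  have l2 : s2.mem (0, 2) = ℓ := by rw [f2 _ (by simp) (by simp), h2]
  obtain ⟨s3, hr3, b3, e35, t3, f3⟩ := Run.pow (ω := ω) hD (d := 5) (by norm_num)
    (x := 2) (b := 2 * .scalar 0 * .scalar 0 + 1) (X := 2) (L := 2 * n * n + 1) (by norm_num)
    (hsmall (by omega)) ((radix_le n).trans_lt hQ) b2 (fun M hM => rfl)
    (fun M hM => by simp [hM, n2])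
  obtain ⟨s4, hr4, b4, e46, t4, f4⟩ := Run.pow (ω := ω) hD (d := 6) (by norm_num)
    (x := .scalar 5) (b := .scalar 0 * .scalar 0 * .scalar 3 + 1) (X := radix n)
    (L := weightBound n) (one_lt_radix n).le
    (hsmall (by omega)) ((vertexVar_le n).trans_lt hQ) b3 (fun M hM => by simp [hM, e35, radix])
    (fun M hM => by simp [hM, f3, n2, e23, weightBound])
  obtain ⟨s5, hr5, b5, e57, t5, f5⟩ := Run.pow (ω := ω) hD (d := 7) (by norm_num)
    (x := .scalar 6) (b := .scalar 0 + 2) (X := vertexVar n)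
    (L := n + 2) (one_lt_vertexVar n).le
    (hsmall (by omega)) ((edgeVar_le n).trans_lt hQ) b4 (fun M hM => by simp [hM, e46, vertexVar])
    (fun M hM => by simp [hM, f3, f4, n2])
  obtain ⟨s6, hr6, b6, e68, t6, f6⟩ := Run.pow (ω := ω) hD (d := 8) (by norm_num)
    (x := .scalar 7) (b := .scalar 0 * .scalar 0 + 1) (X := edgeVar n)
    (L := n * n + 1) (one_lt_edgeVar n).le
    (hsmall (by omega)) hQ b5 (fun M hM => by simp [hM, e57, edgeVar])
    (fun M hM => by simp [hM, f3, f4, f5, n2])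
  obtain ⟨s7, hr7, b7, e79, t7, f7⟩ := Run.pow (ω := ω) hD (d := 9) (by norm_num)
    (x := 2) (b := .scalar 1 + 1) (X := 2)
    (L := k + 1) (by norm_num)
    (hsmall (by omega)) (Nat.pow_lt_pow_right (by norm_num) (by omega)) b6 (fun M hM => rfl)
    (fun M hM => by simp [hM, f3, f4, f5, f6, k2])
  refine ⟨s7, (hr1.seq (hr2.seq (hr3.seq (hr4.seq (hr5.seq (hr6.seq hr7)))))).mono ?_, ?_, ?_, ?_⟩
  · have : 2 * n * n = 2 * (n * n) := by ring
    omega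
  · constructor
    · exact b7
    · simp [f3, f4, f5, f6, f7, n2]
    · simp [f3, f4, f5, f6, f7, k2]
    · simp [f3, f4, f5, f6, f7, l2]
    · simp [f3, f4, f5, f6, f7, e23]
    · simp [f3, f4, f5, f6, f7, e24]
    · simp [f4, f5, f6, f7, e35, radix]
    · simp [f5, f6, f7, e46, vertexVar]
    · simp [f6, f7, e57, edgeVar]
    · simp [f7, e68, modulus]
    · exact e79
  · rw [t7, t6, t5, t4, t3, t2]
  · rintro ⟨a, i⟩ hp
    have hne : ∀ j < 11, ((a, i) : ℕ × ℕ) ≠ (0, j) := by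
      intro j hj h
      obtain ⟨rfl, rfl⟩ := Prod.mk.inj h
      have := hp rfl
      simp only at this
      omega
    rw [f7 _ (hne _ (by omega)) (hne _ (by omega)), f6 _ (hne _ (by omega)) (hne _ (by omega)),
      f5 _ (hne _ (by omega)) (hne _ (by omega)), f4 _ (hne _ (by omega)) (hne _ (by omega)),
      f3 _ (hne _ (by omega)) (hne _ (by omega)), f2 _ (hne _ (by omega)) (hne _ (by omega))]

/-! ### Tossing the coins -/

/-- For every index below `n ^ 2`, choose a random weight and store the corresponding power of the
radix in the array `3`. -/
def Prog.coins : Prog :=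
  .for 11 (.scalar 0 * .scalar 0) <|
    .seq (.assign 3 (.scalar 11) 1) <|
      .for 10 (.scalar 4) <|
        .seq (.toss 0 (.const 13)) <|
          .assign 3 (.scalar 11) (.cell 3 (.scalar 11) * .cell 3 (.scalar 11)
            * (1 + .scalar 13 * (.scalar 5 - 1)))

theorem Constants.congr {n k ℓ : ℕ} {M M' : Memory} (h : Constants n k ℓ M)
    (hb : Bdd (cellBound n) M') (hM : ∀ i < 10, M' (0, i) = M (0, i)) : Constants n k ℓ M' where
  bdd := hb
  n_eq := (hM 0 (by norm_num)).trans h.n_eq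
  k_eq := (hM 1 (by norm_num)).trans h.k_eq
  l_eq := (hM 2 (by norm_num)).trans h.l_eq
  coins_eq := (hM 3 (by norm_num)).trans h.coins_eq
  length_eq := (hM 4 (by norm_num)).trans h.length_eq
  radix_eq := (hM 5 (by norm_num)).trans h.radix_eq
  vertexVar_eq := (hM 6 (by norm_num)).trans h.vertexVar_eq
  edgeVar_eq := (hM 7 (by norm_num)).trans h.edgeVar_eq
  modulus_eq := (hM 8 (by norm_num)).trans h.modulus_eq
  power_eq := (hM 9 (by norm_num)).trans h.power_eq

/-- Squaring doubles the exponent and the last factor is `1` or the radix, so each coin appends a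
binary digit to the exponent. The power of the radix for a random weight thus arises from one update
per toss. -/
theorem sq_radix_pow {n x : ℕ} (b : Bool) :
    radix n ^ x * radix n ^ x * (1 + b.toNat * (radix n - 1)) = radix n ^ (2 * x + b.toNat) := by
  have h := one_lt_radix n
  have h2 : 1 + (radix n - 1) = radix n := by omega
  cases b
  · simp only [Bool.toNat_false]; ring
  · simp only [Bool.toNat_true, one_mul, h2]; ring

theorem run_coins {ω : ℕ → Bool} {n k ℓ : ℕ} {s : State} (hs : Constants n k ℓ s.mem)
    (ht : s.tossed = 0) :
    ∃ s', Run ω (cellBound n) .coins s (n * n * (coinLength n * 4 + 5) + 2) s' ∧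
      Constants n k ℓ s'.mem ∧
      (∀ i < n * n, s'.mem (3, i) = radix n ^ coinNumber ω (coinLength n) i (coinLength n)) ∧
      ∀ p : ℕ × ℕ, p.1 ≠ 3 → p ≠ (0, 10) → p ≠ (0, 11) → p ≠ (0, 13) → s'.mem p = s.mem p := by
  have hD : 16 ≤ cellBound n := by rw [cellBound]; omega
  have hDlen := modulusLength_ge n
  have hcl := coinLength_le n
  have hDdef : cellBound n = modulusLength n + n * n + n + 20 := rfl
  have hsmall : ∀ {x}, x ≤ cellBound n → x < 2 ^ cellBound n := lt_two_pow_cellBound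
  have hQ := modulus_lt n
  have key := Run.for (ω := ω) hD (c := 11) (b := .scalar 0 * .scalar 0)
    (p := .seq (.assign 3 (.scalar 11) 1) <|
      .for 10 (.scalar 4) <|
        .seq (.toss 0 (.const 13)) <|
          .assign 3 (.scalar 11) (.cell 3 (.scalar 11) * .cell 3 (.scalar 11)
            * (1 + .scalar 13 * (.scalar 5 - 1))))
    -- The number of coins tossed ties index `j` to its own block of the sequence `ω`.
    (fun j a => Bdd (cellBound n) a.mem ∧ a.mem (0, 11) = j ∧ a.tossed = j * coinLength n ∧
      (∀ i < j, a.mem (3, i) = radix n ^ coinNumber ω (coinLength n) i (coinLength n)) ∧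
      ∀ p : ℕ × ℕ, p.1 ≠ 3 → p ≠ (0, 10) → p ≠ (0, 11) → p ≠ (0, 13) → a.mem p = s.mem p)
    (L := n * n) (K := coinLength n * 4 + 3)
    (fun j hj a ⟨h1, h2, h3, h4, h5⟩ => ⟨h1, h2, by
      simp [h5 (0, 0), hs.n_eq]⟩) ?_ (s := s) hs.bdd ?_
  · obtain ⟨s', hr, h1, h2, h3, h4, h5⟩ := key
    refine ⟨s', hr.mono (le_of_eq (by ring)), hs.congr h1 fun i hi => h5 _ (by simp) ?_ ?_ ?_, h4,
      h5⟩ <;> simp <;> omega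
  · rintro j hj a ⟨a1, a2, a3, a4, a5⟩
    have hn : n ≠ 0 := by rintro rfl; simp at hj
    have hbound : ∀ x, x ≤ 2 ^ coinLength n → radix n ^ x < 2 ^ cellBound n := fun x hx =>
      ((pow_le_vertexVar hn hx).trans (vertexVar_le n)).trans_lt hQ
    have hr1 := Run.assign (ω := ω) (by omega) a1 3 (.scalar 11) 1
    have b1 : Bdd (cellBound n) (a.mem.update (3, j) 1) :=
      a1.update (by omega) (by omega) (hsmall (by omega))
    simp only [Expr.val_scalar, a2, Expr.val_ofNat] at hr1
    have key := Run.for (ω := ω) hD (c := 10) (b := .scalar 4)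
      (p := .seq (.toss 0 (.const 13)) <|
          .assign 3 (.scalar 11) (.cell 3 (.scalar 11) * .cell 3 (.scalar 11)
            * (1 + .scalar 13 * (.scalar 5 - 1))))
      (fun m c => Bdd (cellBound n) c.mem ∧ c.mem (0, 10) = m ∧ c.mem (0, 11) = j ∧
        c.tossed = j * coinLength n + m ∧
        c.mem (3, j) = radix n ^ coinNumber ω (coinLength n) j m ∧
        ∀ p : ℕ × ℕ, p ≠ (3, j) → p ≠ (0, 10) → p ≠ (0, 11) → p ≠ (0, 13) → c.mem p = a.mem p)
      (L := coinLength n) (K := 1 + 1)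
      (fun m hm c ⟨h1, h2, h3, h4, h5, h6⟩ => ⟨h1, h2, by
        simp [h6 (0, 4), a5 (0, 4), hs.length_eq]⟩) ?_
      (s := ⟨a.mem.update (3, j) 1, a.tossed⟩) b1 ?_
    · obtain ⟨s', hr, c1, c2, c3, c4, c5, c6⟩ := key
      refine ⟨s', (hr1.seq hr).mono (le_of_eq (by ring)), c1, c3,
        c1.update (by omega) (by omega) (hsmall (by omega)), by simp, ?_, ?_, ?_⟩
      · simp only [c4]; ring
      · intro i hi
        rcases Nat.lt_succ_iff_lt_or_eq.1 hi with hi | rfl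
        · have := c6 (3, i) (by simp; omega) (by simp) (by simp) (by simp)
          simpa [this] using a4 i hi
        · simpa using c5
      · intro p h3 h10 h11 h13
        have h3j : p ≠ (3, j) := fun h => h3 (by rw [h])
        simp [h11, c6 p h3j h10 h11 h13, a5 p h3 h10 h11 h13]
    · rintro m hm c ⟨c1, c2, c3, c4, c5, c6⟩
      have e5 : c.mem (0, 5) = radix n := by
        rw [c6 _ (by simp) (by simp) (by simp) (by simp),
          a5 _ (by simp) (by simp) (by simp) (by simp), hs.radix_eq]
      have htoss : (ω c.tossed).toNat ≤ 1 := Bool.toNat_le _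
      have hr1 := Run.toss (ω := ω) (by omega) c1 0 (.const 13)
      have d1 : Bdd (cellBound n) (c.mem.update (0, 13) (ω c.tossed).toNat) :=
        c1.update (by omega) (by omega) (hsmall (by omega))
      have hr2 := Run.assign (ω := ω) (D := cellBound n)
        (s := ⟨c.mem.update (0, 13) (ω c.tossed).toNat, c.tossed + 1⟩) (by omega) d1 3 (.scalar 11)
        (.cell 3 (.scalar 11) * .cell 3 (.scalar 11) * (1 + .scalar 13 * (.scalar 5 - 1)))
      have hval : coinNumber ω (coinLength n) j (m + 1)
          = 2 * coinNumber ω (coinLength n) j m + (ω c.tossed).toNat := by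
        rw [coinNumber, c4]
      have hle : coinNumber ω (coinLength n) j (m + 1) ≤ 2 ^ coinLength n :=
        (coinNumber_lt _ _ _ _).le.trans (Nat.pow_le_pow_right (by norm_num) (by omega))
      simp [c3, c5, e5, sq_radix_pow, ← hval] at hr2
      have d2 := d1.update (a := 3) (i := j) (by omega) (by omega) (hbound _ hle)
      refine ⟨_, hr1.seq hr2, d2, by simp [c2], ?_, by simp, by simp [c3], by simp [c4]; omega,
        by simp, ?_⟩
      · exact d2.update (by omega) (by omega) (hsmall (by omega))
      · intro p h3 h10 h11 h13
        simp [h3, h10, h13, c6 p h3 h10 h11 h13]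
    · refine ⟨b1.update (by omega) (by omega) (hsmall (by omega)), by simp, by simp [a2],
        by simp [a3], by simp [coinNumber], ?_⟩
      intro p h3 h10 h11 h13
      simp [h3, h10]
  · refine ⟨hs.bdd.update (by omega) (by omega) (hsmall (by omega)), by simp, by simp [ht],
      by simp, ?_⟩
    intro p h3 h10 h11 h13
    simp [h11]

/-! ### Local factors -/

/-- The weight of a node in state `q`. -/
def nodeWeight (n q : ℕ) : ℕ :=
  (1 - q / 2) * (1 - q % 2)
    + vertexVar n * (1 + (modulus n - 2) * (q / 2)) * (1 + (modulus n - 2) * (q % 2))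

/-- The factor of the nodes `v` and `a + 1` for the adjacency matrix `A` and the weights `W`. -/
def pairFactor (n : ℕ) (A W : ℕ → ℕ) (σ : ℕ → ℕ) (v a : ℕ) : ℕ :=
  1 + A ((v - 1) * n + a) * (σ v / 2 * (σ (a + 1) / 2) + σ v % 2 * (σ (a + 1) % 2)) * edgeVar n
    * (W ((v - 1) * n + a) * W (a * n + (v - 1)))

/-- The product of the weight of `v` and of the factors of `v` and the first `m` nodes. -/
def localProduct (n : ℕ) (A W : ℕ → ℕ) (σ : ℕ → ℕ) (v : ℕ) : ℕ → ℕ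
  | 0 => nodeWeight n (σ v) % modulus n
  | m + 1 => localProduct n A W σ v m * pairFactor n A W σ v m % modulus n

theorem localProduct_lt (n : ℕ) (A W : ℕ → ℕ) (σ : ℕ → ℕ) (v m : ℕ) :
    localProduct n A W σ v m < modulus n := by
  have := one_lt_modulus n
  cases m <;> exact Nat.mod_lt _ (by omega)

/-- The current node. -/
def Expr.node : Expr := .scalar 12

/-- Compute the local factor of the current node. -/
def Prog.localProduct : Prog :=
  .seq (.assign 5 .node (((1 - .cell 4 .node / 2) * (1 - (Expr.cell 4 .node).mod 2)
    + .scalar 6 * (1 + (.scalar 8 - 2) * (.cell 4 .node / 2))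
      * (1 + (.scalar 8 - 2) * (Expr.cell 4 .node).mod 2)).mod (.scalar 8))) <|
  .for 10 (.scalar 0) <|
    .assign 5 .node ((.cell 5 .node * (1 + .cell 1 ((.node - 1) * .scalar 0 + .scalar 10)
      * (.cell 4 .node / 2 * (.cell 4 (.scalar 10 + 1) / 2)
        + (Expr.cell 4 .node).mod 2 * (Expr.cell 4 (.scalar 10 + 1)).mod 2) * .scalar 7
      * (.cell 3 ((.node - 1) * .scalar 0 + .scalar 10)
        * .cell 3 (.scalar 10 * .scalar 0 + (.node - 1))))).mod (.scalar 8))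

/-! ### The search as a program -/

/-- The cells used by the search. -/
def SearchCell (p : ℕ × ℕ) : Prop := 4 ≤ p.1 ∨ p = (0, 10) ∨ p = (0, 12) ∨ p = (0, 14)

/-- The memory `M` represents the state `y` of the search and otherwise agrees with `M₀`. -/
structure Represents (n : ℕ) (M₀ M : Memory) (y : Search) : Prop where
  bdd : Bdd (cellBound n) M
  frame : ∀ p, ¬ SearchCell p → M p = M₀ p
  cur : M (0, 12) = y.cur
  st : ∀ i, M (4, i) = y.st i
  pr : ∀ i, M (5, i) = y.pr i
  sm : ∀ i, M (6, i) = y.sm i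
  ch : ∀ i, M (7, i) = y.ch i

namespace Represents

variable {n : ℕ} {M₀ M : Memory} {y : Search} (h : Represents n M₀ M y)
include h

theorem update_st {i x : ℕ} (hi : i < cellBound n) (hx : x < 2 ^ cellBound n) :
    Represents n M₀ (M.update (4, i) x) { y with st := Function.update y.st i x } where
  bdd := h.bdd.update (by norm_num) hi hx
  frame p hp := by
    have : p ≠ (4, i) := by rintro rfl; exact hp (Or.inl le_rfl)
    simp [this, h.frame p hp]
  cur := by simp [h.cur]
  st j := by by_cases hj : j = i <;> simp [hj, h.st]
  pr j := by simp [h.pr]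
  sm j := by simp [h.sm]
  ch j := by simp [h.ch]

theorem update_pr {i x : ℕ} (hi : i < cellBound n) (hx : x < 2 ^ cellBound n) :
    Represents n M₀ (M.update (5, i) x) { y with pr := Function.update y.pr i x } where
  bdd := h.bdd.update (by norm_num) hi hx
  frame p hp := by
    have : p ≠ (5, i) := by rintro rfl; exact hp (Or.inl (by norm_num))
    simp [this, h.frame p hp]
  cur := by simp [h.cur]
  st j := by simp [h.st]
  pr j := by by_cases hj : j = i <;> simp [hj, h.pr]
  sm j := by simp [h.sm]
  ch j := by simp [h.ch]

theorem update_sm {i x : ℕ} (hi : i < cellBound n) (hx : x < 2 ^ cellBound n) :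
    Represents n M₀ (M.update (6, i) x) { y with sm := Function.update y.sm i x } where
  bdd := h.bdd.update (by norm_num) hi hx
  frame p hp := by
    have : p ≠ (6, i) := by rintro rfl; exact hp (Or.inl (by norm_num))
    simp [this, h.frame p hp]
  cur := by simp [h.cur]
  st j := by simp [h.st]
  pr j := by simp [h.pr]
  sm j := by by_cases hj : j = i <;> simp [hj, h.sm]
  ch j := by simp [h.ch]

theorem update_ch {i x : ℕ} (hi : i < cellBound n) (hx : x < 2 ^ cellBound n) :
    Represents n M₀ (M.update (7, i) x) { y with ch := Function.update y.ch i x } where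
  bdd := h.bdd.update (by norm_num) hi hx
  frame p hp := by
    have : p ≠ (7, i) := by rintro rfl; exact hp (Or.inl (by norm_num))
    simp [this, h.frame p hp]
  cur := by simp [h.cur]
  st j := by simp [h.st]
  pr j := by simp [h.pr]
  sm j := by simp [h.sm]
  ch j := by by_cases hj : j = i <;> simp [hj, h.ch]

theorem update_cur {x : ℕ} (hx : x < 2 ^ cellBound n) :
    Represents n M₀ (M.update (0, 12) x) { y with cur := x } where
  bdd := h.bdd.update (by norm_num) (by rw [cellBound]; omega) hx
  frame p hp := by
    have : p ≠ (0, 12) := by rintro rfl; exact hp (by simp [SearchCell])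
    simp [this, h.frame p hp]
  cur := by simp
  st j := by simp [h.st]
  pr j := by simp [h.pr]
  sm j := by simp [h.sm]
  ch j := by simp [h.ch]

theorem update_counter {c x : ℕ} (hc : c = 10 ∨ c = 14) (hx : x < 2 ^ cellBound n) :
    Represents n M₀ (M.update (0, c) x) y where
  bdd := h.bdd.update (by norm_num) (by rw [cellBound]; omega) hx
  frame p hp := by
    have : p ≠ (0, c) := by rintro rfl; exact hp (by rcases hc with rfl | rfl <;> simp [SearchCell])
    simp [this, h.frame p hp]
  cur := by rcases hc with rfl | rfl <;> simp [h.cur]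
  st j := by simp [h.st]
  pr j := by simp [h.pr]
  sm j := by simp [h.sm]
  ch j := by simp [h.ch]

end Represents

section Body

variable {ω : ℕ → Bool} {n k ℓ : ℕ} {M₀ : Memory} (hM : Constants n k ℓ M₀)
include hM

theorem run_localProduct {s : State} {y : Search} (hs : Represents n M₀ s.mem y)
    (hy : y.cur ≤ n) :
    ∃ s', Run ω (cellBound n) .localProduct s (n * 3 + 3) s' ∧
      Represents n M₀ s'.mem { y with
        pr := Function.update y.pr y.cur (localProduct n (fun i => M₀ (1, i)) (fun i => M₀ (3, i)) y.st y.cur n) } ∧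
      s'.tossed = s.tossed := by
  set A : ℕ → ℕ := fun i => M₀ (1, i) with hA
  set W : ℕ → ℕ := fun i => M₀ (3, i) with hW
  have hD : 16 ≤ cellBound n := by rw [cellBound]; omega
  have hcur : y.cur < cellBound n := by rw [cellBound]; omega
  have hsmall : ∀ {x}, x ≤ cellBound n → x < 2 ^ cellBound n := lt_two_pow_cellBound
  have hnD : n ≤ cellBound n := by rw [cellBound]; omega
  have hloc : ∀ m, localProduct n A W y.st y.cur m < 2 ^ cellBound n := fun m =>
    (localProduct_lt _ _ _ _ _ _).trans (modulus_lt n)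
  have hfr : ∀ {M : Memory} {z : Search}, Represents n M₀ M z → M (0, 0) = n ∧
      M (0, 6) = vertexVar n ∧ M (0, 7) = edgeVar n ∧ M (0, 8) = modulus n ∧
      (∀ i, M (1, i) = A i) ∧ ∀ i, M (3, i) = W i := fun h =>
    ⟨(h.frame _ (by simp [SearchCell])).trans hM.n_eq,
      (h.frame _ (by simp [SearchCell])).trans hM.vertexVar_eq,
      (h.frame _ (by simp [SearchCell])).trans hM.edgeVar_eq,
      (h.frame _ (by simp [SearchCell])).trans hM.modulus_eq,
      fun i => h.frame _ (by simp [SearchCell]), fun i => h.frame _ (by simp [SearchCell])⟩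
  obtain ⟨-, e6, -, e8, -, -⟩ := hfr hs
  have hr1 := Run.assign (ω := ω) (D := cellBound n) (by omega) hs.bdd 5 .node
    (((1 - .cell 4 .node / 2) * (1 - (Expr.cell 4 .node).mod 2)
    + .scalar 6 * (1 + (.scalar 8 - 2) * (.cell 4 .node / 2))
      * (1 + (.scalar 8 - 2) * (Expr.cell 4 .node).mod 2)).mod (.scalar 8))
  simp only [Expr.node, Expr.val_mod, Expr.val_add, Expr.val_sub, Expr.val_mul, Expr.val_div,
    Expr.val_ofNat, Expr.val_scalar, Expr.val_cell, hs.cur, hs.st, e6, e8] at hr1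
  have b1 := hs.update_pr hcur (hloc 0)
  have key := Run.for (ω := ω) hD (c := 10) (b := .scalar 0)
    (p := .assign 5 .node ((.cell 5 .node * (1 + .cell 1 ((.node - 1) * .scalar 0 + .scalar 10)
      * (.cell 4 .node / 2 * (.cell 4 (.scalar 10 + 1) / 2)
        + (Expr.cell 4 .node).mod 2 * (Expr.cell 4 (.scalar 10 + 1)).mod 2) * .scalar 7
      * (.cell 3 ((.node - 1) * .scalar 0 + .scalar 10)
        * .cell 3 (.scalar 10 * .scalar 0 + (.node - 1))))).mod (.scalar 8)))
    (fun j a => Represents n M₀ a.mem { y with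
        pr := Function.update y.pr y.cur (localProduct n A W y.st y.cur j) } ∧ a.mem (0, 10) = j ∧ a.tossed = s.tossed)
    (L := n) (K := 1)
    (fun j hj a h => ⟨h.1.bdd, h.2.1, (hfr h.1).1⟩) ?_
    (s := ⟨s.mem.update (5, y.cur) (localProduct n A W y.st y.cur 0), s.tossed⟩) b1.bdd ?_
  · obtain ⟨s', hr, h1, -, h3⟩ := key
    exact ⟨s', (hr1.seq hr).mono (by omega), h1, h3⟩
  · rintro j hj a ⟨a1, a2, a3⟩
    obtain ⟨f0, f6, f7, f8, f1, f3⟩ := hfr a1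
    have hr := Run.assign (ω := ω) (D := cellBound n) (by omega) a1.bdd 5 .node
      ((.cell 5 .node * (1 + .cell 1 ((.node - 1) * .scalar 0 + .scalar 10)
      * (.cell 4 .node / 2 * (.cell 4 (.scalar 10 + 1) / 2)
        + (Expr.cell 4 .node).mod 2 * (Expr.cell 4 (.scalar 10 + 1)).mod 2) * .scalar 7
      * (.cell 3 ((.node - 1) * .scalar 0 + .scalar 10)
        * .cell 3 (.scalar 10 * .scalar 0 + (.node - 1))))).mod (.scalar 8))
    have hval : ∀ x, x = localProduct n A W y.st y.cur j →
        x * pairFactor n A W y.st y.cur j % modulus n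
          = localProduct n A W y.st y.cur (j + 1) := by rintro x rfl; rfl
    simp only [Expr.node, Expr.val_mod, Expr.val_add, Expr.val_sub, Expr.val_mul, Expr.val_div,
      Expr.val_ofNat, Expr.val_scalar, Expr.val_cell, a1.cur, a1.st, a1.pr, f0, f7, f8, f1, f3, a2,
      Function.update_self] at hr
    have hr' : Run ω (cellBound n) _ a 1
        ⟨a.mem.update (5, y.cur) (localProduct n A W y.st y.cur (j + 1)), a.tossed⟩ := hr
    have b2 := a1.update_pr hcur (hloc (j + 1))
    simp only [Function.update_idem] at b2
    exact ⟨_, hr', b2.bdd, by simp [a2], b2.update_counter (Or.inl rfl) (hsmall (by omega)),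
      by simp, a3⟩
  · exact ⟨b1.update_counter (Or.inl rfl) (hsmall (by omega)), by simp, rfl⟩

end Body

/-- One step of the search. -/
def Prog.searchStep : Prog :=
  .branch (.scalar 0 - .cell 7 .node)
    (.seq (.assign 0 (.const 14) (.cell 7 .node)) <|
      .seq (.assign 7 .node (.scalar 14 + 1)) <|
        -- With truncated subtraction, `1 - ((x - y) + (y - x))` is nonzero exactly if `x = y`.
        .branch (1 - ((.cell 2 (.scalar 14) - .node) + (.node - .cell 2 (.scalar 14))))
          (.seq (.assign 0 (.const 12) (.scalar 14 + 1)) <|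
            .seq (.assign 6 .node 0) <| .seq (.assign 7 .node 0) .localProduct)
          .nop)
    -- The sum is updated in all three remaining cases, so this precedes the branching.
    (.seq (.assign 6 .node (.mod (.cell 6 .node + .cell 5 .node) (.scalar 8))) <|
      .branch (3 - .cell 4 .node)
        (.seq (.assign 4 .node (.cell 4 .node + 1)) <| .seq (.assign 7 .node 0) .localProduct)
        (.branch .node
          (.seq (.assign 5 (.cell 2 (.node - 1))
              (.mod (.cell 5 (.cell 2 (.node - 1)) * .cell 6 .node) (.scalar 8))) <|
            .seq (.assign 4 .node 0) <| .assign 0 (.const 12) (.cell 2 (.node - 1)))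
          (.assign 4 0 4)))

section Body

variable {ω : ℕ → Bool} {n k ℓ : ℕ} {M₀ : Memory} (hM : Constants n k ℓ M₀)
include hM

/-- `Search.step` updates everything at once, the program cell by cell. The order is such that every
read sees the intended value: the candidate is saved in scalar `14` before its cell is advanced, and
the current node changes only after its parent cell has been read. -/
theorem run_searchStep (hpar : ∀ c < n, M₀ (2, c) ≤ n) {s : State} {y : Search}
    (hs : Represents n M₀ s.mem y) (hy : y.cur ≤ n) (hst : y.st y.cur ≤ 3) :
    ∃ s', Run ω (cellBound n) .searchStep s (n * 3 + 10) s' ∧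
      Represents n M₀ s'.mem (Search.step n (fun c => M₀ (2, c)) (modulus n)
        (fun σ v => localProduct n (fun i => M₀ (1, i)) (fun i => M₀ (3, i)) σ v n) y) ∧
      s'.tossed = s.tossed := by
  have hD : 16 ≤ cellBound n := by rw [cellBound]; omega
  have hD1 : 1 ≤ cellBound n := by omega
  have hnD : n + 1 < cellBound n := by rw [cellBound]; omega
  have hsmall : ∀ {x}, x ≤ cellBound n → x < 2 ^ cellBound n := lt_two_pow_cellBound
  have hmod : ∀ x, x % modulus n < 2 ^ cellBound n := fun x =>
    (Nat.mod_lt _ (by have := one_lt_modulus n; omega)).trans (modulus_lt n)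
  have hfr : ∀ {M : Memory} {z : Search}, Represents n M₀ M z → M (0, 0) = n ∧
      M (0, 8) = modulus n ∧ (∀ i, M (2, i) = M₀ (2, i)) := fun h =>
    ⟨(h.frame _ (by simp [SearchCell])).trans hM.n_eq,
      (h.frame _ (by simp [SearchCell])).trans hM.modulus_eq,
      fun i => h.frame _ (by simp [SearchCell])⟩
  obtain ⟨f0, f8, f2⟩ := hfr hs
  by_cases hch : y.ch y.cur < n
  · -- examine the next candidate
    have hr1 := Run.assign (ω := ω) hD1 hs.bdd 0 (.const 14) (.cell 7 .node)
    simp only [Expr.node, Expr.val_const, Expr.val_cell, Expr.val_scalar, hs.cur, hs.ch] at hr1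
    have b1 := hs.update_counter (c := 14) (x := y.ch y.cur) (Or.inr rfl) (hsmall (by omega))
    have hr2 := Run.assign (ω := ω) (D := cellBound n)
      (s := ⟨s.mem.update (0, 14) (y.ch y.cur), s.tossed⟩) hD1 b1.bdd 7 .node (.scalar 14 + 1)
    have e14 : s.mem.update (0, 14) (y.ch y.cur) (0, 14) = y.ch y.cur := by simp
    simp only [Expr.node, Expr.val_add, Expr.val_ofNat, Expr.val_scalar, b1.cur, e14] at hr2
    have b2 := b1.update_ch (i := y.cur) (x := y.ch y.cur + 1) (by omega) (hsmall (by omega))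
    set M2 := (s.mem.update (0, 14) (y.ch y.cur)).update (7, y.cur) (y.ch y.cur + 1) with hM2
    have e14' : M2 (0, 14) = y.ch y.cur := by simp [hM2]
    obtain ⟨-, -, g2⟩ := hfr b2
    by_cases hp : M₀ (2, y.ch y.cur) = y.cur
    · have hr3 := Run.assign (ω := ω) (D := cellBound n) (s := ⟨M2, s.tossed⟩) hD1 b2.bdd 0
        (.const 12) (.scalar 14 + 1)
      simp only [Expr.val_const, Expr.val_add, Expr.val_ofNat, Expr.val_scalar, e14'] at hr3
      have b3 := b2.update_cur (x := y.ch y.cur + 1) (hsmall (by omega))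
      have hr4 := Run.assign (ω := ω) (D := cellBound n)
        (s := ⟨M2.update (0, 12) (y.ch y.cur + 1), s.tossed⟩) hD1 b3.bdd 6 .node 0
      simp only [Expr.node, Expr.val_ofNat, Expr.val_scalar, b3.cur] at hr4
      have b4 := b3.update_sm (i := y.ch y.cur + 1) (x := 0) (by omega) (hsmall (by omega))
      have hr5 := Run.assign (ω := ω) (D := cellBound n)
        (s := ⟨(M2.update (0, 12) (y.ch y.cur + 1)).update (6, y.ch y.cur + 1) 0, s.tossed⟩) hD1
        b4.bdd 7 .node 0
      simp only [Expr.node, Expr.val_ofNat, Expr.val_scalar, b4.cur] at hr5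
      have b5 := b4.update_ch (i := y.ch y.cur + 1) (x := 0) (by omega) (hsmall (by omega))
      obtain ⟨s6, hr6, b6, t6⟩ := run_localProduct (ω := ω) hM (s := ⟨_, s.tossed⟩) b5
        (show y.ch y.cur + 1 ≤ n by omega)
      refine ⟨s6, ((hr1.seq (hr2.seq (Run.branch_true (q := .nop) hD1 b2.bdd ?_
        (hr3.seq (hr4.seq (hr5.seq hr6)))))).branch_true hD1 hs.bdd ?_).mono (by omega), ?_, t6⟩
      · simp only [Expr.node, Expr.val_add, Expr.val_sub, Expr.val_ofNat, Expr.val_scalar,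
          Expr.val_cell, e14', b2.cur, g2, hp]
        omega
      · simp only [Expr.node, Expr.val_sub, Expr.val_scalar, Expr.val_cell, f0, hs.cur, hs.ch]
        omega
      · simp only [Search.step, hch, hp, if_true]
        exact b6
    · refine ⟨⟨M2, s.tossed⟩, ((hr1.seq (hr2.seq (Run.branch_false hD1 b2.bdd ?_
        (Run.nop hD1 b2.bdd)))).branch_true hD1 hs.bdd ?_).mono (by omega), ?_, rfl⟩
      · simp only [Expr.node, Expr.val_add, Expr.val_sub, Expr.val_ofNat, Expr.val_scalar,
          Expr.val_cell, e14', b2.cur, g2]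
        omega
      · simp only [Expr.node, Expr.val_sub, Expr.val_scalar, Expr.val_cell, f0, hs.cur, hs.ch]
        omega
      · simp only [Search.step, hch, hp, if_true, if_false]
        exact b2
  · -- all children have been treated
    have hr1 := Run.assign (ω := ω) hD1 hs.bdd 6 .node
      (.mod (.cell 6 .node + .cell 5 .node) (.scalar 8))
    simp only [Expr.node, Expr.val_mod, Expr.val_add, Expr.val_cell, Expr.val_scalar, hs.cur,
      hs.sm, hs.pr, f8] at hr1
    have b1 := hs.update_sm (i := y.cur) (by omega) (hmod (y.sm y.cur + y.pr y.cur))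
    set M1 := s.mem.update (6, y.cur) ((y.sm y.cur + y.pr y.cur) % modulus n) with hM1
    obtain ⟨-, g8, g2⟩ := hfr b1
    have hcond : (Expr.scalar 0 - .cell 7 .node).val s.mem = 0 := by
      simp only [Expr.node, Expr.val_sub, Expr.val_scalar, Expr.val_cell, f0, hs.cur, hs.ch]
      omega
    by_cases hq : y.st y.cur < 3
    · have hr2 := Run.assign (ω := ω) (D := cellBound n) (s := ⟨M1, s.tossed⟩) hD1 b1.bdd 4
        .node (.cell 4 .node + 1)
      simp only [Expr.node, Expr.val_add, Expr.val_ofNat, Expr.val_cell, Expr.val_scalar, b1.cur,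
        b1.st] at hr2
      have b2 := b1.update_st (i := y.cur) (x := y.st y.cur + 1) (by omega) (hsmall (by omega))
      have hr3 := Run.assign (ω := ω) (D := cellBound n)
        (s := ⟨M1.update (4, y.cur) (y.st y.cur + 1), s.tossed⟩) hD1 b2.bdd 7 .node 0
      simp only [Expr.node, Expr.val_ofNat, Expr.val_scalar, b2.cur] at hr3
      have b3 := b2.update_ch (i := y.cur) (x := 0) (by omega) (hsmall (by omega))
      obtain ⟨s4, hr4, b4, t4⟩ := run_localProduct (ω := ω) hM (s := ⟨_, s.tossed⟩) b3 hy
      refine ⟨s4, ((hr1.seq (Run.branch_true hD1 b1.bdd ?_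
        (hr2.seq (hr3.seq hr4)))).branch_false hD1 hs.bdd hcond).mono (by omega), ?_, t4⟩
      · simp only [Expr.node, Expr.val_sub, Expr.val_ofNat, Expr.val_scalar, Expr.val_cell, b1.cur,
          b1.st]
        omega
      · simp only [Search.step, hch, hq, if_true, if_false]
        exact b4
    · have hcond2 : (3 - Expr.cell 4 .node).val M1 = 0 := by
        simp only [Expr.node, Expr.val_sub, Expr.val_ofNat, Expr.val_scalar, Expr.val_cell, b1.cur,
          b1.st]
        omega
      by_cases h0 : y.cur = 0
      · have hr2 := Run.assign (ω := ω) (D := cellBound n) (s := ⟨M1, s.tossed⟩) hD1 b1.bdd 4 0 4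
        simp only [Expr.val_ofNat] at hr2
        have b2 := b1.update_st (i := 0) (x := 4) (by omega) (hsmall (by omega))
        refine ⟨_, ((hr1.seq (Run.branch_false hD1 b1.bdd hcond2
          (Run.branch_false hD1 b1.bdd ?_ hr2))).branch_false hD1 hs.bdd hcond).mono (by omega),
          ?_, rfl⟩
        · simp only [Expr.node, Expr.val_scalar, b1.cur, h0]
        · rw [Search.step, if_neg hch, if_neg hq, if_pos h0]
          simp only [h0] at b2 ⊢
          exact b2
      · have hpn : M₀ (2, y.cur - 1) ≤ n := hpar _ (by omega)
        have hr2 := Run.assign (ω := ω) (D := cellBound n) (s := ⟨M1, s.tossed⟩) hD1 b1.bdd 5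
          (.cell 2 (.node - 1)) (.mod (.cell 5 (.cell 2 (.node - 1)) * .cell 6 .node) (.scalar 8))
        simp only [Expr.node, Expr.val_mod, Expr.val_mul, Expr.val_sub, Expr.val_ofNat,
          Expr.val_cell, Expr.val_scalar, b1.cur, b1.pr, b1.sm, g8, g2,
          Function.update_self] at hr2
        have b2 := b1.update_pr (i := M₀ (2, y.cur - 1)) (by omega)
          (hmod (y.pr (M₀ (2, y.cur - 1)) * ((y.sm y.cur + y.pr y.cur) % modulus n)))
        set M2 := M1.update (5, M₀ (2, y.cur - 1))
          (y.pr (M₀ (2, y.cur - 1)) * ((y.sm y.cur + y.pr y.cur) % modulus n) % modulus n) with hM2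
        have hr3 := Run.assign (ω := ω) (D := cellBound n) (s := ⟨M2, s.tossed⟩) hD1 b2.bdd 4
          .node 0
        simp only [Expr.node, Expr.val_ofNat, Expr.val_scalar, b2.cur] at hr3
        have b3 := b2.update_st (i := y.cur) (x := 0) (by omega) (hsmall (by omega))
        obtain ⟨-, -, k2⟩ := hfr b3
        have hr4 := Run.assign (ω := ω) (D := cellBound n)
          (s := ⟨M2.update (4, y.cur) 0, s.tossed⟩) hD1 b3.bdd 0
          (.const 12) (.cell 2 (.node - 1))
        simp only [Expr.node, Expr.val_const, Expr.val_sub, Expr.val_ofNat, Expr.val_cell,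
          Expr.val_scalar, b3.cur, k2] at hr4
        have b4 := b3.update_cur (x := M₀ (2, y.cur - 1)) (hsmall (by omega))
        refine ⟨_, ((hr1.seq (Run.branch_false hD1 b1.bdd hcond2
          (Run.branch_true hD1 b1.bdd ?_ (hr2.seq (hr3.seq hr4))))).branch_false hD1 hs.bdd
            hcond).mono (by omega), ?_, rfl⟩
        · simpa only [Expr.node, Expr.val_scalar, b1.cur] using h0
        · simp only [Search.step, hch, hq, h0, if_false]
          exact b4

/-- States of the search in which the current node exists and the values are in range. -/
def SearchRange (n : ℕ) (y : Search) : Prop := y.cur ≤ n ∧ ∀ u, u ≠ 0 → y.st u ≤ 3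

omit hM in
theorem SearchRange.step {par : ℕ → ℕ} {Q : ℕ} {loc : (ℕ → ℕ) → ℕ → ℕ} {y : Search}
    (hpar : ∀ c < n, par c ≤ n) (h : SearchRange n y) :
    SearchRange n (Search.step n par Q loc y) := by
  obtain ⟨h1, h2⟩ := h
  rw [Search.step]
  split_ifs with hch hp hq h0
  · exact ⟨by simp only; omega, h2⟩
  · exact ⟨h1, h2⟩
  · refine ⟨h1, fun u hu => ?_⟩
    by_cases huc : u = y.cur
    · subst huc; simp only [Function.update_self]; omega
    · simpa [huc] using h2 u hu
  · exact ⟨h1, fun u hu => by simpa [hu] using h2 u hu⟩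
  · refine ⟨hpar _ (by omega), fun u hu => ?_⟩
    by_cases huc : u = y.cur
    · subst huc; simp
    · simpa [huc] using h2 u hu

theorem run_search (hpar : ∀ c < n, M₀ (2, c) ≤ n) {N : ℕ} {y y' : Search}
    (hreach : Search.Reach n (fun c => M₀ (2, c)) (modulus n)
      (fun σ v => localProduct n (fun i => M₀ (1, i)) (fun i => M₀ (3, i)) σ v n) N y y')
    (hend : y'.st 0 = 4) :
    ∀ {s : State}, Represents n M₀ s.mem y → SearchRange n y →
    ∃ s', Run ω (cellBound n) (.loop (4 - .cell 4 0) .searchStep) s (N * (n * 3 + 11) + 1) s' ∧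
      Represents n M₀ s'.mem y' ∧ s'.tossed = s.tossed := by
  have hD1 : 1 ≤ cellBound n := by rw [cellBound]; omega
  induction hreach with
  | refl y =>
    intro s hs _
    exact ⟨s, (Run.loop_done hD1 hs.bdd (by simp [hs.st, hend])).mono (by omega), hs, rfl⟩
  | head h3 _ ih =>
    rename_i N y y' _
    intro s hs hrange
    have hst : y.st y.cur ≤ 3 := by
      by_cases h0 : y.cur = 0
      · rw [h0, h3]
      · exact hrange.2 _ h0
    obtain ⟨s', hr, b, t⟩ := run_searchStep (ω := ω) hM hpar hs hrange.1 hst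
    obtain ⟨s'', hr', b', t'⟩ := ih hend b (hrange.step hpar)
    refine ⟨s'', (Run.loop_step hD1 hs.bdd (by simp [hs.st, h3]) hr hr').mono
      (le_of_eq (by ring)), b', t'.trans t⟩

end Body

/-! ### Reading off the answer -/

/-- Answer yes if one of the relevant digits of the result is not divisible by `2 ^ (k + 1)`. -/
def Prog.readout : Prog :=
  .seq (.assign 0 (.const 13) (.cell 6 0)) <|
  -- Removes the factor that belongs to `ℓ` vertices and `ℓ` edges; afterwards the lowest
  -- `weightBound n` digits are indexed by the weight.
  .seq (.for 10 (.scalar 2) (.assign 0 (.const 13) (.scalar 13 / (.scalar 6 * .scalar 7)))) <|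
  .seq (.assign 0 (.const 14) 0) <|
  .seq (.for 10 (.scalar 0 * .scalar 0 * .scalar 3 + 1) <|
    .seq (.assign 0 (.const 14)
      -- A disjunction: with truncated subtraction `1 - (1 - a) * (1 - b)` is `0` if `a = b = 0` and
      -- `1` otherwise.
      (1 - (1 - .scalar 14) * (1 - .mod (.mod (.scalar 13) (.scalar 5)) (.scalar 9)))) <|
    .assign 0 (.const 13) (.scalar 13 / .scalar 5)) <|
  .assign 0 (.const 0) (.scalar 14)

open Classical in
theorem run_readout {ω : ℕ → Bool} {n k ℓ : ℕ} (hl : ℓ ≤ n + 1) {s : State}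
    (hs : Constants n k ℓ s.mem) :
    ∃ s', Run ω (cellBound n) .readout s (4 * cellBound n + 20) s' ∧
      s'.mem (0, 0) = if ∃ w < weightBound n, s.mem (6, 0) / (vertexVar n * edgeVar n) ^ ℓ
        / radix n ^ w % radix n % 2 ^ (k + 1) ≠ 0 then 1 else 0 := by
  have hD : 16 ≤ cellBound n := by rw [cellBound]; omega
  have hD1 : 1 ≤ cellBound n := by omega
  have hDdef : cellBound n = modulusLength n + n * n + n + 20 := rfl
  have hml := modulusLength_ge n
  have hsmall : ∀ {x}, x ≤ cellBound n → x < 2 ^ cellBound n := lt_two_pow_cellBound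
  have hP : s.mem (6, 0) < 2 ^ cellBound n := Nat.size_le.1 (hs.bdd.size_le 6 0)
  have hdiv : ∀ x, s.mem (6, 0) / x < 2 ^ cellBound n := fun x =>
    (Nat.div_le_self _ x).trans_lt hP
  have hdiv2 : ∀ x y, s.mem (6, 0) / x / y < 2 ^ cellBound n := fun x y =>
    (Nat.div_le_self _ _).trans_lt (hdiv x)
  have hr1 := Run.assign (ω := ω) hD1 hs.bdd 0 (.const 13) (.cell 6 0)
  have b1 := hs.bdd.update (a := 0) (i := 13) (by omega) (by omega) hP
  simp only [Expr.val_const, Expr.val_cell, Expr.val_ofNat] at hr1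
  -- division
  have key := Run.for (ω := ω) hD (c := 10) (b := .scalar 2)
    (p := .assign 0 (.const 13) (.scalar 13 / (.scalar 6 * .scalar 7)))
    (fun j a => Bdd (cellBound n) a.mem ∧ a.mem (0, 10) = j ∧
      a.mem (0, 13) = s.mem (6, 0) / (vertexVar n * edgeVar n) ^ j ∧
      ∀ i < 10, a.mem (0, i) = s.mem (0, i)) (L := ℓ) (K := 1)
    (fun j hj a ⟨h1, h2, h3, h4⟩ => ⟨h1, h2, by simp [h4, hs.l_eq]⟩) ?_
    (s := ⟨s.mem.update (0, 13) (s.mem (6, 0)), s.tossed⟩) b1 ?_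
  rotate_left
  · rintro j hj a ⟨a1, a2, a3, a4⟩
    have hr := Run.assign (ω := ω) hD1 a1 0 (.const 13) (.scalar 13 / (.scalar 6 * .scalar 7))
    have e6 := (a4 6 (by omega)).trans hs.vertexVar_eq
    have e7 := (a4 7 (by omega)).trans hs.edgeVar_eq
    simp only [Expr.val_const, Expr.val_div, Expr.val_mul, Expr.val_scalar, a3, e6, e7,
      Nat.div_div_eq_div_mul, ← pow_succ] at hr
    have b2 := a1.update (a := 0) (i := 13) (by omega) (by omega)
      (hdiv ((vertexVar n * edgeVar n) ^ (j + 1)))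
    refine ⟨_, hr, b2, by simp [a2], b2.update (by omega) (by omega) (hsmall (by omega)), by simp,
      by simp, fun i hi => ?_⟩
    have h10 : i ≠ 10 := by omega
    have h13 : i ≠ 13 := by omega
    simp [h10, h13, a4 i hi]
  · refine ⟨b1.update (by omega) (by omega) (hsmall (by omega)), by simp, by simp, fun i hi => ?_⟩
    have h10 : i ≠ 10 := by omega
    have h13 : i ≠ 13 := by omega
    simp [h10, h13]
  obtain ⟨s2, hr2, b2, -, e2, f2⟩ := key
  have hr3 := Run.assign (ω := ω) hD1 b2 0 (.const 14) 0
  have b3 := b2.update (a := 0) (i := 14) (x := 0) (by omega) (by omega) (hsmall (by omega))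
  simp only [Expr.val_const, Expr.val_ofNat] at hr3
  -- the digits
  let R := s.mem (6, 0) / (vertexVar n * edgeVar n) ^ ℓ
  let good : ℕ → Prop := fun w => R / radix n ^ w % radix n % 2 ^ (k + 1) ≠ 0
  have key := Run.for (ω := ω) hD (c := 10) (b := .scalar 0 * .scalar 0 * .scalar 3 + 1)
    (p := .seq (.assign 0 (.const 14)
      (1 - (1 - .scalar 14) * (1 - .mod (.mod (.scalar 13) (.scalar 5)) (.scalar 9)))) <|
    .assign 0 (.const 13) (.scalar 13 / .scalar 5))
    (fun j a => Bdd (cellBound n) a.mem ∧ a.mem (0, 10) = j ∧ a.mem (0, 13) = R / radix n ^ j ∧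
      a.mem (0, 14) = (if ∃ w < j, good w then 1 else 0) ∧
      ∀ i < 10, a.mem (0, i) = s.mem (0, i)) (L := weightBound n) (K := 1 + 1)
    (fun j hj a ⟨h1, h2, h3, h4, h5⟩ => ⟨h1, h2, by
      simp [h5, hs.n_eq, hs.coins_eq, weightBound]⟩) ?_
    (s := ⟨s2.mem.update (0, 14) 0, s2.tossed⟩) b3 ?_
  rotate_left
  · rintro j hj a ⟨a1, a2, a3, a4, a5⟩
    have hr := Run.assign (ω := ω) hD1 a1 0 (.const 14)
      (1 - (1 - .scalar 14) * (1 - .mod (.mod (.scalar 13) (.scalar 5)) (.scalar 9)))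
    have e5 := (a5 5 (by omega)).trans hs.radix_eq
    have e9 := (a5 9 (by omega)).trans hs.power_eq
    have hans : 1 - (1 - (if ∃ w < j, good w then 1 else 0))
        * (1 - R / radix n ^ j % radix n % 2 ^ (k + 1)) = if ∃ w < j + 1, good w then 1 else 0 := by
      by_cases h1 : ∃ w < j, good w
      · have h2 : ∃ w < j + 1, good w := by
          obtain ⟨w, hw, hg⟩ := h1
          exact ⟨w, by omega, hg⟩
        rw [if_pos h1, if_pos h2, Nat.sub_self, Nat.zero_mul]
      · by_cases h3 : good j
        · have h2 : ∃ w < j + 1, good w := ⟨j, by omega, h3⟩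
          have : 1 - R / radix n ^ j % radix n % 2 ^ (k + 1) = 0 := by
            simp only [good] at h3
            omega
          rw [this, if_neg h1, if_pos h2]
        · have h2 : ¬ ∃ w < j + 1, good w := by
            rintro ⟨w, hw, hg⟩
            rcases Nat.lt_succ_iff_lt_or_eq.1 hw with hw | rfl
            · exact h1 ⟨w, hw, hg⟩
            · exact h3 hg
          have : 1 - R / radix n ^ j % radix n % 2 ^ (k + 1) = 1 := by
            simp only [good] at h3
            omega
          rw [this, if_neg h1, if_neg h2]
    simp only [Expr.val_const, Expr.val_sub, Expr.val_mul, Expr.val_mod, Expr.val_scalar,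
      Expr.val_ofNat, a3, a4, e5, e9, hans] at hr
    have hle : (if ∃ w < j + 1, good w then 1 else 0) < 2 ^ cellBound n := by
      split_ifs <;> exact hsmall (by omega)
    have b4 := a1.update (a := 0) (i := 14) (by omega) (by omega) hle
    have hr' := Run.assign (ω := ω) (D := cellBound n)
      (s := ⟨a.mem.update (0, 14) (if ∃ w < j + 1, good w then 1 else 0), a.tossed⟩)
      hD1 b4 0 (.const 13) (.scalar 13 / .scalar 5)
    have g13 : a.mem.update (0, 14) (if ∃ w < j + 1, good w then 1 else 0) (0, 13)
        = R / radix n ^ j := by simp [a3]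
    have g5 : a.mem.update (0, 14) (if ∃ w < j + 1, good w then 1 else 0) (0, 5)
        = radix n := by simp [e5]
    simp only [Expr.val_const, Expr.val_div, Expr.val_scalar, g13, g5, Nat.div_div_eq_div_mul R,
      ← pow_succ] at hr'
    have b5 := b4.update (a := 0) (i := 13) (by omega) (by omega)
      (hdiv2 ((vertexVar n * edgeVar n) ^ ℓ) (radix n ^ (j + 1)))
    refine ⟨_, hr.seq hr', b5, by simp [a2], ?_, by simp, by simp, by simp, fun i hi => ?_⟩
    · exact b5.update (by omega) (by omega) (hsmall (by omega))
    · have h10 : i ≠ 10 := by omega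
      have h13 : i ≠ 13 := by omega
      have h14 : i ≠ 14 := by omega
      simp [h10, h13, h14, a5 i hi]
  · refine ⟨b3.update (by omega) (by omega) (hsmall (by omega)), by simp, by simp [e2, R], by simp,
      fun i hi => ?_⟩
    have h10 : i ≠ 10 := by omega
    have h14 : i ≠ 14 := by omega
    simp [h10, h14, f2 i hi]
  obtain ⟨s4, hr4, b4, -, -, e4, -⟩ := key
  have hr5 := Run.assign (ω := ω) hD1 b4 0 (.const 0) (.scalar 14)
  refine ⟨_, (hr1.seq (hr2.seq (hr3.seq (hr4.seq hr5)))).mono (by omega), ?_⟩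
  simp only [Expr.val_const, Expr.val_scalar, Finsupp.coe_update, Function.update_self, e4]
  rfl

/-! ### The program after truncation of the numbers in the input -/

/-- The main part of the algorithm. -/
def Prog.core : Prog :=
  .seq .constants <| .seq .coins <| .seq (.assign 4 0 3) <| .seq (.assign 5 0 1) <|
  .seq (.loop (4 - .cell 4 0) .searchStep) .readout

/-- The memory holds a graph, a forest, and numbers `k` and `ℓ`; `A` is the adjacency matrix and
`par` the list of parents. -/
structure InputMemory (n k ℓ : ℕ) (A par : ℕ → ℕ) (M : Memory) : Prop where
  bdd : Bdd (cellBound n) M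
  n_eq : M (0, 0) = n
  k_eq : M (0, 1) = k
  l_eq : M (0, 2) = ℓ
  adj : ∀ i, M (1, i) = A i
  par : ∀ i, M (2, i) = par i
  zero : ∀ i, i ≠ 0 → i ≠ 1 → i ≠ 2 → M (0, i) = 0
  zero' : ∀ a, 3 ≤ a → ∀ i, M (a, i) = 0

/-- The initial state of the search. -/
def Search.init : Search where
  cur := 0
  st := Function.update (fun _ => 0) 0 3
  pr := Function.update (fun _ => 0) 0 1
  sm := fun _ => 0
  ch := fun _ => 0

-- `hsearch` ranges over all `W` because the array of weights is only known at the indices below `n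
-- * n`.
open Classical in
theorem run_core {ω : ℕ → Bool} {n k ℓ : ℕ} {A par : ℕ → ℕ} (hk : k ≤ n) (hl : ℓ ≤ n + 1)
    (hpar : ∀ c < n, par c ≤ n) {s : State} (hs : InputMemory n k ℓ A par s.mem)
    (ht : s.tossed = 0) {N P : ℕ}
    (hsearch : ∀ W : ℕ → ℕ,
      (∀ i < n * n, W i = radix n ^ coinNumber ω (coinLength n) i (coinLength n)) →
      ∃ N' ≤ N, ∃ y, Search.Reach n par (modulus n) (fun σ v => localProduct n A W σ v n)
        N' Search.init y ∧ y.st 0 = 4 ∧ y.sm 0 = P) :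
    ∃ s', Run ω (cellBound n) .core s
        (n * n * (coinLength n * 4 + 5) + 24 * cellBound n + N * (n * 3 + 11) + 45) s' ∧
      s'.mem (0, 0) = if ∃ w < weightBound n, P / (vertexVar n * edgeVar n) ^ ℓ
        / radix n ^ w % radix n % 2 ^ (k + 1) ≠ 0 then 1 else 0 := by
  have hD : 16 ≤ cellBound n := by rw [cellBound]; omega
  have hD1 : 1 ≤ cellBound n := by omega
  have hsmall : ∀ {x}, x ≤ cellBound n → x < 2 ^ cellBound n := lt_two_pow_cellBound
  obtain ⟨s1, hr1, c1, t1, f1⟩ := run_constants (ω := ω) hk hs.bdd hs.n_eq hs.k_eq hs.l_eq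
    (hs.zero 4 (by norm_num) (by norm_num) (by norm_num))
  obtain ⟨s2, hr2, c2, w2, f2⟩ := run_coins (ω := ω) c1 (t1.trans ht)
  have hf : ∀ p : ℕ × ℕ, p.1 ≠ 3 → (p.1 = 0 → 12 ≤ p.2 ∧ p.2 ≠ 13) → s2.mem p = s.mem p := by
    rintro ⟨a, i⟩ h3 h0
    simp only at h3 h0
    have hne : ∀ j, (j ≤ 11 ∨ j = 13) → ((a, i) : ℕ × ℕ) ≠ (0, j) := by
      intro j hj h
      obtain ⟨rfl, rfl⟩ := Prod.mk.inj h
      have := h0 rfl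
      omega
    rw [f2 _ h3 (hne _ (by omega)) (hne _ (by omega)) (hne _ (by omega)),
      f1 _ fun h => by have := h0 h; simp only; omega]
  have hr3 := Run.assign (ω := ω) hD1 c2.bdd 4 0 3
  have b3 := c2.bdd.update (a := 4) (i := 0) (x := 3) (by omega) (by omega) (hsmall (by omega))
  have hr4 := Run.assign (ω := ω) (D := cellBound n) (s := ⟨s2.mem.update (4, 0) 3, s2.tossed⟩)
    hD1 b3 5 0 1
  have b4 := b3.update (a := 5) (i := 0) (x := 1) (by omega) (by omega) (hsmall (by omega))
  simp only [Expr.val_ofNat] at hr3 hr4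
  have hrep : Represents n s2.mem ((s2.mem.update (4, 0) 3).update (5, 0) 1) Search.init := by
    refine ⟨b4, fun p hp => ?_, ?_, fun i => ?_, fun i => ?_, fun i => ?_, fun i => ?_⟩
    · have h4 : p ≠ (4, 0) := by rintro rfl; exact hp (Or.inl le_rfl)
      have h5 : p ≠ (5, 0) := by rintro rfl; exact hp (Or.inl (by norm_num))
      simp [h4, h5]
    · have := hf (0, 12) (by simp) (by simp)
      rw [hs.zero 12 (by norm_num) (by norm_num) (by norm_num)] at this
      simp [this, Search.init]
    · have := hf (4, i) (by simp) (by simp)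
      rw [hs.zero' 4 (by norm_num)] at this
      by_cases hi : i = 0 <;> simp [hi, this, Search.init]
    · have := hf (5, i) (by simp) (by simp)
      rw [hs.zero' 5 (by norm_num)] at this
      by_cases hi : i = 0 <;> simp [hi, this, Search.init]
    · have := hf (6, i) (by simp) (by simp)
      rw [hs.zero' 6 (by norm_num)] at this
      simp [this, Search.init]
    · have := hf (7, i) (by simp) (by simp)
      rw [hs.zero' 7 (by norm_num)] at this
      simp [this, Search.init]
  have hpar2 : (fun c => s2.mem (2, c)) = par := funext fun c => by
    rw [hf (2, c) (by simp) (by simp), hs.par]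
  have hadj2 : (fun c => s2.mem (1, c)) = A := funext fun c => by
    rw [hf (1, c) (by simp) (by simp), hs.adj]
  obtain ⟨N', hN', y, hreach, hend, hP⟩ := hsearch (fun i => s2.mem (3, i)) w2
  obtain ⟨s5, hr5, b5, -⟩ := run_search (ω := ω) c2
    (by intro c hc; rw [congrFun hpar2 c]; exact hpar c hc)
    (by rw [hpar2, hadj2]; exact hreach) hend
    (s := ⟨(s2.mem.update (4, 0) 3).update (5, 0) 1, s2.tossed⟩) hrep
    ⟨Nat.zero_le _, fun u hu => by simp [Search.init, hu]⟩
  have c5 : Constants n k ℓ s5.mem := c2.congr b5.bdd fun i hi =>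
    b5.frame _ (by simp [SearchCell]; omega)
  obtain ⟨s6, hr6, e6⟩ := run_readout (ω := ω) hl c5
  refine ⟨s6, (hr1.seq (hr2.seq (hr3.seq (hr4.seq (hr5.seq hr6))))).mono ?_, ?_⟩
  · have := Nat.mul_le_mul_right (n * 3 + 11) hN'
    omega
  · rw [e6, b5.sm, hP]

/-! ### The search on a rooted forest -/

namespace RootedForest

variable {n : ℕ} (T : RootedForest (Fin n))

/-- The number of the parent of the node `c`, shifted by one, or zero if there is none. -/
def parentCode (c : ℕ) : ℕ :=
  if h : c < n then (T.parent ⟨c, h⟩).elim 0 fun u : Fin n => u.val + 1 else 0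

theorem parentCode_le (c : ℕ) : T.parentCode c ≤ n := by
  rw [parentCode]
  split_ifs with h
  · rcases T.parent ⟨c, h⟩ with _ | u
    · simp
    · exact u.isLt
  · exact Nat.zero_le n

theorem parentCode_val (c : Fin n) :
    T.parentCode c = (T.parent c).elim 0 fun u : Fin n => u.val + 1 := by
  rw [parentCode, dif_pos c.isLt]

theorem parentCode_eq_iff (c : Fin n) (p : Option (Fin n)) :
    T.parentCode c = p.elim 0 (fun u : Fin n => u.val + 1) ↔ T.parent c = p := by
  rw [parentCode_val]
  rcases T.parent c with _ | u <;> rcases p with _ | w <;> simp [Fin.ext_iff]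

theorem image_children {p : Option (Fin n)} {m : ℕ}
    (hm : p.elim 0 (fun u : Fin n => u.val + 1) = m) :
    (T.children p).map Fin.valEmbedding
      = (Finset.range n).filter fun d => T.parentCode d = m := by
  subst hm
  ext d
  simp only [Finset.mem_map, mem_children, Fin.valEmbedding_apply, Finset.mem_filter,
    Finset.mem_range]
  constructor
  · rintro ⟨c, hc, rfl⟩
    exact ⟨c.isLt, (T.parentCode_eq_iff c p).2 hc⟩
  · rintro ⟨hd, h⟩
    exact ⟨⟨d, hd⟩, (T.parentCode_eq_iff ⟨d, hd⟩ p).1 h, rfl⟩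

/-- The code `u` is that of an ancestor of the node with code `v`. -/
def AncestorCode (u v : ℕ) : Prop :=
  u = v ∨ ∃ a d : Fin n, u = a.val + 1 ∧ v = d.val + 1 ∧ T.Ancestor a d

theorem ancestorCode_iff (a d : Fin n) : T.AncestorCode (a.val + 1) (d.val + 1) ↔ T.Ancestor a d := by
  constructor
  · rintro (h | ⟨a', d', h1, h2, h⟩)
    · have : a = d := Fin.ext (by omega)
      exact this ▸ Relation.ReflTransGen.refl
    · have h1' : a = a' := Fin.ext (by omega)
      have h2' : d = d' := Fin.ext (by omega)
      rwa [h1', h2']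
  · exact fun h => Or.inr ⟨a, d, rfl, rfl, h⟩

theorem ncard_tail_le_depth (v : Fin n) : (T.tail v).ncard ≤ T.depth :=
  Finset.le_sup (f := fun v => (T.tail v).ncard) (Finset.mem_univ v)

theorem ncard_tail_of_parent {c p : Fin n} (h : T.parent c = some p) :
    (T.tail c).ncard = (T.tail p).ncard + 1 := by
  have : T.tail c = insert c (T.tail p) := by
    ext u
    simp only [tail, Set.mem_insert_iff, Set.mem_ofPred_eq]
    constructor
    · intro hu
      by_cases hne : u = c
      · exact Or.inl hne
      · exact Or.inr (T.ancestor_parent hu h hne)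
    · rintro (rfl | hu)
      · exact Relation.ReflTransGen.refl
      · exact hu.tail h
  have hnot : c ∉ T.tail p := T.not_ancestor_of_parent h
  rw [this, Set.ncard_insert_of_notMem hnot (Set.toFinite _)]

theorem ncard_tail_root {c : Fin n} (h : T.parent c = none) : (T.tail c).ncard = 1 := by
  have : T.tail c = {c} := by
    ext u
    simp only [tail, Set.mem_singleton_iff, Set.mem_ofPred_eq]
    constructor
    · intro hu
      rcases Relation.ReflTransGen.cases_tail hu with hu | ⟨w, -, hw⟩
      · exact hu.symm
      · rw [h] at hw; cases hw
    · rintro rfl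
      exact Relation.ReflTransGen.refl
  rw [this, Set.ncard_singleton]

/-- A bound for the number of steps of the search in the subtree of `v`. -/
noncomputable def searchBound (v : Fin n) : ℕ :=
  4 ^ (T.depth + 1 - (T.tail v).ncard) * (n + 1) * (T.subtree v).card

theorem card_subtree (v : Fin n) :
    (T.subtree v).card = 1 + ∑ c ∈ T.children (some v), (T.subtree c).card := by
  rw [T.subtree_eq_insert v, Finset.card_insert_of_notMem (T.notMem_biUnion_subtree v),
    Finset.card_biUnion fun c hc d hd hne =>
      T.disjoint_subtree (T.mem_children.1 hc) (T.mem_children.1 hd) hne, add_comm]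

theorem sum_card_subtree_roots : ∑ c ∈ T.children none, (T.subtree c).card = n := by
  rw [← Finset.card_biUnion fun c hc d hd hne =>
      T.disjoint_subtree (T.mem_children.1 hc) (T.mem_children.1 hd) hne, T.biUnion_roots,
    Finset.card_univ, Fintype.card_fin]

/-- The path to a child is one node longer, so the factor `4` for the four passes is absorbed by the
power of four. The sizes of the subtrees of the children sum to one less than that of `v`, and this
missing one pays for the `n + 1` steps at `v` itself. -/
theorem searchBound_step (v : Fin n) :
    4 * (n + 1 + ∑ c ∈ T.children (some v), T.searchBound c) ≤ T.searchBound v := by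
  have hd := T.ncard_tail_le_depth v
  have hchild : ∀ c ∈ T.children (some v), 4 * T.searchBound c
      = 4 ^ (T.depth + 1 - (T.tail v).ncard) * (n + 1) * (T.subtree c).card := fun c hc => by
    have h1 := T.ncard_tail_of_parent (T.mem_children.1 hc)
    have h2 := T.ncard_tail_le_depth c
    rw [searchBound, show T.depth + 1 - (T.tail v).ncard
      = (T.depth + 1 - (T.tail c).ncard) + 1 by omega, pow_succ]
    ring
  have h4 : 4 ≤ 4 ^ (T.depth + 1 - (T.tail v).ncard) :=
    Nat.le_self_pow (by omega) 4
  rw [mul_add, Finset.mul_sum, Finset.sum_congr rfl hchild, ← Finset.mul_sum, searchBound,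
    T.card_subtree v]
  linarith [Nat.mul_le_mul_right (n + 1) h4]

/-- At a root the exponent is exactly the depth, and the trees together have `n` nodes. -/
theorem sum_searchBound_roots :
    ∑ c ∈ T.children none, T.searchBound c = 4 ^ T.depth * (n + 1) * n := by
  have : ∀ c ∈ T.children none, T.searchBound c
      = 4 ^ T.depth * (n + 1) * (T.subtree c).card := fun c hc => by
    rw [searchBound, T.ncard_tail_root (T.mem_children.1 hc), Nat.add_sub_cancel]
  rw [Finset.sum_congr rfl this, ← Finset.mul_sum, T.sum_card_subtree_roots]

/-- Extension of a function on the nodes to codes. -/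
noncomputable def onCodes {β : Type} [Zero β] (f : Fin n → β) (v : ℕ) : β :=
  if h : v - 1 < n then f ⟨v - 1, h⟩ else 0

theorem onCodes_succ {β : Type} [Zero β] (f : Fin n → β) (v : Fin n) :
    onCodes f (v.val + 1) = f v := by
  simp [onCodes]

theorem comp_update_code (σ : ℕ → ℕ) (v : Fin n) (q : ℕ) :
    (fun u : Fin n => Function.update σ (v.val + 1) q (u.val + 1))
      = Function.update (fun u : Fin n => σ (u.val + 1)) v q := by
  funext u
  by_cases h : u = v
  · subst h; simp
  · have : u.val + 1 ≠ v.val + 1 := fun h' => h (Fin.ext (by omega))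
    rw [Function.update_of_ne this, Function.update_of_ne h]

variable {Q : ℕ} {loc : Fin n → (Fin n → ℕ) → ZMod Q} {locN : (ℕ → ℕ) → ℕ → ℕ}

/-- Node `c` has code `c + 1`, and `0` is the artificial root above everything. `hN` asks for
agreement of the computed factor only where the states vanish off the ancestors, which is where the
search evaluates it. The field `value` is `treeSum_eq` in codes. -/
theorem spec (hloc : ∀ v σ τ, (∀ u, T.Ancestor u v → σ u = τ u) → loc v σ = loc v τ)
    (hN : ∀ (v : Fin n) σ, σ (v.val + 1) < 4 → (∀ a : Fin n, ¬ T.Ancestor a v → σ (a.val + 1) = 0) →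
      (locN σ (v.val + 1) : ZMod Q) = loc v fun u => σ (u.val + 1)) :
    Search.Spec n T.parentCode Q locN (fun v u => v = 0 ∨ T.AncestorCode v u)
      (fun v σ => ∀ u, u ≠ 0 → ¬ T.AncestorCode u v → σ u = 0)
      (fun v σ => onCodes (fun c => T.treeSum loc c fun u => σ (u.val + 1)) v)
      (onCodes T.searchBound) where
  sub_refl v := Or.inr (Or.inl rfl)
  sub_child c hc u hu := by
    obtain ⟨c, rfl⟩ : ∃ c' : Fin n, c'.val = c := ⟨⟨c, hc⟩, rfl⟩
    rw [T.parentCode_val]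
    rcases hp : T.parent c with _ | p
    · exact Or.inl rfl
    · right
      simp only [Option.elim]
      obtain hu | hu | ⟨a, d, h1, rfl, h⟩ := hu
      · omega
      · exact hu ▸ (T.ancestorCode_iff p c).2 (Relation.ReflTransGen.single hp)
      · have : c = a := Fin.ext (by omega)
        subst this
        exact (T.ancestorCode_iff p d).2 (Relation.ReflTransGen.head hp h)
  not_sub c hc := by
    obtain ⟨c, rfl⟩ : ∃ c' : Fin n, c'.val = c := ⟨⟨c, hc⟩, rfl⟩
    rw [T.parentCode_val]
    rcases hp : T.parent c with _ | p
    · rintro (h | h | ⟨a, d, -, h, -⟩)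
      · omega
      · simp at h
      · simp at h
    · simp only [Option.elim]
      rintro (h | h)
      · omega
      · exact T.not_ancestor_of_parent hp ((T.ancestorCode_iff c p).1 h)
  ok_child c hc σ hσ := by
    obtain ⟨c, rfl⟩ : ∃ c' : Fin n, c'.val = c := ⟨⟨c, hc⟩, rfl⟩
    rw [T.parentCode_val] at hσ
    rcases hp : T.parent c with _ | p
    · rw [hp] at hσ
      have h0 : ∀ u, u ≠ 0 → σ u = 0 := fun u hu => hσ u hu (by
        rintro (h | ⟨a, d, -, h, -⟩)
        · exact hu h
        · simp at h)
      exact ⟨fun u hu _ => h0 u hu, h0 _ (by omega)⟩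
    · rw [hp] at hσ
      refine ⟨fun u hu h => hσ u hu fun h' => h ?_, hσ _ (by omega) fun h =>
        T.not_ancestor_of_parent hp ((T.ancestorCode_iff c p).1 h)⟩
      obtain h' | ⟨a, d, rfl, h2, h'⟩ := h'
      · rw [h']; exact (T.ancestorCode_iff p c).2 (Relation.ReflTransGen.single hp)
      · have : p = d := Fin.ext (by simp only [Option.elim] at h2; omega)
        subst this
        exact (T.ancestorCode_iff a c).2 (h'.tail hp)
  ok_update v σ q hσ u hu h := by
    have : u ≠ v := fun h' => h (Or.inl h')
    rw [Function.update_of_ne this]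
    exact hσ u hu h
  induct P hP c hc := by
    obtain ⟨c, rfl⟩ : ∃ c' : Fin n, c'.val = c := ⟨⟨c, hc⟩, rfl⟩
    clear hc
    induction c using T.wellFounded_parent.induction with
    | _ c ih =>
      refine hP c c.isLt fun d hd h => ?_
      exact ih ⟨d, hd⟩ ((T.parentCode_eq_iff ⟨d, hd⟩ (some c)).1 h)
  value c hc σ hσ := by
    obtain ⟨c, rfl⟩ : ∃ c' : Fin n, c'.val = c := ⟨⟨c, hc⟩, rfl⟩
    rw [onCodes_succ, T.treeSum_eq hloc]
    refine Finset.sum_congr rfl fun q hq => ?_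
    rw [← T.image_children (p := some c) (m := c.val + 1) rfl, Finset.prod_map, hN, comp_update_code]
    · congr 1
      refine Finset.prod_congr rfl fun d _ => ?_
      rw [Fin.valEmbedding_apply, onCodes_succ]
    · rw [Function.update_self]
      exact Finset.mem_range.1 hq
    · intro a ha
      have hac : a.val + 1 ≠ c.val + 1 := fun h => ha (by
        rw [show a = c from Fin.ext (by omega)]; exact Relation.ReflTransGen.refl)
      rw [Function.update_of_ne hac]
      exact hσ _ (by omega) fun h => ha ((T.ancestorCode_iff a c).1 h)
  steps c hc := by
    obtain ⟨c, rfl⟩ : ∃ c' : Fin n, c'.val = c := ⟨⟨c, hc⟩, rfl⟩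
    rw [← T.image_children (p := some c) (m := c.val + 1) rfl, Finset.sum_map, onCodes_succ]
    simp only [Fin.valEmbedding_apply, onCodes_succ]
    exact T.searchBound_step c

/-- The search computes the sum over all assignments. -/
theorem exists_reach (hloc : ∀ v σ τ, (∀ u, T.Ancestor u v → σ u = τ u) → loc v σ = loc v τ)
    (hN : ∀ (v : Fin n) σ, σ (v.val + 1) < 4 → (∀ a : Fin n, ¬ T.Ancestor a v → σ (a.val + 1) = 0) →
      (locN σ (v.val + 1) : ZMod Q) = loc v fun u => σ (u.val + 1)) (hQ : 0 < Q) :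
    ∃ N ≤ 4 ^ T.depth * (n + 1) ^ 2, ∃ y, Search.Reach n T.parentCode Q locN N Search.init y ∧
      y.st 0 = 4 ∧ y.sm 0 < Q ∧ (y.sm 0 : ZMod Q)
        = ∑ τ ∈ Fintype.piFinset (fun _ : Fin n => Finset.range 4), ∏ v, loc v τ := by
  have h0 := T.image_children (p := none) (m := 0) rfl
  obtain ⟨N, hle, y, hr, h4, hlt, hy⟩ := Search.run (T.spec hloc hN) Search.init rfl rfl
    (fun u hu _ => by simp [Search.init, hu]) rfl rfl rfl hQ
  refine ⟨N, hle.trans ?_, y, hr, h4, hlt, ?_⟩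
  · rw [← h0, Finset.sum_map]
    simp only [Fin.valEmbedding_apply, onCodes_succ]
    rw [T.sum_searchBound_roots]
    have : n + 1 ≤ 4 ^ T.depth * (n + 1) := Nat.le_mul_of_pos_left _ (by positivity)
    nlinarith
  · rw [hy, ← h0, Finset.prod_map]
    simp only [Fin.valEmbedding_apply, onCodes_succ]
    exact T.prod_treeSum_roots hloc _

end RootedForest

/-! ### The value computed by the search -/

section Value

variable {n : ℕ}

/-- The index of a pair of vertices in an `n × n` array. -/
def pairIndex (p : Fin n × Fin n) : ℕ := p.1 * n + p.2

theorem finProdFinEquiv_val (p : Fin n × Fin n) :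
    (finProdFinEquiv p : Fin (n * n)).val = pairIndex p := by
  rw [finProdFinEquiv_apply_val, pairIndex, add_comm, Nat.mul_comm]

theorem pairIndex_lt (p : Fin n × Fin n) : pairIndex p < n * n := by
  rw [← finProdFinEquiv_val]
  exact Fin.isLt _

theorem pairIndex_injective : Function.Injective (pairIndex : Fin n × Fin n → ℕ) := by
  intro p q h
  rw [← finProdFinEquiv_val, ← finProdFinEquiv_val] at h
  exact finProdFinEquiv.injective (Fin.ext h)

/-- The random number of an index. -/
def indexWeight (ω : ℕ → Bool) (n i : ℕ) : ℕ := coinNumber ω (coinLength n) i (coinLength n)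

open Classical in
/-- The weight of an edge: the sum of the random numbers of both orderings of its endpoints. -/
noncomputable def edgeWeight (ω : ℕ → Bool) (e : Sym2 (Fin n)) : ℕ :=
  ∑ p : Fin n × Fin n with s(p.1, p.2) = e, indexWeight ω n (pairIndex p)

theorem edgeWeight_mk (ω : ℕ → Bool) {u v : Fin n} (h : u ≠ v) :
    edgeWeight ω s(u, v) = indexWeight ω n (pairIndex (u, v)) + indexWeight ω n (pairIndex (v, u)) := by
  classical
  have : (Finset.univ.filter fun p : Fin n × Fin n => s(p.1, p.2) = s(u, v))
      = {(u, v), (v, u)} := by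
    ext ⟨a, b⟩
    simp
  rw [edgeWeight, this, Finset.sum_pair fun h' => h (Prod.mk.inj h').1]

open Classical in
/-- The indices of the pairs of vertices that form an edge in `C`. -/
noncomputable def indexSet (C : Set (Sym2 (Fin n))) : Finset (Fin (n * n)) :=
  (Finset.univ.filter fun p : Fin n × Fin n => s(p.1, p.2) ∈ C).map finProdFinEquiv.toEmbedding

theorem indexSet_injective :
    Function.Injective (indexSet : Set (Sym2 (Fin n)) → Finset (Fin (n * n))) := by
  classical
  intro C D h
  have h := Finset.map_injective _ h
  ext e
  induction e using Sym2.ind with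
  | _ u v =>
    have := Finset.ext_iff.1 h (u, v)
    simpa using this

/-- The weight of a set of edges. -/
noncomputable def coverWeight (ω : ℕ → Bool) (C : Set (Sym2 (Fin n))) : ℕ :=
  setWeight (coinLength n) ω (indexSet C)

theorem coverWeight_lt (ω : ℕ → Bool) (C : Set (Sym2 (Fin n))) :
    coverWeight ω C < weightBound n := by
  rw [weightBound, Nat.lt_succ_iff, coverWeight, setWeight]
  refine (Finset.sum_le_card_nsmul _ _ _ fun i _ => (coinNumber_lt ω _ _ _).le).trans ?_
  rw [smul_eq_mul]
  refine Nat.mul_le_mul_right _ ?_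
  simpa using Finset.card_le_univ (indexSet C)

variable {G : SimpleGraph (Fin n)}

-- Every ordered pair in the support belongs to exactly one coloured edge, so the pairs can be
-- grouped by their edge.
open Classical in
theorem sum_edgeWeight (ω : ℕ → Bool) (f : G.edgeSet → Fin 3) :
    ∑ e with f e ≠ 0, edgeWeight ω (e : Sym2 (Fin n)) = coverWeight ω (colourSupp f) := by
  have h1 : coverWeight ω (colourSupp f)
      = ∑ p : Fin n × Fin n with s(p.1, p.2) ∈ colourSupp f, indexWeight ω n (pairIndex p) := by
    rw [coverWeight, setWeight, indexSet, Finset.sum_map]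
    refine Finset.sum_congr (by congr) fun p _ => ?_
    rw [Equiv.coe_toEmbedding, finProdFinEquiv_val, indexWeight]
  have h2 : ∑ e with f e ≠ 0, edgeWeight ω (e : Sym2 (Fin n))
      = ∑ e ∈ (Finset.univ.filter fun e => f e ≠ 0).map (Function.Embedding.subtype _),
        edgeWeight ω e := by
    rw [Finset.sum_map]; rfl
  rw [h1, h2]
  symm
  rw [← Finset.sum_fiberwise_of_maps_to (g := fun p : Fin n × Fin n => s(p.1, p.2))
    (t := (Finset.univ.filter fun e => f e ≠ 0).map (Function.Embedding.subtype _))]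
  · refine Finset.sum_congr rfl fun e he => ?_
    rw [edgeWeight, Finset.filter_filter]
    refine Finset.sum_congr (Finset.filter_congr fun p _ => ?_) fun _ _ => rfl
    refine ⟨fun h => h.2, fun h => ⟨?_, h⟩⟩
    rw [h]
    obtain ⟨e', he', rfl⟩ := Finset.mem_map.1 he
    exact ⟨e'.2, (Finset.mem_filter.1 he').2⟩
  · intro p hp
    obtain ⟨h, hf⟩ := (Finset.mem_filter.1 hp).2
    exact Finset.mem_map.2 ⟨⟨_, h⟩, by simpa using hf, rfl⟩

open Classical in
/-- The factor of a vertex and its neighbours among its ancestors. -/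
noncomputable def localFactor (G : SimpleGraph (Fin n)) (T : RootedForest (Fin n)) {R : Type}
    [CommRing R] (t : R) (y : Sym2 (Fin n) → R) (v : Fin n) (τ : Fin n → ℕ) : R :=
  vertexWeight t (τ v) * ∏ a with T.Ancestor a v ∧ G.Adj v a,
    (1 + y s(v, a) * (hiBit R (τ v) * hiBit R (τ a) + loBit R (τ v) * loBit R (τ a)))

open Classical in
theorem localFactor_congr (G : SimpleGraph (Fin n)) (T : RootedForest (Fin n)) {R : Type}
    [CommRing R] (t : R) (y : Sym2 (Fin n) → R) (v : Fin n) (σ τ : Fin n → ℕ)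
    (h : ∀ u, T.Ancestor u v → σ u = τ u) : localFactor G T t y v σ = localFactor G T t y v τ := by
  rw [localFactor, localFactor, h v Relation.ReflTransGen.refl]
  congr 1
  refine Finset.prod_congr rfl fun a ha => ?_
  rw [h a (Finset.mem_filter.1 ha).2.1]

-- The product of the local factors is regrouped as a product over all edges, each taken at its
-- lower endpoint, and then inclusion-exclusion applies.
open Classical in
theorem sum_prod_localFactor (G : SimpleGraph (Fin n)) (T : RootedForest (Fin n))
    (hT : T.IsEliminationForest G) {R : Type} [CommRing R] (t : R) (y : Sym2 (Fin n) → R) :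
    ∑ τ ∈ Fintype.piFinset (fun _ : Fin n => Finset.range 4), ∏ v, localFactor G T t y v τ
      = ∑ f : G.edgeSet → Fin 3 with Balanced (edgeInc G) f,
          t ^ (touched (edgeInc G) f).card * ∏ e with f e ≠ 0, y e := by
  rw [← sum_assignments_eq (edgeInc G) (fun e => y e) t]
  refine Finset.sum_congr rfl fun τ _ => ?_
  have h := prod_edges_eq G T hT fun e => 1 + y e * ((∏ v with v ∈ e, hiBit R (τ v))
    + ∏ v with v ∈ e, loBit R (τ v))
  simp only [localFactor, Finset.prod_mul_distrib]
  congr 1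
  refine Eq.trans ?_ (h.symm.trans ?_)
  · refine Finset.prod_congr rfl fun v _ => Finset.prod_congr rfl fun a ha => ?_
    have hne : v ≠ a := (Finset.mem_filter.1 ha).2.2.ne
    have : (Finset.univ.filter fun x => x ∈ s(v, a)) = {v, a} := by
      ext x; simp
    rw [this, Finset.prod_pair hne, Finset.prod_pair hne]
  · exact Finset.prod_congr rfl fun e _ => by unfold edgeInc; congr!

/-! ### The local factors as computed by the program -/

variable {A W : ℕ → ℕ} {ω : ℕ → Bool}

theorem cast_localProduct (σ : ℕ → ℕ) (v m : ℕ) :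
    (localProduct n A W σ v m : ZMod (modulus n))
      = nodeWeight n (σ v) * ∏ a ∈ Finset.range m, (pairFactor n A W σ v a : ZMod (modulus n)) := by
  induction m with
  | zero => simp [localProduct]
  | succ m ih =>
    rw [localProduct, ZMod.natCast_mod, Nat.cast_mul, ih, Finset.prod_range_succ, mul_assoc]

/-- The program has only natural numbers; `modulus n - 2` plays the role of `-2`. -/
theorem cast_nodeWeight {q : ℕ} (hq : q < 4) :
    (nodeWeight n q : ZMod (modulus n)) = vertexWeight (vertexVar n : ZMod (modulus n)) q := by
  have h2 : 2 ≤ modulus n := one_lt_modulus n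
  have hm : ((modulus n - 2 : ℕ) : ZMod (modulus n)) = -2 := by
    rw [Nat.cast_sub h2, ZMod.natCast_self]; simp
  rw [nodeWeight, vertexWeight, hiBit, loBit]
  push_cast [hm, Nat.cast_sub (show q / 2 ≤ 1 by omega), Nat.cast_sub (show q % 2 ≤ 1 by omega)]
  ring

-- The program multiplies over all nodes, without testing for ancestors. The extra factors are `1`:
-- a vertex that is not an ancestor has state `0`, so both of its bits vanish.
open Classical in
theorem cast_localProduct_eq (T : RootedForest (Fin n))
    (hA : ∀ p : Fin n × Fin n, A (pairIndex p) = if G.Adj p.1 p.2 then 1 else 0)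
    (hW : ∀ i < n * n, W i = radix n ^ indexWeight ω n i) (v : Fin n) (σ : ℕ → ℕ)
    (hq : σ (v.val + 1) < 4) (hσ : ∀ a : Fin n, ¬ T.Ancestor a v → σ (a.val + 1) = 0) :
    (localProduct n A W σ (v.val + 1) n : ZMod (modulus n))
      = localFactor G T (vertexVar n : ZMod (modulus n))
          (fun e => ((edgeVar n * radix n ^ edgeWeight ω e : ℕ) : ZMod (modulus n))) v
          (fun u => σ (u.val + 1)) := by
  rw [cast_localProduct, cast_nodeWeight hq, localFactor, Finset.prod_range, Finset.prod_filter]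
  congr 1
  refine Finset.prod_congr rfl fun a _ => ?_
  rw [pairFactor, Nat.add_sub_cancel]
  have h1 : A (v.val * n + a.val) = if G.Adj v a then 1 else 0 := hA (v, a)
  have h2 : W (v.val * n + a.val) = radix n ^ indexWeight ω n (pairIndex (v, a)) :=
    hW _ (pairIndex_lt (v, a))
  have h3 : W (a.val * n + v.val) = radix n ^ indexWeight ω n (pairIndex (a, v)) :=
    hW _ (pairIndex_lt (a, v))
  rw [h1, h2, h3]
  by_cases hadj : G.Adj v a
  · by_cases hanc : T.Ancestor a v
    · rw [if_pos hadj, if_pos ⟨hanc, hadj⟩, edgeWeight_mk ω hadj.ne, hiBit, hiBit, loBit, loBit]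
      push_cast [pow_add]
      ring
    · simp [hanc, hσ a hanc]
  · rw [if_neg hadj, if_neg fun h => hadj h.2]
    simp

end Value

/-! ### Decoding the result -/

section Decode

variable {n : ℕ} {G : SimpleGraph (Fin n)}

open Classical in
/-- The number of coloured edges. -/
noncomputable def edgeCount (f : G.edgeSet → Fin 3) : ℕ := (Finset.univ.filter fun e => f e ≠ 0).card

open Classical in
/-- The exponent of the radix to which a colouring contributes. -/
noncomputable def exponent (ω : ℕ → Bool) (f : G.edgeSet → Fin 3) : ℕ :=
  weightBound n * ((touched (edgeInc G) f).card + (n + 2) * edgeCount f)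
    + coverWeight ω (colourSupp f)

open Classical in
/-- The result of the search. -/
noncomputable def resultValue (G : SimpleGraph (Fin n)) (ω : ℕ → Bool) : ℕ :=
  ∑ f : G.edgeSet → Fin 3 with Balanced (edgeInc G) f, radix n ^ exponent ω f

theorem card_edgeSet_le (G : SimpleGraph (Fin n)) [Fintype G.edgeSet] :
    Fintype.card G.edgeSet ≤ n * n := by
  classical
  calc Fintype.card G.edgeSet ≤ Fintype.card (Sym2 (Fin n)) :=
        Fintype.card_le_of_injective _ Subtype.val_injective
    _ ≤ Fintype.card (Fin n × Fin n) :=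
        Fintype.card_le_of_surjective (fun p => s(p.1, p.2)) fun e => by
          induction e using Sym2.ind with
          | _ u v => exact ⟨(u, v), rfl⟩
    _ = n * n := by simp

-- At most `3 ^ (n * n)` colourings exist, so the number of colourings of any kind fits into one
-- digit.
open Classical in
theorem card_colourings_lt (p : (G.edgeSet → Fin 3) → Prop) :
    (Finset.univ.filter p).card < radix n := by
  refine (Finset.card_le_univ _).trans_lt ?_
  rw [Fintype.card_fun, Fintype.card_fin, radix]
  calc 3 ^ Fintype.card G.edgeSet ≤ 4 ^ (n * n) :=
        (Nat.pow_le_pow_left (by norm_num) _).trans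
          (Nat.pow_le_pow_right (by norm_num) (card_edgeSet_le G))
    _ = 2 ^ (2 * n * n) := by rw [show 4 = 2 ^ 2 by norm_num, ← pow_mul, mul_assoc]
    _ < 2 ^ (2 * n * n + 1) := Nat.pow_lt_pow_right (by norm_num) (by omega)

open Classical in
theorem card_touched_le (f : G.edgeSet → Fin 3) : (touched (edgeInc G) f).card ≤ n := by
  simpa using Finset.card_le_univ (touched (edgeInc G) f)

open Classical in
theorem edgeCount_le (f : G.edgeSet → Fin 3) : edgeCount f ≤ n * n :=
  (Finset.card_le_univ _).trans (card_edgeSet_le G)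

theorem modulus_eq_radix_pow :
    modulus n = radix n ^ (weightBound n * ((n + 2) * (n * n + 1))) := by
  rw [modulus, edgeVar, vertexVar, ← pow_mul, ← pow_mul, ← mul_assoc]

open Classical in
theorem exponent_lt (ω : ℕ → Bool) (f : G.edgeSet → Fin 3) :
    exponent ω f < weightBound n * ((n + 2) * (n * n + 1)) := by
  have h1 := card_touched_le f
  have h2 := edgeCount_le f
  have h3 := coverWeight_lt ω (colourSupp f)
  have h4 : (touched (edgeInc G) f).card + (n + 2) * edgeCount f + 1
      ≤ (n + 2) * (n * n + 1) := by nlinarith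
  have := Nat.mul_le_mul_left (weightBound n) h4
  rw [exponent]
  linarith

/-- Hence the residue found by the search is the result itself. -/
theorem resultValue_lt (ω : ℕ → Bool) : resultValue G ω < modulus n := by
  classical
  rw [modulus_eq_radix_pow]
  exact sum_pow_lt (card_colourings_lt _) fun f _ => exponent_lt ω f

-- The exponent is a mixed radix numeral: the weight is below `weightBound n`, and the number of
-- touched vertices below `n + 2`. The base `n + 2`, not `n + 1`, leaves room for `ℓ = n + 1`, the
-- truncated value of every `ℓ` that is too large.
open Classical in
theorem exponent_eq_iff (ω : ℕ → Bool) (f : G.edgeSet → Fin 3) {ℓ w : ℕ} (hl : ℓ ≤ n + 1)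
    (hw : w < weightBound n) :
    exponent ω f = weightBound n * (ℓ + (n + 2) * ℓ) + w ↔
      (touched (edgeInc G) f).card = ℓ ∧ edgeCount f = ℓ ∧ coverWeight ω (colourSupp f) = w := by
  have h1 := card_touched_le f
  have h3 := coverWeight_lt ω (colourSupp f)
  have decode : ∀ {b x y r s : ℕ}, r < b → s < b → b * x + r = b * y + s → x = y ∧ r = s := by
    intro b x y r s hr hs h
    have hb : 0 < b := by omega
    have e1 := congrArg (· / b) h
    have e2 := congrArg (· % b) h
    simp only [Nat.mul_add_div hb, Nat.div_eq_of_lt hr, Nat.div_eq_of_lt hs, add_zero,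
      Nat.mul_add_mod, Nat.mod_eq_of_lt hr, Nat.mod_eq_of_lt hs] at e1 e2
    exact ⟨e1, e2⟩
  rw [exponent]
  constructor
  · intro h
    obtain ⟨h4, h5⟩ := decode h3 hw h
    rw [add_comm, add_comm ℓ] at h4
    obtain ⟨h6, h7⟩ := decode (by omega) (by omega) h4
    exact ⟨h7, h6, h5⟩
  · rintro ⟨h4, h5, h6⟩
    rw [h4, h5, h6]

theorem vertexVar_mul_edgeVar_pow (n ℓ w : ℕ) : (vertexVar n * edgeVar n) ^ ℓ * radix n ^ w
    = radix n ^ (weightBound n * (ℓ + (n + 2) * ℓ) + w) := by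
  rw [edgeVar, vertexVar, ← pow_mul, ← pow_add, ← pow_mul, ← pow_add]
  congr 1
  ring

open Classical in
theorem resultValue_div_pow_mod (G : SimpleGraph (Fin n)) (ω : ℕ → Bool) (j : ℕ) :
    resultValue G ω / radix n ^ j % radix n
      = (Finset.univ.filter fun f : G.edgeSet → Fin 3 =>
          Balanced (edgeInc G) f ∧ exponent ω f = j).card := by
  have hcard := card_colourings_lt (Balanced (edgeInc G))
  rw [resultValue, digit_sum_pow hcard, Finset.filter_filter]

-- The digit counts balanced colourings with `ℓ` touched vertices, `ℓ` edges and weight `w`;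
-- grouping them by support gives `2` to the number of cycles for each cover.
open Classical in
theorem digit_resultValue (hG : G.IsBipartite) (ω : ℕ → Bool) {ℓ w : ℕ} (hl : ℓ ≤ n + 1)
    (hw : w < weightBound n) :
    resultValue G ω / (vertexVar n * edgeVar n) ^ ℓ / radix n ^ w % radix n
      = ∑ C : Set (Sym2 (Fin n)) with IsPartialCycleCover G C ∧ (coveredVertices C).ncard = ℓ ∧
          coverWeight ω C = w, 2 ^ numCycles C := by
  have hdigit := resultValue_div_pow_mod G ω (weightBound n * (ℓ + (n + 2) * ℓ) + w)
  rw [← vertexVar_mul_edgeVar_pow, ← Nat.div_div_eq_div_mul] at hdigit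
  rw [hdigit, ← card_balanced_eq hG ℓ (coverWeight ω) w]
  simp only [exponent_eq_iff _ _ hl hw, edgeCount]
  congr!

/-- The search computes the result. -/
theorem search_result (G : SimpleGraph (Fin n)) (T : RootedForest (Fin n))
    (hT : T.IsEliminationForest G) {A W : ℕ → ℕ} {ω : ℕ → Bool}
    (hA : ∀ p : Fin n × Fin n, G.Adj p.1 p.2 → A (pairIndex p) = 1)
    (hA' : ∀ p : Fin n × Fin n, ¬ G.Adj p.1 p.2 → A (pairIndex p) = 0)
    (hW : ∀ i < n * n, W i = radix n ^ indexWeight ω n i) :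
    ∃ N ≤ 4 ^ T.depth * (n + 1) ^ 2, ∃ y, Search.Reach n T.parentCode (modulus n)
      (fun σ v => localProduct n A W σ v n) N Search.init y ∧ y.st 0 = 4 ∧
      y.sm 0 = resultValue G ω := by
  classical
  have hQ := one_lt_modulus n
  obtain ⟨N, hN, y, hr, h4, hlt, hy⟩ := T.exists_reach
    (loc := localFactor G T (vertexVar n : ZMod (modulus n))
      (fun e => ((edgeVar n * radix n ^ edgeWeight ω e : ℕ) : ZMod (modulus n))))
    (locN := fun σ v => localProduct n A W σ v n)
    (fun v σ τ h => localFactor_congr G T _ _ v σ τ h)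
    (fun v σ hq hσ => cast_localProduct_eq T
      (fun p => by split_ifs with h; exacts [hA p h, hA' p h]) hW v σ hq hσ) (by omega)
  refine ⟨N, hN, y, hr, h4, ?_⟩
  rw [sum_prod_localFactor G T hT] at hy
  have hcast : (y.sm 0 : ZMod (modulus n)) = (resultValue G ω : ℕ) := by
    rw [hy, resultValue, Nat.cast_sum]
    refine Finset.sum_congr (by congr) fun f _ => ?_
    rw [← Nat.cast_prod, ← Nat.cast_pow, ← Nat.cast_mul]
    congr 1
    rw [Finset.prod_mul_distrib, Finset.prod_const, Finset.prod_pow_eq_pow_sum, sum_edgeWeight,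
      exponent, edgeVar, vertexVar, pow_add (radix n), mul_add, pow_add (radix n), ← pow_mul,
      ← pow_mul, ← pow_mul, edgeCount]
    ring
  -- Both sides are below the modulus, so congruence is equality.
  have := (ZMod.natCast_eq_natCast_iff _ _ _).1 hcast
  rwa [Nat.ModEq, Nat.mod_eq_of_lt hlt, Nat.mod_eq_of_lt (resultValue_lt ω)] at this

end Decode

/-! ### Correctness of the answer -/

section Correct

variable {n : ℕ} {G : SimpleGraph (Fin n)}

/-- Some relevant digit of the result is not divisible by `2 ^ (k + 1)`. -/
def Accepts (G : SimpleGraph (Fin n)) (ω : ℕ → Bool) (k ℓ : ℕ) : Prop :=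
  ∃ w < weightBound n, resultValue G ω / (vertexVar n * edgeVar n) ^ ℓ / radix n ^ w % radix n
    % 2 ^ (k + 1) ≠ 0

/-- Without a solution every cover counted in a digit has more than `k` cycles, so every summand is
divisible by `2 ^ (k + 1)`. -/
theorem hasPartialCycleCover_of_accepts (hG : G.IsBipartite) {ω : ℕ → Bool} {k ℓ : ℕ}
    (hl : ℓ ≤ n + 1) (h : Accepts G ω k ℓ) : HasPartialCycleCover G k ℓ := by
  classical
  obtain ⟨w, hw, h⟩ := h
  rw [digit_resultValue hG ω hl hw] at h
  by_contra hno
  refine h (Nat.mod_eq_zero_of_dvd (Finset.dvd_sum fun C hC => pow_dvd_pow 2 ?_))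
  obtain ⟨-, h1, h2, -⟩ := Finset.mem_filter.1 hC
  by_contra hlt
  exact hno ⟨C, h1, by omega, h2⟩

open Classical in
/-- The index sets of the solutions. -/
noncomputable def solutions (G : SimpleGraph (Fin n)) (k ℓ : ℕ) : Finset (Finset (Fin (n * n))) :=
  (Finset.univ.filter fun C : Set (Sym2 (Fin n)) =>
    IsPartialCycleCover G C ∧ numCycles C ≤ k ∧ (coveredVertices C).ncard = ℓ).image indexSet

theorem mem_solutions {k ℓ : ℕ} {A : Finset (Fin (n * n))} :
    A ∈ solutions G k ℓ ↔ ∃ C : Set (Sym2 (Fin n)),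
      (IsPartialCycleCover G C ∧ numCycles C ≤ k ∧ (coveredVertices C).ncard = ℓ) ∧
        indexSet C = A := by
  simp [solutions]

/-- Look at the digit of the weight of the unique lightest solution `C`. Any other cover of that
weight is no solution, hence contributes a multiple of `2 ^ (k + 1)`, while `C` contributes a
smaller power of two. -/
theorem accepts_of_isolating (hG : G.IsBipartite) {ω : ℕ → Bool} {k ℓ : ℕ} (hl : ℓ ≤ n + 1)
    (h : Isolating (solutions G k ℓ) (coinLength n) ω) : Accepts G ω k ℓ := by
  classical
  obtain ⟨A, hA, hmin⟩ := h
  obtain ⟨C, ⟨h1, h2, h3⟩, rfl⟩ := mem_solutions.1 hA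
  refine ⟨coverWeight ω C, coverWeight_lt ω C, ?_⟩
  rw [digit_resultValue hG ω hl (coverWeight_lt ω C)]
  have hC : C ∈ Finset.univ.filter fun D : Set (Sym2 (Fin n)) => IsPartialCycleCover G D ∧
      (coveredVertices D).ncard = ℓ ∧ coverWeight ω D = coverWeight ω C := by
    simp [h1, h3]
  have hrest : 2 ^ (k + 1) ∣ ∑ D ∈ (Finset.univ.filter fun D : Set (Sym2 (Fin n)) =>
      IsPartialCycleCover G D ∧ (coveredVertices D).ncard = ℓ ∧
        coverWeight ω D = coverWeight ω C).erase C, 2 ^ numCycles D := by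
    refine Finset.dvd_sum fun D hD => pow_dvd_pow 2 ?_
    obtain ⟨hne, hD⟩ := Finset.mem_erase.1 hD
    obtain ⟨-, d1, d2, d3⟩ := Finset.mem_filter.1 hD
    by_contra hlt
    exact hne (indexSet_injective (hmin _ (mem_solutions.2 ⟨D, ⟨d1, by omega, d2⟩, rfl⟩) d3.le))
  rw [← Finset.sum_erase_add _ _ hC]
  intro h0
  have hdvd := (Nat.dvd_add_right hrest).1 (Nat.dvd_of_mod_eq_zero h0)
  have := (Nat.pow_dvd_pow_iff_le_right (by norm_num)).1 hdvd
  omega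

theorem coinMeasure_not_accepts_le (hG : G.IsBipartite) {k ℓ : ℕ} (hl : ℓ ≤ n + 1)
    (h : HasPartialCycleCover G k ℓ) : coinMeasure {ω | ¬ Accepts G ω k ℓ} ≤ 1 / 2 := by
  obtain ⟨C, hC⟩ := h
  refine (MeasureTheory.measure_mono fun ω hω => ?_).trans
    (coinMeasure_not_isolating_le (F := solutions G k ℓ) (r := coinLength n)
      ⟨_, mem_solutions.2 ⟨C, hC, rfl⟩⟩ ?_)
  · exact fun hi => hω (accepts_of_isolating hG hl hi)
  · have := le_two_pow_coinLength n
    linarith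

/-- There are at most `n` cycles and at most `n` covered vertices, so `k` may be cut at `n`, and all
`ℓ > n` are alike: none is attained. -/
theorem hasPartialCycleCover_min (k ℓ : ℕ) :
    HasPartialCycleCover G (min k n) (min ℓ (n + 1)) ↔ HasPartialCycleCover G k ℓ := by
  refine exists_congr fun C => and_congr_right fun _ => ?_
  have h1 : numCycles C ≤ n := by simpa using numCycles_le_card C
  have h2 : (coveredVertices C).ncard ≤ n := by simpa using Set.ncard_le_card (coveredVertices C)
  omega

end Correct

/-! ### The initial memory -/

section InitialState

variable {n : ℕ} (G : SimpleGraph (Fin n)) (T : RootedForest (Fin n)) (k ℓ : ℕ)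

theorem initialState_zero (i : ℕ) : (initialState G T k ℓ).mem (0, i)
    = if i = 0 then n else if i = 1 then k else if i = 2 then ℓ else 0 := by
  simp only [initialState, Finsupp.add_apply, Finsupp.finsetSum_apply, Finsupp.single_apply,
    Prod.mk.injEq]
  rcases i with _ | _ | _ | i <;> simp

open Classical in
theorem initialState_one (p : Fin n × Fin n) : (initialState G T k ℓ).mem (1, pairIndex p)
    = if G.Adj p.1 p.2 then 1 else 0 := by
  have hinj : ∀ u v : Fin n, u.val * n + v.val = pairIndex p ↔ (u, v) = p := fun u v =>
    ⟨fun h => pairIndex_injective h, fun h => h ▸ rfl⟩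
  simp only [initialState, Finsupp.add_apply, Finsupp.finsetSum_apply, Finsupp.single_apply,
    Prod.mk.injEq, hinj]
  rw [← Fintype.sum_prod_type']
  simp

theorem initialState_one_ne_zero {i : ℕ} (h : (initialState G T k ℓ).mem (1, i) ≠ 0) :
    ∃ p : Fin n × Fin n, i = pairIndex p := by
  by_contra hno
  have hne : ∀ u v : Fin n, u.val * n + v.val ≠ i := fun u v h => hno ⟨(u, v), h.symm⟩
  refine h ?_
  simp [initialState, hne]

theorem initialState_two (c : ℕ) : (initialState G T k ℓ).mem (2, c) = T.parentCode c := by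
  simp only [initialState, Finsupp.add_apply, Finsupp.finsetSum_apply, Finsupp.single_apply,
    Prod.mk.injEq]
  rw [RootedForest.parentCode]
  by_cases h : c < n
  · rw [dif_pos h]
    have : ∀ v : Fin n, v.val = c ↔ v = ⟨c, h⟩ := fun v => by rw [Fin.ext_iff]
    simp [this]
  · rw [dif_neg h]
    have : ∀ v : Fin n, v.val ≠ c := fun v hv => h (hv ▸ v.isLt)
    simp [this]

theorem initialState_ge_three {a : ℕ} (ha : 3 ≤ a) (i : ℕ) :
    (initialState G T k ℓ).mem (a, i) = 0 := by
  have h0 : 0 ≠ a := by omega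
  have h1 : 1 ≠ a := by omega
  have h2 : 2 ≠ a := by omega
  simp [initialState, h0, h1, h2]

/-- The initial memory with the numbers `k` and `ℓ` replaced by `k'` and `ℓ'`. -/
noncomputable def truncatedMemory (k' ℓ' : ℕ) : Memory :=
  ((initialState G T k ℓ).mem.update (0, 1) k').update (0, 2) ℓ'

theorem inputMemory_truncatedMemory {k' ℓ' : ℕ} (hk : k' ≤ n) (hl : ℓ' ≤ n + 1) :
    InputMemory n k' ℓ' (fun i => (initialState G T k ℓ).mem (1, i)) T.parentCode
      (truncatedMemory G T k ℓ k' ℓ') := by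
  have hD : cellBound n = modulusLength n + n * n + n + 20 := rfl
  have hsmall : ∀ {x}, x ≤ cellBound n → x < 2 ^ cellBound n := lt_two_pow_cellBound
  have h0 : ∀ i, truncatedMemory G T k ℓ k' ℓ' (0, i)
      = if i = 0 then n else if i = 1 then k' else if i = 2 then ℓ' else 0 := fun i => by
    rw [truncatedMemory, Finsupp.coe_update, Function.update_apply, Finsupp.coe_update,
      Function.update_apply, initialState_zero]
    rcases i with _ | _ | _ | i <;> simp
  have hne : ∀ a, a ≠ 0 → ∀ i, truncatedMemory G T k ℓ k' ℓ' (a, i)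
      = (initialState G T k ℓ).mem (a, i) := fun a ha i => by
    simp [truncatedMemory, ha]
  refine ⟨fun a i h => ?_, h0 0, h0 1, h0 2, fun i => hne 1 (by norm_num) i, fun i => ?_,
    fun i h1 h2 h3 => ?_, fun a ha i => ?_⟩
  · rcases a with _ | _ | _ | a
    · rw [h0] at h ⊢
      have hi : i < 3 := by
        by_contra hi
        rw [if_neg (by omega), if_neg (by omega), if_neg (by omega)] at h
        exact h rfl
      refine ⟨by norm_num, by omega, hsmall ?_⟩
      split_ifs <;> omega
    · rw [hne _ (by norm_num)] at h ⊢
      obtain ⟨p, rfl⟩ := initialState_one_ne_zero G T k ℓ h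
      have := pairIndex_lt p
      refine ⟨by norm_num, by omega, hsmall ?_⟩
      classical
      rw [zero_add, initialState_one]
      split_ifs <;> omega
    · rw [hne _ (by norm_num)] at h ⊢
      simp only [zero_add, Nat.reduceAdd, initialState_two] at h ⊢
      have := T.parentCode_le i
      have : i < n := by
        by_contra hi
        rw [RootedForest.parentCode, dif_neg hi] at h
        exact h rfl
      exact ⟨by norm_num, by omega, hsmall (by omega)⟩
    · rw [hne _ (by omega), initialState_ge_three _ _ _ _ (by omega)] at h
      exact absurd rfl h
  · rw [hne 2 (by norm_num), initialState_two]
  · rw [h0, if_neg h1, if_neg h2, if_neg h3]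
  · rw [hne a (by omega), initialState_ge_three _ _ _ _ ha]

/-- The start memory arises from a bounded one by writing `k` and `ℓ`; the `3` is for the addresses
of these two cells. -/
theorem bits_initialState_le :
    (initialState G T k ℓ).mem.bits ≤ spaceBound (cellBound n) + (3 + Nat.size k + Nat.size ℓ) := by
  have h : (initialState G T k ℓ).mem
      = ((truncatedMemory G T k ℓ 0 0).update (0, 1) k).update (0, 2) ℓ := by
    ext ⟨a, i⟩
    by_cases h2 : ((a, i) : ℕ × ℕ) = (0, 2)
    · rw [h2, initialState_zero]; simp
    · by_cases h1 : ((a, i) : ℕ × ℕ) = (0, 1)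
      · rw [h1, initialState_zero]; simp
      · rw [Finsupp.coe_update, Function.update_of_ne h2, Finsupp.coe_update,
          Function.update_of_ne h1, truncatedMemory, Finsupp.coe_update, Function.update_of_ne h2,
          Finsupp.coe_update, Function.update_of_ne h1]
  have hb := (inputMemory_truncatedMemory G T k ℓ (Nat.zero_le n) (Nat.zero_le (n + 1))).bdd.bits_le
  have h1 := (truncatedMemory G T k ℓ 0 0).bits_update_le (0, 1) k
  have h2 := Memory.bits_update_le ((truncatedMemory G T k ℓ 0 0).update (0, 1) k) (0, 2) ℓ
  rw [h]
  simp only [Nat.size_zero, Nat.size_one, show Nat.size 2 = 2 from rfl] at h1 h2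
  omega

end InitialState

/-! ### The algorithm -/

/-- The algorithm: truncate the numbers in the input, and run the main part. -/
def Prog.main : Prog :=
  -- With truncated subtraction `x - (x - y)` is the minimum of `x` and `y`.
  .seq (.assign 0 1 (.scalar 1 - (.scalar 1 - .scalar 0))) <|
  .seq (.assign 0 2 (.scalar 2 - (.scalar 2 - (.scalar 0 + 1)))) .core

section Main

variable {n : ℕ} (G : SimpleGraph (Fin n)) (T : RootedForest (Fin n)) (k ℓ : ℕ)

/-- The number of instructions of the main part. -/
def coreSteps (n N : ℕ) : ℕ :=
  n * n * (coinLength n * 4 + 5) + 24 * cellBound n + N * (n * 3 + 11) + 45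

/-- The two truncating instructions are charged by hand, since `k` and `ℓ` may exceed any bound in
terms of `n`; this is the source of the additive term in their lengths. From then on the memory is
bounded and `run_core` applies. -/
theorem exec_main (hT : T.IsEliminationForest G) (ω : ℕ → Bool) :
    ∃ t m s', Exec ω .main (initialState G T k ℓ) t m s' ∧
      t ≤ Prog.core.weight * cellBound n * coreSteps n (4 ^ T.depth * (n + 1) ^ 2)
        + 100 * (n + 1 + Nat.size k + Nat.size ℓ) ∧
      m ≤ spaceBound (cellBound n) + Prog.core.weight * cellBound n
        + 100 * (n + 1 + Nat.size k + Nat.size ℓ) ∧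
      (s'.mem (0, 0) = 1 ↔ Accepts G ω (min k n) (min ℓ (n + 1))) := by
  classical
  have hk : k - (k - n) = min k n := by omega
  have hl : ℓ - (ℓ - (n + 1)) = min ℓ (n + 1) := by omega
  set s := initialState G T k ℓ with hs
  have e0 : s.mem (0, 0) = n := initialState_zero G T k ℓ 0
  have e1 : s.mem (0, 1) = k := initialState_zero G T k ℓ 1
  have e2 : s.mem (0, 2) = ℓ := initialState_zero G T k ℓ 2
  have hr1 := Exec.assign (ω := ω) s 0 1 (.scalar 1 - (.scalar 1 - .scalar 0))
  simp only [Expr.val_ofNat, Expr.val_sub, Expr.val_scalar, e0, e1, hk] at hr1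
  let s1 : State := ⟨s.mem.update (0, 1) (min k n), s.tossed⟩
  have f0 : s1.mem (0, 0) = n := by simp [s1, e0]
  have f2 : s1.mem (0, 2) = ℓ := by simp [s1, e2]
  have hr2 := Exec.assign (ω := ω) s1 0 2 (.scalar 2 - (.scalar 2 - (.scalar 0 + 1)))
  simp only [Expr.val_ofNat, Expr.val_sub, Expr.val_add, Expr.val_scalar, f0, f2, hl] at hr2
  have hin := inputMemory_truncatedMemory G T k ℓ (k' := min k n) (ℓ' := min ℓ (n + 1))
    (by omega) (by omega)
  obtain ⟨s3, ⟨t, m, hr3, ht, hm⟩, hans⟩ := run_core (ω := ω) (by omega) (by omega)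
    (fun c _ => T.parentCode_le c) (s := ⟨truncatedMemory G T k ℓ (min k n) (min ℓ (n + 1)), 0⟩)
    hin rfl (N := 4 ^ T.depth * (n + 1) ^ 2) (P := resultValue G ω) fun W hW =>
      search_result G T hT
        (fun p hp => by simp only [initialState_one, if_pos hp])
        (fun p hp => by simp only [initialState_one, if_neg hp]) hW
  have b0 := bits_initialState_le G T k ℓ
  rw [← hs] at b0
  have b1 := s.mem.bits_update_le (0, 1) (min k n)
  have k1 : Nat.size (min k n) ≤ Nat.size k := Nat.size_le_size (by omega)
  have k2 : Nat.size (k - n) ≤ Nat.size k := Nat.size_le_size (by omega)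
  have l1 : Nat.size (min ℓ (n + 1)) ≤ Nat.size ℓ := Nat.size_le_size (by omega)
  have l2 : Nat.size (ℓ - (n + 1)) ≤ Nat.size ℓ := Nat.size_le_size (by omega)
  have n1 : Nat.size n ≤ n := Nat.size_le.2 Nat.lt_two_pow_self
  have n2 : Nat.size (n + 1) ≤ n + 1 := Nat.size_le.2 Nat.lt_two_pow_self
  have c1 : (1 : Expr).cost s.mem + (.scalar 1 - (.scalar 1 - .scalar 0) : Expr).cost s.mem
      ≤ 20 + 4 * Nat.size k + n := by
    change (1 + Nat.size 1) + (((1 + Nat.size 1) + (1 + Nat.size 0 + Nat.size (s.mem (0, 1))))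
      + (((1 + Nat.size 1) + (1 + Nat.size 0 + Nat.size (s.mem (0, 1))))
        + ((1 + Nat.size 0) + (1 + Nat.size 0 + Nat.size (s.mem (0, 0))))
        + (1 + Nat.size (s.mem (0, 1) - s.mem (0, 0))))
      + (1 + Nat.size (s.mem (0, 1) - (s.mem (0, 1) - s.mem (0, 0))))) ≤ _
    rw [e0, e1, hk, Nat.size_zero, Nat.size_one]
    omega
  have c2 : (2 : Expr).cost s1.mem
      + (.scalar 2 - (.scalar 2 - (.scalar 0 + 1)) : Expr).cost s1.mem
      ≤ 30 + 4 * Nat.size ℓ + 2 * n := by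
    change (1 + Nat.size 2) + (((1 + Nat.size 2) + (1 + Nat.size 0 + Nat.size (s1.mem (0, 2))))
      + (((1 + Nat.size 2) + (1 + Nat.size 0 + Nat.size (s1.mem (0, 2))))
        + (((1 + Nat.size 0) + (1 + Nat.size 0 + Nat.size (s1.mem (0, 0)))) + (1 + Nat.size 1)
          + (1 + Nat.size (s1.mem (0, 0) + 1)))
        + (1 + Nat.size (s1.mem (0, 2) - (s1.mem (0, 0) + 1))))
      + (1 + Nat.size (s1.mem (0, 2) - (s1.mem (0, 2) - (s1.mem (0, 0) + 1))))) ≤ _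
    rw [f0, f2, hl, Nat.size_zero, Nat.size_one, show Nat.size 2 = 2 from rfl]
    omega
  simp only [Nat.size_zero, Nat.size_one] at b1
  refine ⟨_, _, s3, hr1.seq (hr2.seq hr3), ?_, ?_, ?_⟩
  · rw [Nat.size_zero, coreSteps]
    omega
  · have b1' : s1.mem.bits ≤ s.mem.bits + (0 + 1 + Nat.size (min k n)) := b1
    rw [Nat.size_zero]
    omega
  · rw [hans, Accepts]
    split_ifs with h
    · exact iff_of_true rfl h
    · exact iff_of_false (by norm_num) h

-- `AnswersYes` asks for some halting run; determinism identifies it with the run constructed in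
-- `exec_main`.
variable {G k ℓ} in
theorem answersYes_iff (hT : T.IsEliminationForest G) (ω : ℕ → Bool) :
    AnswersYes .main (initialState G T k ℓ) ω ↔ Accepts G ω (min k n) (min ℓ (n + 1)) := by
  obtain ⟨t, m, s', h, -, -, hiff⟩ := exec_main G T k ℓ hT ω
  rw [← hiff]
  constructor
  · rintro ⟨t₂, m₂, s₂, h₂, hyes⟩
    rwa [h.deterministic h₂]
  · exact fun hyes => ⟨t, m, s', h, hyes⟩

/-! ### The running time -/

theorem cellBound_le_pow (n : ℕ) : cellBound n ≤ 42 * (n + 1) ^ 9 := by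
  have hw : weightBound n ≤ 5 * (n + 1) ^ 4 := by
    rw [weightBound]
    have := Nat.mul_le_mul_left (n * n) (two_pow_coinLength_le (n := n))
    have : n * n * (4 * n * n + 1) + 1 ≤ 5 * (n + 1) ^ 4 := by
      ring_nf
      nlinarith [Nat.zero_le (n ^ 3), Nat.zero_le (n ^ 2), Nat.zero_le (n ^ 4), Nat.zero_le n]
    omega
  have h1 : 2 * n * n + 1 ≤ 2 * (n + 1) ^ 2 := by nlinarith
  have h2 : n + 2 ≤ 2 * (n + 1) := by omega
  have h3 : n * n + 1 ≤ (n + 1) ^ 2 := by nlinarith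
  have h4 : modulusLength n ≤ 20 * (n + 1) ^ 9 := by
    -- The exponent `9` is `2 + 4 + 1 + 2`, one summand for each factor of `modulusLength`.
    calc modulusLength n ≤ 2 * (n + 1) ^ 2 * (5 * (n + 1) ^ 4) * (2 * (n + 1)) * (n + 1) ^ 2 := by
          rw [modulusLength]; gcongr
      _ = 20 * (n + 1) ^ 9 := by ring
  have h5 : (n + 1) ^ 2 ≤ (n + 1) ^ 9 := Nat.pow_le_pow_right (by omega) (by norm_num)
  have h6 : (n + 1) ^ 1 ≤ (n + 1) ^ 9 := Nat.pow_le_pow_right (by omega) (by norm_num)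
  rw [pow_one] at h6
  rw [cellBound]
  omega

theorem coreSteps_le_pow (n d : ℕ) :
    coreSteps n (4 ^ d * (n + 1) ^ 2) ≤ 2000 * (4 ^ d * (n + 1) ^ 9) := by
  have hpow : ∀ j ≤ 9, (n + 1) ^ j ≤ 4 ^ d * (n + 1) ^ 9 := fun j hj =>
    (Nat.pow_le_pow_right (by omega) hj).trans (Nat.le_mul_of_pos_left _ (by positivity))
  have h1 : coinLength n * 4 + 5 ≤ 13 * (n + 1) ^ 2 := by
    have : coinLength n ≤ 2 * n * n := Nat.size_le.2 Nat.lt_two_pow_self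
    nlinarith
  have h2 : n * n * (coinLength n * 4 + 5) ≤ 13 * (n + 1) ^ 4 := by
    calc n * n * (coinLength n * 4 + 5) ≤ (n + 1) * (n + 1) * (13 * (n + 1) ^ 2) := by
          gcongr <;> omega
      _ = 13 * (n + 1) ^ 4 := by ring
  have h3 : 4 ^ d * (n + 1) ^ 2 * (n * 3 + 11) ≤ 11 * (4 ^ d * (n + 1) ^ 9) := by
    calc 4 ^ d * (n + 1) ^ 2 * (n * 3 + 11) ≤ 4 ^ d * (n + 1) ^ 2 * (11 * (n + 1)) := by
          gcongr; omega
      _ = 11 * (4 ^ d * (n + 1) ^ 3) := by ring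
      _ ≤ 11 * (4 ^ d * (n + 1) ^ 9) := by
          gcongr
          · omega
          · norm_num
  have h4 := cellBound_le_pow n
  have h5 := hpow 4 (by norm_num)
  have h6 := hpow 9 le_rfl
  have h7 := hpow 0 (by norm_num)
  rw [coreSteps]
  simp only [pow_zero] at h7
  omega

/-- Nine powers of `n + 1` come from the cost of an instruction and nine from the number of
instructions. -/
theorem time_le (w n d a b : ℕ) :
    w * cellBound n * coreSteps n (4 ^ d * (n + 1) ^ 2) + 100 * (n + 1 + a + b)
      ≤ 200000 * (w + 1) * 4 ^ d * (n + 1) ^ 18 + 200000 * (w + 1) * (a + b) := by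
  have h1 := cellBound_le_pow n
  have h2 := coreSteps_le_pow n d
  have h3 : n + 1 ≤ 4 ^ d * (n + 1) ^ 18 :=
    (Nat.le_self_pow (by norm_num) _).trans (Nat.le_mul_of_pos_left _ (by positivity))
  calc _ ≤ w * (42 * (n + 1) ^ 9) * (2000 * (4 ^ d * (n + 1) ^ 9))
        + 100 * (4 ^ d * (n + 1) ^ 18 + a + b) := by gcongr
    _ = (84000 * w + 100) * (4 ^ d * (n + 1) ^ 18) + 100 * (a + b) := by ring
    _ ≤ (200000 * (w + 1)) * (4 ^ d * (n + 1) ^ 18) + (200000 * (w + 1)) * (a + b) := by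
      gcongr <;> omega
    _ = _ := by ring

/-- The space is quadratic in `cellBound n`: the number of cells times their length. This again
gives the exponent `18`. -/
theorem space_le (w n a b : ℕ) :
    spaceBound (cellBound n) + w * cellBound n + 100 * (n + 1 + a + b)
      ≤ 200000 * (w + 1) * (n + 1) ^ 18 + 200000 * (w + 1) * (a + b) := by
  have h1 := cellBound_le_pow n
  have h3 : n + 1 ≤ (n + 1) ^ 18 := Nat.le_self_pow (by norm_num) _
  have h4 : (n + 1) ^ 9 ≤ (n + 1) ^ 18 := Nat.pow_le_pow_right (by omega) (by norm_num)
  have h5 : 1 ≤ (n + 1) ^ 9 := Nat.one_le_pow _ _ (by omega)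
  have h6 : (n + 1) ^ 18 = (n + 1) ^ 9 * (n + 1) ^ 9 := by rw [← pow_add]
  generalize (n + 1) ^ 18 = y at *
  generalize (n + 1) ^ 9 = x at *
  have h7 : spaceBound (cellBound n) ≤ 16 * (42 * x) * (5 * x + 42 * x + 42 * x) := by
    rw [spaceBound]
    gcongr
    omega
  have h8 : w * cellBound n ≤ w * (42 * y) := by
    gcongr
    omega
  have h9 : 16 * (42 * x) * (5 * x + 42 * x + 42 * x) = 59808 * y := by rw [h6]; ring
  have h10 : 200000 * (w + 1) * y = 200000 * (w * y) + 200000 * y := by ring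
  have h11 : 200000 * (w + 1) * (a + b) = 200000 * (w * (a + b)) + 200000 * (a + b) := by ring
  have h12 : w * (42 * y) = 42 * (w * y) := by ring
  omega

end Main

end PartialCycleCover

/-! ### The main theorem. -/

theorem mainTheorem3 :
    ∃ (P : PartialCycleCover.Prog) (A c : ℕ),
      ∀ (n : ℕ) (G : SimpleGraph (Fin n)) (T : PartialCycleCover.RootedForest (Fin n)) (k ℓ : ℕ),
        G.IsBipartite → T.IsEliminationForest G →
          -- time and space, for all outcomes of the coin tosses
          (∀ ω : ℕ → Bool, ∃ (t m : ℕ) (s' : PartialCycleCover.State),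
            PartialCycleCover.Exec ω P (PartialCycleCover.initialState G T k ℓ) t m s' ∧
            t ≤ A * 4 ^ T.depth * (n + 1) ^ c + A * (Nat.size k + Nat.size ℓ) ∧
            m ≤ A * (n + 1) ^ c + A * (Nat.size k + Nat.size ℓ)) ∧
          -- no false positives
          (¬ PartialCycleCover.HasPartialCycleCover G k ℓ →
            ∀ ω : ℕ → Bool,
              ¬ PartialCycleCover.AnswersYes P (PartialCycleCover.initialState G T k ℓ) ω) ∧
          -- false negatives have probability at most one half
          (PartialCycleCover.HasPartialCycleCover G k ℓ →
            PartialCycleCover.coinMeasure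
              {ω | ¬ PartialCycleCover.AnswersYes P (PartialCycleCover.initialState G T k ℓ) ω}
                ≤ 1 / 2) := by
  open PartialCycleCover in
  refine ⟨.main, 200000 * (Prog.core.weight + 1), 18, fun n G T k ℓ hG hT =>
    ⟨fun ω => ?_, fun hno ω => ?_, fun hyes => ?_⟩⟩
  · obtain ⟨t, m, s', h, ht, hm, -⟩ := exec_main G T k ℓ hT ω
    exact ⟨t, m, s', h, ht.trans (time_le _ _ _ _ _), hm.trans (space_le _ _ _ _)⟩
  · rw [answersYes_iff T hT]
    intro h
    exact hno ((hasPartialCycleCover_min k ℓ).1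
      (hasPartialCycleCover_of_accepts hG (min_le_right _ _) h))
  · simp only [answersYes_iff T hT]
    exact coinMeasure_not_accepts_le hG (min_le_right _ _) ((hasPartialCycleCover_min k ℓ).2 hyes)
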